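/- Let $L>0$, let $\mathbb T=\mathbb R/L\mathbb Z$, and let $|\cdot|$ be the norm of $L^2(\mathbb T)$ (real-valued functions). Put $$H=\Big\{\varphi\in L^2(\mathbb T):\int_{\mathbb T}\varphi\,dx=0\Big\},\qquad V=\{\varphi\in H:\varphi_x\in L^2(\mathbb T)\},$$ where $H$ carries the norm $|\cdot|$ and $V$ the norm $(|\varphi|^2+|\varphi_x|^2)^{1/2}$ ($\varphi_x$ is the weak derivative), and let $V'$ be the dual of $V$. Let $\nu>0$, $\beta\in\mathbb R$, $\gamma\neq 0$ and $f\in V'$, and consider the KdV-Burgers-Sivashinsky equation $$u_t-\nu u_{xx}+uu_x-\beta u+\gamma u_{xxx}=f,\qquad x\in\mathbb T,\ t>0,\qquad u(0)=u_0 .$$ A solution with initial value $u_0\in H$ is a function $u\in C([0,\infty);H)\cap L^2_{loc}([0,\infty);V)$ such that, for every $t\ge 0$ and every smooth $\varphi:\mathbb T\to\mathbb R$ of mean zero, $$\int_{\mathbb T}u(t)\varphi\,dx=\int_{\mathbb T}u_0\varphi\,dx+\int_0^t\Big(\int_{\mathbb T}\big(\nu u\varphi_{xx}+\tfrac12u^2\varphi_x+\beta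 u\varphi+\gamma u\varphi_{xxx}\big)dx+\langle f,\varphi\rangle\Big)ds .$$ For every $u_0\in H$ there is exactly one such solution, and $S(t)u_0:=u(t)$, $t\ge0$, defines the solution semigroup $S(t):H\to H$. For every $t'>0$ there is $r(t')>0$ (depending only on $t'$, $L$, $\nu$, $\beta$, $\gamma$ and $f$) such that $$|S(t)u_0|<r(t')\qquad\text{for all }u_0\in H\text{ and all }t\ge t'.$$ Consequently, for every $t>0$ the set $S(t)H$ is not dense in $H$. -/

import Mathlib

open MeasureTheory

noncomputable section

namespace KBS

/-- Real square-integrable functions on the torus `ℝ / Lℤ`, with Lebesgue measure of total mass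
`L`. -/
abbrev L2 (L : ℝ) [Fact (0 < L)] : Type := Lp ℝ 2 (volume : Measure (AddCircle L))

/-- The `k`-th derivative of a function on the torus. -/
def torusDeriv {L : ℝ} (k : ℕ) (φ : AddCircle L → ℝ) (x : AddCircle L) : ℝ :=
  iteratedDeriv k (fun y : ℝ => φ (x + (y : AddCircle L))) 0

/-- Smooth functions on the torus, that is, smooth `L`-periodic functions on the line. -/
def IsSmooth {L : ℝ} (φ : AddCircle L → ℝ) : Prop :=
  ContDiff ℝ (⊤ : ℕ∞) (fun y : ℝ => φ (y : AddCircle L))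

/-- The function `w` is the weak derivative of `u` on the torus. -/
def HasWeakDeriv {L : ℝ} [Fact (0 < L)] (u w : L2 L) : Prop :=
  ∀ φ : AddCircle L → ℝ, IsSmooth φ → ∫ x, u x * torusDeriv 1 φ x = - ∫ x, w x * φ x

theorem torusDeriv_coe {L : ℝ} (k : ℕ) (φ : AddCircle L → ℝ) (a : ℝ) :
    torusDeriv k φ (a : AddCircle L) =
      iteratedDeriv k (fun y : ℝ => φ (y : AddCircle L)) a := by
  have h := iteratedDeriv_comp_const_add k (fun y : ℝ => φ (y : AddCircle L)) a
  have h0 := congrFun h 0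
  simp only [add_zero] at h0
  rw [← h0]
  simp only [torusDeriv, AddCircle.coe_add]

theorem continuous_of_coe {L : ℝ} {g : AddCircle L → ℝ}
    (h : Continuous (fun y : ℝ => g (y : AddCircle L))) : Continuous g :=
  continuous_coinduced_dom.2 h

theorem IsSmooth.continuous {L : ℝ} {φ : AddCircle L → ℝ} (h : IsSmooth φ) : Continuous φ :=
  continuous_of_coe (ContDiff.continuous h)

theorem IsSmooth.continuous_torusDeriv {L : ℝ} {φ : AddCircle L → ℝ} (h : IsSmooth φ) (k : ℕ) :
    Continuous (torusDeriv k φ) := by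
  refine continuous_of_coe ?_
  simp only [torusDeriv_coe]
  exact ContDiff.continuous_iteratedDeriv k h (by exact_mod_cast le_top)

theorem memLp_of_continuous {L : ℝ} [Fact (0 < L)] {g : AddCircle L → ℝ} (h : Continuous g) :
    MemLp g 2 (volume : Measure (AddCircle L)) := by
  obtain ⟨C, hC⟩ := isCompact_univ.exists_bound_of_continuousOn h.continuousOn
  exact MemLp.of_bound h.aestronglyMeasurable C (Filter.Eventually.of_forall fun x =>
    hC x (Set.mem_univ x))

theorem integrable_L2 {L : ℝ} [Fact (0 < L)] (u : L2 L) : Integrable (fun x => u x) :=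
  (Lp.memLp u).integrable one_le_two

theorem integrable_L2_mul {L : ℝ} [Fact (0 < L)] (u : L2 L) {g : AddCircle L → ℝ}
    (h : Continuous g) : Integrable (fun x => u x * g x) :=
  MemLp.integrable_mul (Lp.memLp u) (memLp_of_continuous h)

theorem integral_add_mul {L : ℝ} [Fact (0 < L)] (u v : L2 L) {g : AddCircle L → ℝ}
    (h : Continuous g) : ∫ x, (u + v) x * g x = (∫ x, u x * g x) + ∫ x, v x * g x := by
  rw [← integral_add (integrable_L2_mul u h) (integrable_L2_mul v h)]
  refine integral_congr_ae ?_
  filter_upwards [Lp.coeFn_add u v] with x hx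
  simp only [hx, Pi.add_apply, add_mul]

theorem integral_smul_mul {L : ℝ} [Fact (0 < L)] (c : ℝ) (u : L2 L) (g : AddCircle L → ℝ) :
    ∫ x, (c • u) x * g x = c * ∫ x, u x * g x := by
  rw [← integral_const_mul]
  refine integral_congr_ae ?_
  filter_upwards [Lp.coeFn_smul c u] with x hx
  simp only [hx, Pi.smul_apply, smul_eq_mul, mul_assoc]

theorem integral_zero_mul {L : ℝ} [Fact (0 < L)] (g : AddCircle L → ℝ) :
    ∫ x, (0 : L2 L) x * g x = 0 := by
  have := integral_smul_mul (0 : ℝ) (0 : L2 L) g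
  simpa only [zero_smul, zero_mul] using this

theorem HasWeakDeriv.zero {L : ℝ} [Fact (0 < L)] : HasWeakDeriv (0 : L2 L) 0 := by
  intro φ _
  rw [integral_zero_mul, integral_zero_mul, neg_zero]

theorem HasWeakDeriv.add {L : ℝ} [Fact (0 < L)] {u v u' v' : L2 L} (hu : HasWeakDeriv u u')
    (hv : HasWeakDeriv v v') : HasWeakDeriv (u + v) (u' + v') := by
  intro φ hφ
  rw [integral_add_mul u v (hφ.continuous_torusDeriv 1), integral_add_mul u' v' hφ.continuous,
    hu φ hφ, hv φ hφ]
  ring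

theorem HasWeakDeriv.smul {L : ℝ} [Fact (0 < L)] {u u' : L2 L} (c : ℝ)
    (hu : HasWeakDeriv u u') : HasWeakDeriv (c • u) (c • u') := by
  intro φ hφ
  rw [integral_smul_mul, integral_smul_mul, hu φ hφ]
  ring

/-- The phase space: square-integrable functions of mean zero, with the `L²` norm. -/
def H (L : ℝ) [Fact (0 < L)] : Submodule ℝ (L2 L) where
  carrier := {u | ∫ x, u x = 0}
  zero_mem' := by
    have := integral_zero_mul (L := L) (fun _ => 1)
    simp only [mul_one] at this
    exact this
  add_mem' := by
    intro u v hu hv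
    have := integral_add_mul u v (g := fun _ => 1) continuous_const
    simp only [mul_one] at this
    change ∫ x, u x = 0 at hu
    change ∫ x, v x = 0 at hv
    change ∫ x, (u + v) x = 0
    rw [this, hu, hv, add_zero]
  smul_mem' := by
    intro c u hu
    have := integral_smul_mul c u (fun _ => 1)
    simp only [mul_one] at this
    change ∫ x, u x = 0 at hu
    change ∫ x, (c • u) x = 0
    rw [this, hu, mul_zero]

/-- The energy space of mean-zero functions with a square-integrable weak derivative, as the space
of pairs `(φ, φ_x)`; the norm is `(|φ|² + |φ_x|²)^(1/2)`. Its dual is `StrongDual ℝ (V L)`. -/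
def V (L : ℝ) [Fact (0 < L)] : Submodule ℝ (WithLp 2 (L2 L × L2 L)) where
  carrier := {p | p.fst ∈ H L ∧ HasWeakDeriv p.fst p.snd}
  zero_mem' := ⟨(H L).zero_mem, HasWeakDeriv.zero⟩
  add_mem' := fun hp hq => ⟨(H L).add_mem hp.1 hq.1, hp.2.add hq.2⟩
  smul_mem' := fun c _ hp => ⟨(H L).smul_mem c hp.1, hp.2.smul c⟩

/-- Integration by parts for smooth functions on the torus. -/
theorem integral_mul_torusDeriv {L : ℝ} [Fact (0 < L)] {φ ψ : AddCircle L → ℝ}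
    (hφ : IsSmooth φ) (hψ : IsSmooth ψ) :
    ∫ x, φ x * torusDeriv 1 ψ x = - ∫ x, torusDeriv 1 φ x * ψ x := by
  rw [← AddCircle.intervalIntegral_preimage L 0 (fun x => φ x * torusDeriv 1 ψ x),
    ← AddCircle.intervalIntegral_preimage L 0 (fun x => torusDeriv 1 φ x * ψ x)]
  simp only [torusDeriv_coe, iteratedDeriv_one]
  have hd : ∀ {χ : AddCircle L → ℝ}, IsSmooth χ → ∀ x : ℝ,
      HasDerivAt (fun y : ℝ => χ (y : AddCircle L))
        (deriv (fun y : ℝ => χ (y : AddCircle L)) x) x := fun {χ} h x =>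
    (ContDiff.differentiable h (by simp)).differentiableAt.hasDerivAt
  have hc : ∀ {χ : AddCircle L → ℝ}, IsSmooth χ →
      Continuous (deriv (fun y : ℝ => χ (y : AddCircle L))) := fun {χ} h =>
    ContDiff.continuous_deriv h (by exact_mod_cast le_top)
  rw [intervalIntegral.integral_mul_deriv_eq_deriv_mul (fun x _ => hd hφ x) (fun x _ => hd hψ x)
    ((hc hφ).intervalIntegrable _ _) ((hc hψ).intervalIntegrable _ _)]
  simp only [zero_add, AddCircle.coe_period, QuotientAddGroup.mk_zero, sub_self, zero_sub]

/-- Smooth functions of mean zero on the torus: the test functions of the weak formulation. -/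
structure TestFunction (L : ℝ) [Fact (0 < L)] where
  toFun : AddCircle L → ℝ
  smooth : IsSmooth toFun
  mean_zero : ∫ x, toFun x = 0

/-- A test function as an element of the energy space. -/
def TestFunction.toV {L : ℝ} [Fact (0 < L)] (φ : TestFunction L) : V L :=
  ⟨WithLp.toLp 2 ((memLp_of_continuous φ.smooth.continuous).toLp φ.toFun,
      (memLp_of_continuous (φ.smooth.continuous_torusDeriv 1)).toLp (torusDeriv 1 φ.toFun)), by
    have h0 := (memLp_of_continuous φ.smooth.continuous).coeFn_toLp
    have h1 := (memLp_of_continuous (φ.smooth.continuous_torusDeriv 1)).coeFn_toLp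
    constructor
    · exact (integral_congr_ae h0).trans φ.mean_zero
    · intro ψ hψ
      have e0 : ∫ x, (memLp_of_continuous φ.smooth.continuous).toLp φ.toFun x * torusDeriv 1 ψ x
          = ∫ x, φ.toFun x * torusDeriv 1 ψ x :=
        integral_congr_ae (by filter_upwards [h0] with x hx; rw [hx])
      have e1 : ∫ x, (memLp_of_continuous (φ.smooth.continuous_torusDeriv 1)).toLp
            (torusDeriv 1 φ.toFun) x * ψ x = ∫ x, torusDeriv 1 φ.toFun x * ψ x :=
        integral_congr_ae (by filter_upwards [h1] with x hx; rw [hx])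
      exact e0.trans ((integral_mul_torusDeriv φ.smooth hψ).trans (congrArg Neg.neg e1.symm))⟩

/-- The equation `u_t = ν u_xx - u u_x + β u - γ u_xxx + f`, evaluated at `w` and tested
with `φ`; all the derivatives are moved to `φ`. -/
def weakRHS {L : ℝ} [Fact (0 < L)] (ν β γ : ℝ) (f : StrongDual ℝ (V L)) (w : L2 L)
    (φ : TestFunction L) : ℝ :=
  ν * (∫ x, w x * torusDeriv 2 φ.toFun x) + (1 / 2) * (∫ x, w x ^ 2 * torusDeriv 1 φ.toFun x)
    + β * (∫ x, w x * φ.toFun x) + γ * (∫ x, w x * torusDeriv 3 φ.toFun x) + f φ.toV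

/-- The function `u`, restricted to `[0, ∞)`, is a weak solution, in `C([0, ∞); H)` and
`L²_loc([0, ∞); V)`, of `u_t - ν u_xx + u u_x - β u + γ u_xxx = f` with `u(0) = u₀`.
The values of `u` at negative times play no role. -/
structure IsSolution {L : ℝ} [Fact (0 < L)] (ν β γ : ℝ) (f : StrongDual ℝ (V L)) (u₀ : H L)
    (u : ℝ → H L) : Prop where
  initial : u 0 = u₀
  continuousOn : ContinuousOn u (Set.Ici 0)
  memL2V : ∃ v : ℝ → V L,
    (∀ᵐ t ∂(volume.restrict (Set.Ioi (0 : ℝ))), (v t : WithLp 2 (L2 L × L2 L)).fst = u t) ∧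
      ∀ T : ℝ, 0 < T → MemLp v 2 (volume.restrict (Set.Ioc 0 T))
  weak : ∀ φ : TestFunction L, ∀ t : ℝ, 0 ≤ t →
    ∫ x, (u t : L2 L) x * φ.toFun x =
      (∫ x, (u₀ : L2 L) x * φ.toFun x) + ∫ s in (0 : ℝ)..t, weakRHS ν β γ f (u s) φ

/-- The family `S t`, `t ≥ 0`, is the solution semigroup on `H`: for every `u₀` in `H` the
function `t ↦ S t u₀` is a solution starting at `u₀`, and the only one on `[0, ∞)`. -/
def IsSolutionSemigroup {L : ℝ} [Fact (0 < L)] (ν β γ : ℝ) (f : StrongDual ℝ (V L))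
    (S : ℝ → H L → H L) : Prop :=
  ∀ u₀ : H L, IsSolution ν β γ f u₀ (fun t => S t u₀) ∧
    ∀ u : ℝ → H L, IsSolution ν β γ f u₀ u → ∀ t : ℝ, 0 ≤ t → u t = S t u₀

end KBS

end

/-!
The solution semigroup is built from Galerkin approximations, and the absorbing ball is found for
these, with a radius that does not depend on the number of modes.

*Well-posedness.* On the torus every element of `V` is a bounded function (`SmoothH.agmon`), so the
difference of two right-hand sides, tested with the difference of the arguments, is controlled by
the viscosity up to a multiple of the square of the difference, with a factor that is integrable in
time (`rhs_sub_le`). For solutions this gives uniqueness (`solution_unique`). For the Galerkin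
approximations with `N` and `M ≥ N` modes it leaves the error of the truncation, which tends to zero
as `N` grows (`IsGalerkin.rhs_tail_le`); hence the approximations form a Cauchy sequence in
`C([0, T]; H) ∩ L²(0, T; V)` (`galerkin_cauchy`), no compactness argument is needed, and the limit
is a solution (`exists_solution_of_galerkin`).

*Decay at an arbitrary rate.* Energy alone does not yield decay, since transport conserves it and
`β` may be large. Subtract from `½ |u|²` the product `⟨u, φ⟩` with a profile `φ` (a Lyapunov
functional as in the work of Nicolaenko, Scheurer, Temam, Collet, Eckmann, Epstein, Stubbe and
Goodman on the Kuramoto-Sivashinsky equation). The transport term contributes `-½ ∫ u² φ_x`, which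
is `-½ λ |u|²` where `φ_x = λ`. By periodicity this slope has to be compensated somewhere: here
`φ_x = λ (1 - G)`, where `G` is a Fejér kernel, whose positivity and concentration are explicit.
Near the peak of `G` the viscosity controls the deviation of `u` from its mean, and the mean itself is
handled by a shift `s` of the profile: if `s' = ⟨u, φ_x⟩ / (2 λ L)`, then the derivative of the
functional gains the term `-⟨u, φ_x⟩² / (2 λ L)`, which is exactly what is needed
(`profile_coercive`). The outcome (`exists_decay`) is that, for every sufficiently large `λ`,
`|u(t₁)|² ≤ 4 exp (-λ (t₁ - t₀) / 4) |u(t₀)|² + C λ ^ 15`.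

*A bound independent of the initial value.* The constant depends polynomially on the rate, and the
rate is arbitrary. An energy of order `λ ^ 15` therefore falls to an energy of order `(λ / 2) ^ 15`
within a time of order `1 / λ`. Along `λ = Λ 2 ^ k`, with `k` descending to `0`, these times add up
to at most `144 / Λ`, whatever the first `k` is (`exists_time_of_decay`). The number of modes
needed depends on the size of the initial value, but the bound does not (`exists_uniform_bound`), so
that it passes to the solution. The range of `S t` then lies in a ball, and `H` is unbounded.
-/

noncomputable section

namespace KBS

section

/-! ### Smooth functions of mean zero -/

variable {L : ℝ}

theorem IsSmooth.torusDeriv_one {φ : AddCircle L → ℝ} (h : IsSmooth φ) :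
    IsSmooth (torusDeriv 1 φ) := by
  unfold IsSmooth
  simp only [torusDeriv_coe, iteratedDeriv_one]
  have h' : ContDiff ℝ ((⊤ : ℕ∞) + 1) (fun y : ℝ => φ (y : AddCircle L)) := h
  exact (contDiff_succ_iff_deriv.1 h').2.2

theorem torusDeriv_succ (k : ℕ) (φ : AddCircle L → ℝ) :
    torusDeriv (k + 1) φ = torusDeriv 1 (torusDeriv k φ) := by
  funext x
  obtain ⟨a, rfl⟩ := QuotientAddGroup.mk_surjective x
  simp only [torusDeriv_coe, iteratedDeriv_succ, iteratedDeriv_zero]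

theorem integrable_of_continuous [Fact (0 < L)] {g : AddCircle L → ℝ} (h : Continuous g) :
    Integrable g :=
  (memLp_of_continuous h).integrable one_le_two

theorem isSmooth_const (c : ℝ) : IsSmooth (fun _ : AddCircle L => c) := contDiff_const

/-- The smooth functions of mean zero, as a subspace of the space of all functions on the torus. -/
def smoothMeanZero (L : ℝ) [Fact (0 < L)] : Submodule ℝ (AddCircle L → ℝ) where
  carrier := {φ | IsSmooth φ ∧ ∫ x, φ x = 0}
  zero_mem' := ⟨isSmooth_const 0, by simp⟩
  add_mem' := fun {φ ψ} hφ hψ => ⟨ContDiff.add hφ.1 hψ.1, by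
    simp only [Pi.add_apply]
    rw [integral_add (integrable_of_continuous hφ.1.continuous)
      (integrable_of_continuous hψ.1.continuous), hφ.2, hψ.2, add_zero]⟩
  smul_mem' := fun c φ hφ => ⟨contDiff_const.smul hφ.1, by
    simp only [Pi.smul_apply, smul_eq_mul]
    rw [integral_const_mul, hφ.2, mul_zero]⟩

/-- The real vector space of smooth functions of mean zero on the torus. It is a type of its own,
not a coercion of `smoothMeanZero`, so that the operations below are available in dot notation. -/
def SmoothH (L : ℝ) [Fact (0 < L)] : Type := smoothMeanZero L

namespace SmoothH

variable [Fact (0 < L)]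

instance : AddCommGroup (SmoothH L) := inferInstanceAs (AddCommGroup (smoothMeanZero L))

instance : Module ℝ (SmoothH L) := inferInstanceAs (Module ℝ (smoothMeanZero L))

theorem add_val (φ ψ : SmoothH L) : (φ + ψ).1 = φ.1 + ψ.1 := rfl

theorem smul_val (c : ℝ) (φ : SmoothH L) : (c • φ).1 = c • φ.1 := rfl

theorem zero_val : (0 : SmoothH L).1 = 0 := rfl

theorem ext_coe {φ ψ : SmoothH L} (h : ∀ y : ℝ, φ.1 (y : AddCircle L) = ψ.1 (y : AddCircle L)) :
    φ = ψ := by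
  refine Subtype.ext (funext fun x => ?_)
  obtain ⟨a, rfl⟩ := QuotientAddGroup.mk_surjective x
  exact h a

theorem smooth (φ : SmoothH L) : IsSmooth φ.1 := φ.2.1

theorem mean_zero (φ : SmoothH L) : ∫ x, φ.1 x = 0 := φ.2.2

theorem continuous (φ : SmoothH L) : Continuous φ.1 := φ.smooth.continuous

theorem contDiff (φ : SmoothH L) : ContDiff ℝ (⊤ : ℕ∞) (fun y : ℝ => φ.1 (y : AddCircle L)) :=
  φ.2.1

theorem sum_apply {ι : Type*} (s : Finset ι) (φ : ι → SmoothH L) (x : AddCircle L) :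
    (∑ i ∈ s, φ i).1 x = ∑ i ∈ s, (φ i).1 x := by
  have h : (∑ i ∈ s, φ i).1 = ∑ i ∈ s, (φ i).1 := map_sum (smoothMeanZero L).subtype φ s
  rw [h, Finset.sum_apply]

/-- A smooth mean-zero function as a test function of the weak formulation. -/
def test (φ : SmoothH L) : TestFunction L := ⟨φ.1, φ.2.1, φ.2.2⟩

theorem hasDerivAt (φ : SmoothH L) (y : ℝ) :
    HasDerivAt (fun y : ℝ => φ.1 (y : AddCircle L)) (torusDeriv 1 φ.1 (y : AddCircle L)) y := by
  rw [torusDeriv_coe, iteratedDeriv_one]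
  exact (φ.contDiff.differentiable (by simp)).differentiableAt.hasDerivAt

theorem integral_torusDeriv (φ : SmoothH L) : ∫ x, torusDeriv 1 φ.1 x = 0 := by
  have h := integral_mul_torusDeriv (isSmooth_const (L := L) 1) φ.smooth
  have h0 : torusDeriv 1 (fun _ : AddCircle L => (1 : ℝ)) = fun _ => 0 := by
    funext x
    simp [torusDeriv]
  simpa [h0] using h

/-- Differentiation on smooth mean-zero functions. -/
def D : SmoothH L →ₗ[ℝ] SmoothH L where
  toFun φ := ⟨torusDeriv 1 φ.1, φ.smooth.torusDeriv_one, φ.integral_torusDeriv⟩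
  map_add' φ ψ := by
    refine ext_coe fun a => ?_
    exact (φ + ψ).hasDerivAt a |>.unique ((φ.hasDerivAt a).add (ψ.hasDerivAt a))
  map_smul' c φ := by
    refine ext_coe fun a => ?_
    exact (c • φ).hasDerivAt a |>.unique ((φ.hasDerivAt a).const_mul c)

theorem D_coe (φ : SmoothH L) : (D φ).1 = torusDeriv 1 φ.1 := rfl

theorem torusDeriv_two (φ : SmoothH L) : torusDeriv 2 φ.1 = (D (D φ)).1 := by
  rw [torusDeriv_succ, D_coe, D_coe]

theorem torusDeriv_three (φ : SmoothH L) : torusDeriv 3 φ.1 = (D (D (D φ))).1 := by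
  rw [torusDeriv_succ, D_coe, torusDeriv_two]

theorem hasDerivAt_D (φ : SmoothH L) (y : ℝ) :
    HasDerivAt (fun y : ℝ => φ.1 (y : AddCircle L)) ((D φ).1 (y : AddCircle L)) y :=
  φ.hasDerivAt y

/-- The class of a smooth mean-zero function in the phase space. -/
def toH : SmoothH L →ₗ[ℝ] H L where
  toFun φ := ⟨(memLp_of_continuous φ.continuous).toLp φ.1,
    (integral_congr_ae (memLp_of_continuous φ.continuous).coeFn_toLp).trans φ.mean_zero⟩
  map_add' _ _ := rfl
  map_smul' _ _ := rfl

theorem coe_toH (φ : SmoothH L) : ((toH φ : H L) : L2 L) =ᵐ[volume] φ.1 :=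
  (memLp_of_continuous φ.continuous).coeFn_toLp

/-- A smooth mean-zero function as an element of the energy space. -/
def toV : SmoothH L →ₗ[ℝ] V L where
  toFun φ := φ.test.toV
  map_add' φ ψ := by
    refine Subtype.ext ?_
    change WithLp.toLp 2 (((toH (φ + ψ) : H L) : L2 L), ((toH (D (φ + ψ)) : H L) : L2 L)) =
      WithLp.toLp 2 (((toH φ : H L) : L2 L), ((toH (D φ) : H L) : L2 L)) +
      WithLp.toLp 2 (((toH ψ : H L) : L2 L), ((toH (D ψ) : H L) : L2 L))
    simp only [map_add]
    rfl
  map_smul' c φ := by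
    refine Subtype.ext ?_
    change WithLp.toLp 2 (((toH (c • φ) : H L) : L2 L), ((toH (D (c • φ)) : H L) : L2 L)) =
      c • WithLp.toLp 2 (((toH φ : H L) : L2 L), ((toH (D φ) : H L) : L2 L))
    simp only [map_smul]
    rfl

theorem norm_toV_sq (φ : SmoothH L) : ‖toV φ‖ ^ 2 = ‖toH φ‖ ^ 2 + ‖toH (D φ)‖ ^ 2 :=
  WithLp.prod_norm_sq_eq_of_L2 (toV φ : WithLp 2 (L2 L × L2 L))

theorem inner_coe_eq_integral (u v : L2 L) : inner ℝ u v = ∫ x, u x * v x := by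
  rw [L2.inner_def]
  refine integral_congr_ae (Filter.Eventually.of_forall fun x => ?_)
  simp [mul_comm]

theorem inner_coe_toH (w : L2 L) (φ : SmoothH L) :
    inner ℝ w (toH φ : L2 L) = ∫ x, w x * φ.1 x := by
  rw [inner_coe_eq_integral]
  refine integral_congr_ae ?_
  filter_upwards [φ.coe_toH] with x hx
  rw [hx]

theorem inner_toH_right (w : H L) (φ : SmoothH L) :
    inner ℝ w (toH φ) = ∫ x, (w : L2 L) x * φ.1 x :=
  inner_coe_toH (w : L2 L) φ

theorem inner_toH (φ ψ : SmoothH L) : inner ℝ (toH φ) (toH ψ) = ∫ x, φ.1 x * ψ.1 x := by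
  rw [inner_toH_right]
  refine integral_congr_ae ?_
  filter_upwards [φ.coe_toH] with x hx
  rw [hx]

theorem norm_toH_sq (φ : SmoothH L) : ‖toH φ‖ ^ 2 = ∫ x, φ.1 x ^ 2 := by
  rw [← real_inner_self_eq_norm_sq, inner_toH]
  simp only [pow_two]

/-- Differentiation is skew-symmetric. -/
theorem inner_D (φ ψ : SmoothH L) :
    inner ℝ (toH φ) (toH (D ψ)) = - inner ℝ (toH (D φ)) (toH ψ) := by
  rw [inner_toH, inner_toH]
  exact integral_mul_torusDeriv φ.smooth ψ.smooth

theorem inner_self_D (φ : SmoothH L) : inner ℝ (toH φ) (toH (D φ)) = 0 := by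
  have h := inner_D φ φ
  rw [real_inner_comm (toH φ) (toH (D φ))] at h
  linarith

/-- The cubic form `∫ φ² ψ_x` is `-2 ∫ φ φ_x ψ`. -/
theorem integral_sq_mul_D (φ ψ : SmoothH L) :
    ∫ x, φ.1 x ^ 2 * (D ψ).1 x = - ∫ x, (2 * φ.1 x * (D φ).1 x) * ψ.1 x := by
  have hs : IsSmooth (fun x => φ.1 x ^ 2) := ContDiff.pow φ.contDiff 2
  have h := integral_mul_torusDeriv hs ψ.smooth
  have hd : torusDeriv 1 (fun x => φ.1 x ^ 2) = fun x => 2 * φ.1 x * (D φ).1 x := by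
    funext x
    obtain ⟨a, rfl⟩ := QuotientAddGroup.mk_surjective x
    rw [torusDeriv_coe, iteratedDeriv_one]
    have := ((φ.hasDerivAt_D a).pow 2).deriv
    exact this.trans (by simp)
  rw [hd] at h
  exact h

/-- The transport term conserves energy. -/
theorem integral_sq_mul_D_self (φ : SmoothH L) : ∫ x, φ.1 x ^ 2 * (D φ).1 x = 0 := by
  have h := integral_sq_mul_D φ φ
  have h2 : ∫ x, (2 * φ.1 x * (D φ).1 x) * φ.1 x = 2 * ∫ x, φ.1 x ^ 2 * (D φ).1 x := by
    rw [← integral_const_mul]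
    congr 1
    funext x
    ring
  linarith

/-- A smooth periodic function on the line with vanishing integral over a period descends to the
torus. -/
def ofPeriodic (g : ℝ → ℝ) (hp : Function.Periodic g L) (hs : ContDiff ℝ (⊤ : ℕ∞) g)
    (h0 : ∫ y in (0 : ℝ)..L, g y = 0) : SmoothH L :=
  ⟨hp.lift, hs, by
    rw [← AddCircle.intervalIntegral_preimage L 0 hp.lift, zero_add]
    exact h0⟩

theorem integral_eq (g : AddCircle L → ℝ) : ∫ x, g x = ∫ y in (0 : ℝ)..L, g (y : AddCircle L) := by
  rw [← AddCircle.intervalIntegral_preimage L 0 g, zero_add]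

end SmoothH

end

section

variable {L : ℝ} [Fact (0 < L)]

/-! ### Interpolation inequalities and trilinear forms -/

theorem sq_integral_mul_le {g h : AddCircle L → ℝ} (hg : Continuous g) (hh : Continuous h) :
    (∫ x, g x * h x) ^ 2 ≤ (∫ x, g x ^ 2) * ∫ x, h x ^ 2 := by
  have key : ∀ {a b : AddCircle L → ℝ} (ha : Continuous a) (hb : Continuous b),
      inner ℝ ((memLp_of_continuous ha).toLp a) ((memLp_of_continuous hb).toLp b) =
        ∫ x, a x * b x := by
    intro a b ha hb
    rw [SmoothH.inner_coe_eq_integral]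
    refine integral_congr_ae ?_
    filter_upwards [(memLp_of_continuous ha).coeFn_toLp, (memLp_of_continuous hb).coeFn_toLp]
      with x h1 h2
    rw [h1, h2]
  have h := real_inner_mul_inner_self_le ((memLp_of_continuous hg).toLp g)
    ((memLp_of_continuous hh).toLp h)
  rw [key hg hh, key hg hg, key hh hh] at h
  simpa only [pow_two] using h

theorem intervalIntegral_le_integral {g : AddCircle L → ℝ} (hg : Continuous g) (h0 : ∀ x, 0 ≤ g x)
    {a b : ℝ} (hab : a ≤ b) (hL : b - a ≤ L) :
    ∫ y in a..b, g (y : AddCircle L) ≤ ∫ x, g x := by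
  rw [← AddCircle.intervalIntegral_preimage L a g]
  have hc : Continuous fun y : ℝ => g (y : AddCircle L) := hg.comp (AddCircle.continuous_mk' L)
  refine intervalIntegral.integral_mono_interval le_rfl hab (by linarith)
    (Filter.Eventually.of_forall fun y => h0 _) (hc.intervalIntegrable _ _)

theorem sq_intervalIntegral_le {g : ℝ → ℝ} (hg : Continuous g) {a b : ℝ} (hab : a ≤ b) :
    (∫ y in a..b, g y) ^ 2 ≤ (b - a) * ∫ y in a..b, g y ^ 2 := by
  rcases hab.eq_or_lt with rfl | hlt
  · simp
  set I := ∫ y in a..b, g y with hI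
  have h : 0 ≤ ∫ y in a..b, (g y - I / (b - a)) ^ 2 :=
    intervalIntegral.integral_nonneg hab fun y _ => sq_nonneg _
  have h2 : ∫ y in a..b, (g y - I / (b - a)) ^ 2 =
      (∫ y in a..b, g y ^ 2) - 2 * (I / (b - a)) * I + (b - a) * (I / (b - a)) ^ 2 := by
    have : ∀ y, (g y - I / (b - a)) ^ 2 =
        g y ^ 2 - 2 * (I / (b - a)) * g y + (I / (b - a)) ^ 2 := fun y => by ring
    simp only [this]
    rw [intervalIntegral.integral_add, intervalIntegral.integral_sub,
      intervalIntegral.integral_const_mul, intervalIntegral.integral_const, smul_eq_mul, ← hI]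
    all_goals exact Continuous.intervalIntegrable (by fun_prop) _ _
  rw [h2] at h
  have hpos : 0 < b - a := sub_pos.2 hlt
  have h3 : (∫ y in a..b, g y ^ 2) - 2 * (I / (b - a)) * I + (b - a) * (I / (b - a)) ^ 2 =
      (∫ y in a..b, g y ^ 2) - I ^ 2 / (b - a) := by
    field_simp
    ring
  rw [h3, sub_nonneg, div_le_iff₀ hpos] at h
  linarith

namespace SmoothH

theorem norm_sq_eq (φ : SmoothH L) : ∫ x, φ.1 x ^ 2 = ‖toH φ‖ ^ 2 := (norm_toH_sq φ).symm

theorem integral_abs_mul_le (φ ψ : SmoothH L) :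
    ∫ x, |φ.1 x * ψ.1 x| ≤ ‖toH φ‖ * ‖toH ψ‖ := by
  have h := sq_integral_mul_le φ.continuous.abs ψ.continuous.abs
  simp only [sq_abs, norm_sq_eq, ← abs_mul, ← mul_pow] at h
  exact le_of_sq_le_sq h (by positivity)

theorem exists_eq_zero (φ : SmoothH L) : ∃ x, φ.1 x = 0 := by
  have hi := integrable_of_continuous φ.continuous
  have hne : (volume : Measure (AddCircle L)) ≠ 0 := NeZero.ne _
  have h1 := exists_le_average hne hi
  have h2 := exists_average_le hne hi
  have h0 : ⨍ x, φ.1 x = 0 := by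
    rw [average_eq, φ.mean_zero, smul_zero]
  rw [h0] at h1 h2
  exact mem_range_of_exists_le_of_exists_ge φ.continuous h1 h2

/-- A point of the torus has a representative in the period that follows a given real number. -/
theorem exists_coe_eq (a : ℝ) (x : AddCircle L) :
    ∃ b : ℝ, a ≤ b ∧ b - a ≤ L ∧ (b : AddCircle L) = x := by
  obtain ⟨y, rfl⟩ := QuotientAddGroup.mk_surjective x
  have hL : 0 < L := Fact.out
  refine ⟨toIcoMod hL a y, (toIcoMod_mem_Ico hL a y).1, ?_, ?_⟩
  · have := (toIcoMod_mem_Ico hL a y).2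
    linarith
  · rw [toIcoMod, AddCircle.coe_sub, AddCircle.coe_zsmul, AddCircle.coe_period, smul_zero, sub_zero]

/-- Agmon's inequality: mean-zero functions are bounded by the geometric mean of the norms of the
function and of its derivative. -/
theorem agmon (φ : SmoothH L) (x : AddCircle L) :
    φ.1 x ^ 2 ≤ 2 * (‖toH φ‖ * ‖toH (D φ)‖) := by
  obtain ⟨z, hz⟩ := φ.exists_eq_zero
  obtain ⟨a, rfl⟩ := QuotientAddGroup.mk_surjective z
  obtain ⟨b, hab, hL, rfl⟩ := exists_coe_eq a x
  have hc : Continuous fun x => |φ.1 x * (D φ).1 x| := (φ.continuous.mul (D φ).continuous).abs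
  have hF : ∫ y in a..b, 2 * φ.1 (y : AddCircle L) * (D φ).1 (y : AddCircle L) =
      φ.1 (b : AddCircle L) ^ 2 - φ.1 (a : AddCircle L) ^ 2 := by
    refine intervalIntegral.integral_eq_sub_of_hasDerivAt (f := fun y : ℝ =>
      φ.1 (y : AddCircle L) ^ 2) (fun y _ => ?_) ?_
    · exact ((φ.hasDerivAt_D y).pow 2).congr_deriv (by simp)
    · have h1 := φ.continuous.comp (AddCircle.continuous_mk' L)
      have h2 := (D φ).continuous.comp (AddCircle.continuous_mk' L)
      exact ((continuous_const.mul h1).mul h2).intervalIntegrable _ _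
  have hle : ∫ y in a..b, 2 * φ.1 (y : AddCircle L) * (D φ).1 (y : AddCircle L) ≤
      ∫ y in a..b, 2 * |φ.1 (y : AddCircle L) * (D φ).1 (y : AddCircle L)| := by
    have h1 := φ.continuous.comp (AddCircle.continuous_mk' L)
    have h2 := (D φ).continuous.comp (AddCircle.continuous_mk' L)
    refine intervalIntegral.integral_mono hab
      (((continuous_const.mul h1).mul h2).intervalIntegrable _ _)
      ((continuous_const.mul (h1.mul h2).abs).intervalIntegrable _ _) fun y => ?_
    have := le_abs_self (φ.1 (y : AddCircle L) * (D φ).1 (y : AddCircle L))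
    simp only
    nlinarith
  rw [intervalIntegral.integral_const_mul] at hle
  have h3 := intervalIntegral_le_integral hc (fun x => abs_nonneg _) hab hL
  have h4 := integral_abs_mul_le φ (D φ)
  have hz' : φ.1 (a : AddCircle L) = 0 := hz
  rw [hF, hz'] at hle
  linarith

theorem abs_le_norm_toV (φ : SmoothH L) (x : AddCircle L) : |φ.1 x| ≤ ‖toV φ‖ := by
  refine abs_le_of_sq_le_sq (((agmon φ x).trans ?_)) (norm_nonneg _)
  rw [norm_toV_sq]
  nlinarith [sq_nonneg (‖toH φ‖ - ‖toH (D φ)‖)]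

theorem sq_sub_le_mul (φ : SmoothH L) {a b : ℝ} (hab : a ≤ b) (hL : b - a ≤ L) :
    (φ.1 (b : AddCircle L) - φ.1 (a : AddCircle L)) ^ 2 ≤ (b - a) * ‖toH (D φ)‖ ^ 2 := by
  have h2 : Continuous fun y : ℝ => (D φ).1 (y : AddCircle L) :=
    (D φ).continuous.comp (AddCircle.continuous_mk' L)
  have hF : ∫ y in a..b, (D φ).1 (y : AddCircle L) =
      φ.1 (b : AddCircle L) - φ.1 (a : AddCircle L) :=
    intervalIntegral.integral_eq_sub_of_hasDerivAt (f := fun y : ℝ =>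
      φ.1 (y : AddCircle L)) (fun y _ => φ.hasDerivAt_D y) (h2.intervalIntegrable _ _)
  rw [← hF]
  refine (sq_intervalIntegral_le h2 hab).trans ?_
  refine mul_le_mul_of_nonneg_left ?_ (by linarith)
  rw [norm_toH_sq]
  exact intervalIntegral_le_integral ((D φ).continuous.pow 2) (fun x => sq_nonneg _) hab hL

/-- Hölder continuity with exponent `1/2`, with the distance on the circle measured by a sine, which
is a trigonometric function of both points. -/
theorem sq_sub_le_sin (φ : SmoothH L) {a y : ℝ} (h : |y - a| ≤ L / 2) :
    (φ.1 (y : AddCircle L) - φ.1 (a : AddCircle L)) ^ 2 ≤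
      L / 2 * |Real.sin (Real.pi * (y - a) / L)| * ‖toH (D φ)‖ ^ 2 := by
  have hL : 0 < L := Fact.out
  have h1 : (φ.1 (y : AddCircle L) - φ.1 (a : AddCircle L)) ^ 2 ≤
      |y - a| * ‖toH (D φ)‖ ^ 2 := by
    rcases le_total a y with hay | hay
    · rw [abs_of_nonneg (by linarith)] at h ⊢
      exact sq_sub_le_mul φ hay (by linarith)
    · rw [abs_of_nonpos (by linarith)] at h ⊢
      have := sq_sub_le_mul φ hay (by linarith)
      calc _ = (φ.1 (a : AddCircle L) - φ.1 (y : AddCircle L)) ^ 2 := by ring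
        _ ≤ _ := this
        _ = _ := by ring
  refine h1.trans (mul_le_mul_of_nonneg_right ?_ (sq_nonneg _))
  have hpi := Real.pi_pos
  have harg : |Real.pi * (y - a) / L| = Real.pi * |y - a| / L := by
    rw [abs_div, abs_mul, abs_of_pos hpi, abs_of_pos hL]
  have hle : Real.pi * |y - a| / L ≤ Real.pi / 2 := by
    rw [div_le_div_iff₀ hL two_pos]
    nlinarith
  have h0 : 0 ≤ Real.pi * |y - a| / L := by positivity
  have hj := Real.mul_le_sin h0 hle
  have hs : |Real.sin (Real.pi * (y - a) / L)| = Real.sin (Real.pi * |y - a| / L) := by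
    rw [← harg]
    have := Real.abs_sin_eq_sin_abs_of_abs_le_pi (x := Real.pi * (y - a) / L)
      (by rw [harg]; linarith)
    exact this
  rw [hs]
  have : 2 / Real.pi * (Real.pi * |y - a| / L) = 2 / L * |y - a| := by
    field_simp
  rw [this] at hj
  calc |y - a| = L / 2 * (2 / L * |y - a|) := by field_simp
    _ ≤ _ := mul_le_mul_of_nonneg_left hj (by positivity)

end SmoothH

theorem integrable_mul_mul (a b : L2 L) {c : AddCircle L → ℝ} (hc : Continuous c) :
    Integrable (fun x => a x * b x * c x) := by
  obtain ⟨C, hC⟩ := isCompact_univ.exists_bound_of_continuousOn hc.continuousOn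
  exact (MemLp.integrable_mul (Lp.memLp a) (Lp.memLp b)).mul_bdd (c := C)
    hc.aestronglyMeasurable (Filter.Eventually.of_forall fun x => hC x (Set.mem_univ x))

theorem abs_integral_mul_mul_le (a b : L2 L) {c : AddCircle L → ℝ} (hc : Continuous c) {C : ℝ}
    (hC : ∀ x, |c x| ≤ C) : |∫ x, a x * b x * c x| ≤ C * ‖a‖ * ‖b‖ := by
  have hC0 : 0 ≤ C := (abs_nonneg _).trans (hC 0)
  have habs : ∀ (a : L2 L), MemLp (fun x => |a x|) 2 := fun a => (Lp.memLp a).abs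
  have hn : ∀ a : L2 L, ‖(habs a).toLp‖ = ‖a‖ := by
    intro a
    rw [Lp.norm_toLp, Lp.norm_def]
    congr 1
    exact eLpNorm_congr_norm_ae (Filter.Eventually.of_forall fun x => by simp)
  have h1 : |∫ x, a x * b x * c x| ≤ ∫ x, C * (|a x| * |b x|) := by
    refine (abs_integral_le_integral_abs).trans (integral_mono (integrable_mul_mul a b hc).abs
      ((MemLp.integrable_mul (habs a) (habs b)).const_mul C) fun x => ?_)
    simp only [abs_mul]
    have := mul_le_mul_of_nonneg_left (hC x) (mul_nonneg (abs_nonneg (a x)) (abs_nonneg (b x)))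
    linarith
  have h2 : ∫ x, |a x| * |b x| = inner ℝ (habs a).toLp (habs b).toLp := by
    rw [SmoothH.inner_coe_eq_integral]
    refine integral_congr_ae ?_
    filter_upwards [(habs a).coeFn_toLp, (habs b).coeFn_toLp] with x h1 h2
    rw [h1, h2]
  rw [integral_const_mul, h2] at h1
  refine h1.trans ?_
  have h3 := real_inner_le_norm (habs a).toLp (habs b).toLp
  rw [hn, hn] at h3
  rw [mul_assoc]
  exact mul_le_mul_of_nonneg_left h3 hC0

/-- The symmetric trilinear form `∫ a b c`, as a continuous bilinear form of `a` and `b`. -/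
def tri (c : SmoothH L) : H L →L[ℝ] H L →L[ℝ] ℝ :=
  LinearMap.mkContinuous₂
    (LinearMap.mk₂ ℝ (fun a b : H L => ∫ x, (a : L2 L) x * (b : L2 L) x * c.1 x)
      (fun a a' b => by
        rw [← integral_add (integrable_mul_mul _ _ c.continuous)
          (integrable_mul_mul _ _ c.continuous)]
        refine integral_congr_ae ?_
        filter_upwards [Lp.coeFn_add (a : L2 L) a'] with x hx
        simp only [Submodule.coe_add, hx, Pi.add_apply]
        ring)
      (fun r a b => by
        rw [smul_eq_mul, ← integral_const_mul]
        refine integral_congr_ae ?_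
        filter_upwards [Lp.coeFn_smul r (a : L2 L)] with x hx
        simp only [Submodule.coe_smul, hx, Pi.smul_apply, smul_eq_mul]
        ring)
      (fun a b b' => by
        rw [← integral_add (integrable_mul_mul _ _ c.continuous)
          (integrable_mul_mul _ _ c.continuous)]
        refine integral_congr_ae ?_
        filter_upwards [Lp.coeFn_add (b : L2 L) b'] with x hx
        simp only [Submodule.coe_add, hx, Pi.add_apply]
        ring)
      (fun r a b => by
        rw [smul_eq_mul, ← integral_const_mul]
        refine integral_congr_ae ?_
        filter_upwards [Lp.coeFn_smul r (b : L2 L)] with x hx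
        simp only [Submodule.coe_smul, hx, Pi.smul_apply, smul_eq_mul]
        ring))
    ‖SmoothH.toV c‖ fun a b => by
      exact abs_integral_mul_mul_le (a : L2 L) b c.continuous c.abs_le_norm_toV

theorem tri_apply (c : SmoothH L) (a b : H L) :
    tri c a b = ∫ x, (a : L2 L) x * (b : L2 L) x * c.1 x := rfl

theorem tri_comm (c : SmoothH L) (a b : H L) : tri c a b = tri c b a := by
  simp only [tri_apply, mul_comm]

theorem tri_toH_left (a c : SmoothH L) (b : H L) :
    tri c (a.toH) b = tri a c.toH b := by
  rw [tri_apply, tri_apply]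
  refine integral_congr_ae ?_
  filter_upwards [a.coe_toH, c.coe_toH] with x h1 h2
  rw [h1, h2]
  ring

theorem tri_add (c c' : SmoothH L) (a b : H L) : tri (c + c') a b = tri c a b + tri c' a b := by
  simp only [tri_apply]
  rw [← integral_add (integrable_mul_mul _ _ c.continuous) (integrable_mul_mul _ _ c'.continuous)]
  simp only [SmoothH.add_val, Pi.add_apply, mul_add]

theorem tri_smul (r : ℝ) (c : SmoothH L) (a b : H L) : tri (r • c) a b = r * tri c a b := by
  simp only [tri_apply]
  rw [← integral_const_mul]
  congr 1
  funext x
  simp only [SmoothH.smul_val, Pi.smul_apply, smul_eq_mul]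
  ring

theorem abs_tri_le_of_forall (c : SmoothH L) (a b : H L) {C : ℝ} (hC : ∀ x, |c.1 x| ≤ C) :
    |tri c a b| ≤ C * ‖a‖ * ‖b‖ :=
  abs_integral_mul_mul_le (a : L2 L) b c.continuous hC

theorem abs_tri_le (c : SmoothH L) (a b : H L) : |tri c a b| ≤ ‖c.toV‖ * ‖a‖ * ‖b‖ :=
  abs_tri_le_of_forall c a b c.abs_le_norm_toV

theorem tri_toH_toH (a b c : SmoothH L) :
    tri c a.toH b.toH = ∫ x, a.1 x * b.1 x * c.1 x := by
  rw [tri_apply]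
  refine integral_congr_ae ?_
  filter_upwards [a.coe_toH, b.coe_toH] with x h1 h2
  rw [h1, h2]

/-! ### The right-hand side of the equation -/

theorem inner_smul_H (w v : H L) (c : ℝ) : inner ℝ w (c • v) = c * inner ℝ w v :=
  real_inner_smul_right w v c

/-- The right-hand side of the equation, as a linear form on smooth mean-zero functions. -/
def rhs (ν β γ : ℝ) (f : StrongDual ℝ (V L)) (w : H L) : SmoothH L →ₗ[ℝ] ℝ where
  toFun φ := ν * inner ℝ w (φ.D.D.toH) + 1 / 2 * tri φ.D w w + β * inner ℝ w φ.toH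
    + γ * inner ℝ w φ.D.D.D.toH + f φ.toV
  map_add' φ ψ := by
    simp only [map_add, inner_add_right, tri_add]
    ring
  map_smul' c φ := by
    simp only [map_smul, inner_smul_H, tri_smul, smul_eq_mul, RingHom.id_apply]
    ring

variable {ν β γ : ℝ} {f : StrongDual ℝ (V L)}

theorem rhs_apply (w : H L) (φ : SmoothH L) : rhs ν β γ f w φ =
    ν * inner ℝ w (φ.D.D.toH) + 1 / 2 * tri φ.D w w + β * inner ℝ w φ.toH
    + γ * inner ℝ w φ.D.D.D.toH + f φ.toV := rfl

theorem weakRHS_test (w : H L) (φ : SmoothH L) :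
    weakRHS ν β γ f (w : L2 L) φ.test = rhs ν β γ f w φ := by
  rw [rhs_apply, SmoothH.inner_toH_right, SmoothH.inner_toH_right, SmoothH.inner_toH_right,
    tri_apply, ← SmoothH.torusDeriv_two, ← SmoothH.torusDeriv_three, SmoothH.D_coe]
  simp only [← pow_two]
  rfl

theorem contDiff_rhs (φ : SmoothH L) : ContDiff ℝ (⊤ : ℕ∞) fun w : H L => rhs ν β γ f w φ := by
  simp only [rhs_apply]
  have h1 : ∀ ψ : H L, ContDiff ℝ (⊤ : ℕ∞) fun w : H L => inner ℝ w ψ := fun ψ =>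
    contDiff_id.inner ℝ contDiff_const
  have h2 : ContDiff ℝ (⊤ : ℕ∞) fun w : H L => tri φ.D w w :=
    (tri φ.D).contDiff.clm_apply contDiff_id
  exact ((((contDiff_const.mul (h1 _)).add (contDiff_const.mul h2)).add
    (contDiff_const.mul (h1 _))).add (contDiff_const.mul (h1 _))).add contDiff_const

theorem continuous_rhs (φ : SmoothH L) : Continuous fun w : H L => rhs ν β γ f w φ :=
  (contDiff_rhs φ).continuous

/-- The energy identity: dispersion and transport drop out. -/
theorem rhs_self (φ : SmoothH L) : rhs ν β γ f φ.toH φ =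
    -ν * ‖φ.D.toH‖ ^ 2 + β * ‖φ.toH‖ ^ 2 + f φ.toV := by
  have h1 : inner ℝ φ.toH φ.D.D.toH = - ‖φ.D.toH‖ ^ 2 := by
    rw [SmoothH.inner_D, real_inner_self_eq_norm_sq]
  have h2 : tri φ.D φ.toH φ.toH = 0 := by
    rw [tri_toH_toH, ← φ.integral_sq_mul_D_self]
    simp only [pow_two]
  have h3 : inner ℝ φ.toH φ.D.D.D.toH = (0 : ℝ) := by
    rw [SmoothH.inner_D, SmoothH.inner_self_D, neg_zero]
  rw [rhs_apply, h1, h2, h3, real_inner_self_eq_norm_sq]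
  ring

end

section

variable {L : ℝ} [Fact (0 < L)]

/-! ### Completeness of the phase space and of the energy space -/

theorem continuous_integral_mul {g : AddCircle L → ℝ} (hg : Continuous g) :
    Continuous fun u : L2 L => ∫ x, u x * g x := by
  have h : ∀ u : L2 L, ∫ x, u x * g x = inner ℝ u ((memLp_of_continuous hg).toLp g) := by
    intro u
    rw [SmoothH.inner_coe_eq_integral]
    refine integral_congr_ae ?_
    filter_upwards [(memLp_of_continuous hg).coeFn_toLp] with x hx
    rw [hx]
  simp only [h]
  fun_prop

theorem isClosed_H : IsClosed (H L : Set (L2 L)) := by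
  have h : (H L : Set (L2 L)) = {u | ∫ x, u x * 1 = 0} := by
    ext u
    simp only [mul_one]
    rfl
  rw [h]
  exact isClosed_eq (continuous_integral_mul continuous_const) continuous_const

instance : CompleteSpace (H L) := isClosed_H.completeSpace_coe

theorem continuous_fst : Continuous fun p : WithLp 2 (L2 L × L2 L) => p.fst :=
  (WithLp.fstL 2 ℝ (L2 L) (L2 L)).continuous

theorem continuous_snd : Continuous fun p : WithLp 2 (L2 L × L2 L) => p.snd :=
  (WithLp.sndL 2 ℝ (L2 L) (L2 L)).continuous

theorem isClosed_V : IsClosed (V L : Set (WithLp 2 (L2 L × L2 L))) := by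
  have h : (V L : Set (WithLp 2 (L2 L × L2 L))) = {p | p.fst ∈ H L} ∩
      ⋂ (φ : AddCircle L → ℝ) (_ : IsSmooth φ),
        {p | ∫ x, p.fst x * torusDeriv 1 φ x = - ∫ x, p.snd x * φ x} := by
    ext p
    simp only [Set.mem_inter_iff, Set.mem_iInter]
    rfl
  rw [h]
  refine (isClosed_H.preimage continuous_fst).inter ?_
  refine isClosed_iInter fun φ => isClosed_iInter fun hφ => ?_
  exact isClosed_eq ((continuous_integral_mul (hφ.continuous_torusDeriv 1)).comp continuous_fst)
    ((continuous_integral_mul hφ.continuous).comp continuous_snd).neg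

instance : CompleteSpace (V L) := isClosed_V.completeSpace_coe

/-- The function underlying an element of the energy space. -/
def V.fn (p : V L) : H L := ⟨(p : WithLp 2 (L2 L × L2 L)).fst, p.2.1⟩

/-- The weak derivative of an element of the energy space. It has mean zero, as a test with the
constant function `1` shows. -/
def V.deriv (p : V L) : H L := ⟨(p : WithLp 2 (L2 L × L2 L)).snd, by
  have h := p.2.2 (fun _ => 1) (isSmooth_const 1)
  have h0 : torusDeriv 1 (fun _ : AddCircle L => (1 : ℝ)) = fun _ => 0 := by
    funext x
    simp [torusDeriv]
  simp only [h0, mul_zero, integral_zero, mul_one] at h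
  exact neg_eq_zero.1 h.symm⟩

theorem V.norm_sq (p : V L) : ‖p‖ ^ 2 = ‖V.fn p‖ ^ 2 + ‖V.deriv p‖ ^ 2 :=
  WithLp.prod_norm_sq_eq_of_L2 (p : WithLp 2 (L2 L × L2 L))

theorem V.fn_toV (φ : SmoothH L) : V.fn φ.toV = φ.toH := rfl

theorem V.deriv_toV (φ : SmoothH L) : V.deriv φ.toV = φ.D.toH := rfl

theorem V.fn_sub (p q : V L) : V.fn (p - q) = V.fn p - V.fn q := rfl

theorem V.deriv_sub (p q : V L) : V.deriv (p - q) = V.deriv p - V.deriv q := rfl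

/-- Integration by parts between an element of the energy space and a smooth function. -/
theorem V.inner_deriv (p : V L) (φ : SmoothH L) :
    inner ℝ (V.deriv p) φ.toH = - inner ℝ (V.fn p) φ.D.toH := by
  rw [SmoothH.inner_toH_right, SmoothH.inner_toH_right]
  have h : ∫ x, (V.fn p : L2 L) x * φ.D.1 x = - ∫ x, (V.deriv p : L2 L) x * φ.1 x :=
    p.2.2 φ.1 φ.smooth
  linarith

theorem V.inner_eq (p q : V L) :
    inner ℝ p q = inner ℝ (V.fn p) (V.fn q) + inner ℝ (V.deriv p) (V.deriv q) := rfl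

/-! ### A trigonometric basis -/

/-- The fundamental frequency `2π / L`. -/
def omega (L : ℝ) : ℝ := 2 * Real.pi / L

theorem omega_pos : 0 < omega L := by
  have hL : 0 < L := Fact.out
  unfold omega
  positivity

theorem omega_mul : omega L * L = 2 * Real.pi := by
  have hL : 0 < L := Fact.out
  unfold omega
  field_simp

theorem integral_cos_int (k : ℤ) :
    ∫ y in (0 : ℝ)..L, Real.cos (k * omega L * y) = if k = 0 then L else 0 := by
  split_ifs with hk
  · simp [hk]
  · have hc : (k : ℝ) * omega L ≠ 0 :=
      mul_ne_zero (by exact_mod_cast hk) (omega_pos (L := L)).ne'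
    rw [intervalIntegral.integral_comp_mul_left (fun y => Real.cos y) hc, integral_cos,
      mul_assoc, omega_mul, mul_zero, Real.sin_zero]
    have : (k : ℝ) * (2 * Real.pi) = ((2 * k : ℤ) : ℝ) * Real.pi := by push_cast; ring
    rw [this, Real.sin_int_mul_pi, sub_zero, smul_zero]

theorem integral_sin_int (k : ℤ) :
    ∫ y in (0 : ℝ)..L, Real.sin (k * omega L * y) = 0 := by
  by_cases hk : k = 0
  · simp [hk]
  · have hc : (k : ℝ) * omega L ≠ 0 :=
      mul_ne_zero (by exact_mod_cast hk) (omega_pos (L := L)).ne'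
    rw [intervalIntegral.integral_comp_mul_left (fun y => Real.sin y) hc, integral_sin,
      mul_zero, mul_assoc, omega_mul, Real.cos_zero, Real.cos_int_mul_two_pi, sub_self, smul_zero]

/-- The Hartley basis: `e k` is `(cos (kωx) + sin (kωx)) / √L` for an integer `k ≠ 0`, and `e 0 = 0`
since constants do not have mean zero. With this choice both orthonormality and
`(e k)' = kω e (-k)` hold without a distinction between sines and cosines. -/
def e (k : ℤ) : SmoothH L :=
  if hk : k = 0 then 0 else
    SmoothH.ofPeriodic
      (fun y => (Real.sqrt L)⁻¹ * (Real.cos (k * omega L * y) + Real.sin (k * omega L * y)))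
      (fun y => by
        have h : (k : ℝ) * omega L * (y + L) = k * omega L * y + k * (2 * Real.pi) := by
          rw [← omega_mul (L := L)]
          ring
        simp only [h, Real.cos_add_int_mul_two_pi, Real.sin_add_int_mul_two_pi])
      (by fun_prop)
      (by
        rw [intervalIntegral.integral_const_mul, intervalIntegral.integral_add,
          integral_cos_int, integral_sin_int, if_neg hk, add_zero, mul_zero]
        all_goals exact Continuous.intervalIntegrable (by fun_prop) _ _)

theorem e_zero : (e 0 : SmoothH L) = 0 := dif_pos rfl

theorem e_coe {k : ℤ} (hk : k ≠ 0) (y : ℝ) : (e k : SmoothH L).1 (y : AddCircle L) =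
    (Real.sqrt L)⁻¹ * (Real.cos (k * omega L * y) + Real.sin (k * omega L * y)) := by
  rw [e, dif_neg hk]
  rfl

theorem D_e (k : ℤ) : (e k : SmoothH L).D = (k * omega L) • e (-k) := by
  by_cases hk : k = 0
  · subst hk
    simp [e_zero]
  refine SmoothH.ext_coe fun y => ?_
  refine ((e k : SmoothH L).hasDerivAt_D y).unique ?_
  simp only [e_coe hk, SmoothH.smul_val, Pi.smul_apply, smul_eq_mul, e_coe (neg_ne_zero.2 hk)]
  have h : HasDerivAt (fun y : ℝ => (k : ℝ) * omega L * y) (k * omega L) y := by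
    simpa using (hasDerivAt_id y).const_mul ((k : ℝ) * omega L)
  refine ((h.cos.add h.sin).const_mul ((Real.sqrt L)⁻¹)).congr_deriv ?_
  have : ((-k : ℤ) : ℝ) * omega L * y = -(k * omega L * y) := by push_cast; ring
  rw [this, Real.cos_neg, Real.sin_neg]
  ring

theorem inner_e_e (k j : ℤ) : inner ℝ (e k : SmoothH L).toH (e j : SmoothH L).toH =
    if k = j ∧ k ≠ 0 then (1 : ℝ) else 0 := by
  by_cases hk : k = 0
  · subst hk
    simp [e_zero]
  by_cases hj : j = 0
  · subst hj
    simp [e_zero, hk]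
  have hL : 0 < L := Fact.out
  rw [SmoothH.inner_toH, SmoothH.integral_eq]
  simp only [e_coe hk, e_coe hj]
  have h : ∀ y : ℝ, (Real.sqrt L)⁻¹ * (Real.cos (k * omega L * y) + Real.sin (k * omega L * y)) *
      ((Real.sqrt L)⁻¹ * (Real.cos (j * omega L * y) + Real.sin (j * omega L * y))) =
      L⁻¹ * (Real.cos (((k - j : ℤ) : ℝ) * omega L * y) +
        Real.sin (((k + j : ℤ) : ℝ) * omega L * y)) := by
    intro y
    have hs : (Real.sqrt L)⁻¹ * (Real.sqrt L)⁻¹ = L⁻¹ := by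
      rw [← mul_inv, Real.mul_self_sqrt hL.le]
    have h1 : ((k - j : ℤ) : ℝ) * omega L * y = k * omega L * y - j * omega L * y := by
      push_cast; ring
    have h2 : ((k + j : ℤ) : ℝ) * omega L * y = k * omega L * y + j * omega L * y := by
      push_cast; ring
    rw [h1, h2, Real.cos_sub, Real.sin_add, ← hs]
    ring
  simp only [h]
  rw [intervalIntegral.integral_const_mul, intervalIntegral.integral_add,
    integral_cos_int, integral_sin_int]
  · by_cases hkj : k = j
    · simp [hkj, hj, hL.ne']
    · simp [hkj, sub_ne_zero.2 hkj]
  all_goals exact Continuous.intervalIntegrable (by fun_prop) _ _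

/-- The complex exponentials are combinations of Hartley functions. -/
theorem fourier_eq {n : ℤ} (hn : n ≠ 0) (x : AddCircle L) :
    fourier (-n) x = (Real.sqrt L / 2 : ℂ) * ((1 - Complex.I) * ((e n : SmoothH L).1 x : ℂ) +
      (1 + Complex.I) * ((e (-n) : SmoothH L).1 x : ℂ)) := by
  obtain ⟨y, rfl⟩ := QuotientAddGroup.mk_surjective x
  have hL : 0 < L := Fact.out
  have h := e_coe (L := L) hn y
  have h' := e_coe (L := L) (neg_ne_zero.2 hn) y
  have hf := fourier_coe_apply (T := L) (n := -n) (x := y)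
  have harg : 2 * (Real.pi : ℂ) * Complex.I * ((-n : ℤ) : ℂ) * y / L =
      ((-(n * omega L * y) : ℝ) : ℂ) * Complex.I := by
    unfold omega
    push_cast
    ring
  rw [harg, Complex.exp_mul_I, ← Complex.ofReal_cos, ← Complex.ofReal_sin, Real.cos_neg,
    Real.sin_neg] at hf
  have h1 : ((-n : ℤ) : ℝ) * omega L * y = -(n * omega L * y) := by push_cast; ring
  rw [h1, Real.cos_neg, Real.sin_neg] at h'
  have hs : ((Real.sqrt L : ℝ) : ℂ) ≠ 0 := by
    exact_mod_cast (Real.sqrt_pos.2 hL).ne'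
  refine hf.trans ?_
  erw [h, h']
  push_cast
  field_simp
  ring

/-- The Hartley functions are complete, since the complex exponentials are. -/
theorem eq_zero_of_inner_e (w : H L) (h : ∀ k : ℤ, inner ℝ w (e k : SmoothH L).toH = 0) :
    w = 0 := by
  have hL : 0 < L := Fact.out
  have hF : MemLp (fun x => ((w : L2 L) x : ℂ)) 2 (volume : Measure (AddCircle L)) :=
    (Lp.memLp (w : L2 L)).ofReal
  have hF' : MemLp (fun x => ((w : L2 L) x : ℂ)) 2 (AddCircle.haarAddCircle (T := L)) :=
    memLp_haarAddCircle_iff.2 hF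
  have hc : ∀ n : ℤ, fourierCoeff (fun x => ((w : L2 L) x : ℂ)) n = 0 := by
    intro n
    rw [fourierCoeff, AddCircle.integral_haarAddCircle]
    by_cases hn : n = 0
    · subst hn
      simp only [neg_zero, fourier_zero, one_smul]
      have h0 : ∫ x, (w : L2 L) x = 0 := w.2
      have := integral_ofReal (𝕜 := ℂ) (μ := volume) (f := fun x => (w : L2 L) x)
      erw [this]
      rw [h0]
      simp
    · have he : ∀ k : ℤ, ∫ x, (((w : L2 L) x * (e k : SmoothH L).1 x : ℝ) : ℂ) = 0 := by
        intro k
        have := integral_ofReal (𝕜 := ℂ) (μ := volume)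
          (f := fun x => (w : L2 L) x * (e k : SmoothH L).1 x)
        erw [this]
        rw [← SmoothH.inner_toH_right, h k]
        simp
      have hi : ∀ k : ℤ, Integrable fun x => (((w : L2 L) x * (e k : SmoothH L).1 x : ℝ) : ℂ) :=
        fun k => (integrable_L2_mul (w : L2 L) (e k : SmoothH L).continuous).ofReal
      have heq : ∀ x, fourier (-n) x • ((w : L2 L) x : ℂ) =
          (Real.sqrt L / 2 : ℂ) * (1 - Complex.I) *
            (((w : L2 L) x * (e n : SmoothH L).1 x : ℝ) : ℂ) +
          (Real.sqrt L / 2 : ℂ) * (1 + Complex.I) *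
            (((w : L2 L) x * (e (-n) : SmoothH L).1 x : ℝ) : ℂ) := by
        intro x
        rw [fourier_eq hn, smul_eq_mul]
        push_cast
        ring
      simp only [heq]
      rw [integral_add ((hi _).const_mul _) ((hi _).const_mul _), integral_const_mul,
        integral_const_mul, he, he]
      simp
  have hz : hF'.toLp = 0 := by
    refine (fourierBasis (T := L)).repr.injective ?_
    rw [map_zero]
    ext n
    rw [fourierBasis_repr, fourierCoeff_congr_ae hF'.coeFn_toLp, hc]
    rfl
  have hae : (fun x => ((w : L2 L) x : ℂ)) =ᵐ[AddCircle.haarAddCircle (T := L)] 0 :=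
    hF'.coeFn_toLp.symm.trans ((Lp.eq_zero_iff_ae_eq_zero).1 hz)
  have hvol : ∀ g : AddCircle L → ℂ, g =ᵐ[AddCircle.haarAddCircle (T := L)] 0 →
      g =ᵐ[volume] 0 := by
    intro g hg
    rw [AddCircle.volume_eq_smul_haarAddCircle]
    exact Measure.ae_smul_measure hg _
  refine Subtype.ext ((Lp.eq_zero_iff_ae_eq_zero).2 ?_)
  filter_upwards [hvol _ hae] with x hx
  exact Complex.ofReal_eq_zero.1 hx

end

section

variable {L : ℝ} [Fact (0 < L)]

/-! ### Fourier truncation -/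

theorem SmoothH.toH_injective : Function.Injective (toH : SmoothH L → H L) := by
  intro φ ψ h
  have h1 : φ.1 =ᵐ[volume] ψ.1 := by
    have := φ.coe_toH
    rw [h] at this
    exact this.symm.trans ψ.coe_toH
  exact Subtype.ext ((φ.continuous.ae_eq_iff_eq volume ψ.continuous).1 h1)

theorem eq_of_inner_e {u v : H L}
    (h : ∀ k : ℤ, inner ℝ u (e k : SmoothH L).toH = (inner ℝ v (e k : SmoothH L).toH : ℝ)) :
    u = v := by
  rw [← sub_eq_zero]
  refine eq_zero_of_inner_e _ fun k => ?_
  rw [inner_sub_left, h, sub_self]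

theorem SmoothH.eq_of_inner_e {φ ψ : SmoothH L} (h : ∀ k : ℤ,
    inner ℝ φ.toH (e k : SmoothH L).toH = (inner ℝ ψ.toH (e k : SmoothH L).toH : ℝ)) : φ = ψ :=
  SmoothH.toH_injective (KBS.eq_of_inner_e h)

theorem inner_smul_H_left (w v : H L) (c : ℝ) : inner ℝ (c • w) v = c * inner ℝ w v :=
  real_inner_smul_left w v c

/-- Projection onto the span of the basis functions with index in `A`. -/
def proj (A : Finset ℤ) : H L →ₗ[ℝ] SmoothH L where
  toFun w := ∑ k ∈ A, (inner ℝ w (e k : SmoothH L).toH : ℝ) • e k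
  map_add' u v := by
    simp only [inner_add_left, add_smul, Finset.sum_add_distrib]
  map_smul' c u := by
    simp only [inner_smul_H_left, mul_smul, Finset.smul_sum, RingHom.id_apply]

theorem proj_apply (A : Finset ℤ) (w : H L) :
    proj A w = ∑ k ∈ A, (inner ℝ w (e k : SmoothH L).toH : ℝ) • (e k : SmoothH L) := rfl

theorem inner_toH_sum_left (A : Finset ℤ) (c : ℤ → ℝ) (g : ℤ → SmoothH L) (w : H L) :
    inner ℝ (∑ k ∈ A, c k • g k).toH w = ∑ k ∈ A, c k * inner ℝ (g k).toH w := by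
  rw [map_sum, sum_inner]
  refine Finset.sum_congr rfl fun k _ => ?_
  rw [map_smul, inner_smul_H_left]

theorem inner_sum_e (A : Finset ℤ) (c : ℤ → ℝ) (j : ℤ) :
    inner ℝ (∑ k ∈ A, c k • (e k : SmoothH L)).toH (e j : SmoothH L).toH =
      if j ∈ A ∧ j ≠ 0 then c j else 0 := by
  rw [inner_toH_sum_left]
  simp only [inner_e_e]
  by_cases hj : j = 0
  · simp [hj]
  · have : ∀ k, (k = j ∧ k ≠ 0) ↔ k = j := fun k => ⟨And.left, fun h => ⟨h, h ▸ hj⟩⟩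
    simp [this, hj]

theorem inner_proj_e (A : Finset ℤ) (w : H L) (j : ℤ) :
    inner ℝ (proj A w).toH (e j : SmoothH L).toH =
      if j ∈ A then inner ℝ w (e j : SmoothH L).toH else 0 := by
  rw [proj_apply, inner_sum_e A (fun k => inner ℝ w (e k : SmoothH L).toH) j]
  by_cases hj : j = 0
  · simp [hj, e_zero]
  · simp [hj]

theorem inner_proj_left (A : Finset ℤ) (u v : H L) : inner ℝ (proj A u).toH v =
    ∑ k ∈ A, (inner ℝ u (e k : SmoothH L).toH : ℝ) * inner ℝ v (e k : SmoothH L).toH := by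
  rw [proj_apply, inner_toH_sum_left A (fun k => inner ℝ u (e k : SmoothH L).toH)]
  exact Finset.sum_congr rfl fun k _ => by rw [real_inner_comm v]

theorem inner_proj_comm (A : Finset ℤ) (u v : H L) :
    inner ℝ (proj A u).toH v = (inner ℝ u (proj A v).toH : ℝ) := by
  rw [inner_proj_left, real_inner_comm (proj A v).toH u, inner_proj_left]
  exact Finset.sum_congr rfl fun k _ => mul_comm _ _

theorem proj_proj (A B : Finset ℤ) (u : H L) : proj A (proj B u).toH = proj (A ∩ B) u := by
  refine SmoothH.eq_of_inner_e fun k => ?_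
  simp only [inner_proj_e, Finset.mem_inter]
  split_ifs <;> simp_all

theorem norm_proj_sq (A : Finset ℤ) (u : H L) :
    ‖(proj A u).toH‖ ^ 2 = ∑ k ∈ A, (inner ℝ u (e k : SmoothH L).toH : ℝ) ^ 2 := by
  rw [← real_inner_self_eq_norm_sq, ← inner_proj_comm, proj_proj, Finset.inter_self,
    inner_proj_left]
  simp only [pow_two]

/-- Bessel's inequality. -/
theorem norm_proj_le (A : Finset ℤ) (u : H L) : ‖(proj A u).toH‖ ≤ ‖u‖ := by
  have h : ‖(proj A u).toH‖ ^ 2 = inner ℝ (proj A u).toH u := by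
    rw [norm_proj_sq, inner_proj_left]
    simp only [pow_two]
  have h2 := real_inner_le_norm (proj A u).toH u
  rw [← h] at h2
  nlinarith [norm_nonneg (proj A u).toH, norm_nonneg u]

theorem inner_D_e (w : H L) (k : ℤ) : inner ℝ w (e k : SmoothH L).D.toH =
    k * omega L * inner ℝ w (e (-k) : SmoothH L).toH := by
  rw [D_e, map_smul, inner_smul_H]

/-- Truncation commutes with differentiation if the set of frequencies is symmetric: differentiation
maps `e k` to a multiple of `e (-k)`. -/
theorem D_proj {A : Finset ℤ} (hA : ∀ k, -k ∈ A ↔ k ∈ A) (φ : SmoothH L) :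
    (proj A φ.toH).D = proj A φ.D.toH := by
  refine SmoothH.eq_of_inner_e fun k => ?_
  rw [← neg_inj, ← SmoothH.inner_D, inner_D_e, inner_proj_e, inner_proj_e]
  simp only [hA]
  split_ifs with h
  · rw [← inner_D_e, SmoothH.inner_D]
  · simp

theorem V.D_proj {A : Finset ℤ} (hA : ∀ k, -k ∈ A ↔ k ∈ A) (p : V L) :
    (proj A (V.fn p)).D = proj A (V.deriv p) := by
  refine SmoothH.eq_of_inner_e fun k => ?_
  rw [← neg_inj, ← SmoothH.inner_D, inner_D_e, inner_proj_e, inner_proj_e]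
  simp only [hA]
  split_ifs with h
  · rw [← inner_D_e, V.inner_deriv, neg_neg]
  · simp

/-- The nonzero frequencies up to `N`. -/
def freq (N : ℕ) : Finset ℤ := (Finset.Icc (-(N : ℤ)) N).erase 0

theorem mem_freq {N : ℕ} {k : ℤ} : k ∈ freq N ↔ k ≠ 0 ∧ |k| ≤ N := by
  rw [freq, Finset.mem_erase, Finset.mem_Icc, abs_le]

theorem neg_mem_freq {N : ℕ} (k : ℤ) : -k ∈ freq N ↔ k ∈ freq N := by
  simp [mem_freq]

theorem freq_subset {N M : ℕ} (h : N ≤ M) : freq N ⊆ freq M := by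
  intro k hk
  rw [mem_freq] at hk ⊢
  exact ⟨hk.1, hk.2.trans (by exact_mod_cast h)⟩

/-- High frequencies are controlled by the derivative. -/
theorem norm_toH_le_of_high {A : Finset ℤ} {N : ℝ} (hN : 0 ≤ N) (hA : ∀ k ∈ A, N ≤ |(k : ℝ)|)
    (hA0 : (0 : ℤ) ∉ A) (u : H L) :
    N * omega L * ‖(proj A u).toH‖ ≤ ‖(proj A u).D.toH‖ := by
  have hω := omega_pos (L := L)
  refine le_of_sq_le_sq ?_ (norm_nonneg _)
  -- differentiation maps `e k` to a multiple of `e (-k)`, so the derivative has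
  -- the frequencies `-A`
  have hD : (proj A u).D = ∑ k ∈ A.image Neg.neg,
      (-(k : ℝ) * omega L * inner ℝ u (e (-k) : SmoothH L).toH) • (e k : SmoothH L) := by
    rw [Finset.sum_image (by simp), proj_apply, map_sum]
    refine Finset.sum_congr rfl fun k _ => ?_
    rw [map_smul, D_e, smul_smul]
    congr 1
    push_cast
    simp only [neg_neg]
    ring
  have h1 : ‖(proj A u).D.toH‖ ^ 2 =
      ∑ k ∈ A, (k * omega L * inner ℝ u (e k : SmoothH L).toH) ^ 2 := by
    rw [← real_inner_self_eq_norm_sq]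
    nth_rewrite 1 [hD]
    rw [inner_toH_sum_left, Finset.sum_image (by simp)]
    refine Finset.sum_congr rfl fun k hk => ?_
    have hk0 : k ≠ 0 := fun h => hA0 (h ▸ hk)
    rw [hD, real_inner_comm _ (e (-k) : SmoothH L).toH,
      inner_sum_e _ (fun k => -(k : ℝ) * omega L * inner ℝ u (e (-k) : SmoothH L).toH),
      if_pos ⟨Finset.mem_image_of_mem _ hk, neg_ne_zero.2 hk0⟩]
    push_cast
    simp only [neg_neg]
    ring
  rw [h1, mul_pow, norm_proj_sq, Finset.mul_sum]
  refine Finset.sum_le_sum fun k hk => ?_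
  rw [mul_pow, mul_pow, mul_pow]
  have := hA k hk
  have h2 : N ^ 2 ≤ (k : ℝ) ^ 2 := by
    rw [← sq_abs (k : ℝ)]
    exact pow_le_pow_left₀ hN this 2
  gcongr

theorem orthonormal_e : Orthonormal ℝ fun k : {k : ℤ // k ≠ 0} => (e k : SmoothH L).toH := by
  classical
  rw [orthonormal_iff_ite]
  intro i j
  rw [inner_e_e]
  by_cases h : i = j
  · simp [h, j.2]
  · have : (i : ℤ) ≠ j := fun h' => h (Subtype.ext h')
    simp [h, this]

theorem tendsto_proj (u : H L) :
    Filter.Tendsto (fun N : ℕ => (proj (freq N) u).toH) Filter.atTop (nhds u) := by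
  let b : HilbertBasis {k : ℤ // k ≠ 0} ℝ (H L) :=
    HilbertBasis.mkOfOrthogonalEqBot orthonormal_e (by
      rw [Submodule.eq_bot_iff]
      intro w hw
      refine eq_zero_of_inner_e w fun k => ?_
      by_cases hk : k = 0
      · simp [hk, e_zero]
      · have := (Submodule.mem_orthogonal' _ _).1 hw (e k : SmoothH L).toH
          (Submodule.subset_span ⟨⟨k, hk⟩, rfl⟩)
        exact this)
  have hb : ∀ k, b k = (e k : SmoothH L).toH := fun k => by
    rw [HilbertBasis.coe_mkOfOrthogonalEqBot]
  have hs := b.hasSum_repr u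
  have ht : Filter.Tendsto (fun N : ℕ => (freq N).subtype (fun k : ℤ => k ≠ 0)) Filter.atTop
      Filter.atTop := by
    refine Filter.tendsto_atTop_finset_of_monotone (fun N M h => ?_) fun k => ⟨k.1.natAbs, ?_⟩
    · exact Finset.subtype_mono (freq_subset h)
    · rw [Finset.mem_subtype, mem_freq]
      exact ⟨k.2, by rw [Int.abs_eq_natAbs]⟩
  refine (hs.comp ht).congr fun N => ?_
  have hsub : ∀ k ∈ freq N, k ≠ 0 := fun k hk => (mem_freq.1 hk).1
  simp only [Function.comp_apply, HilbertBasis.repr_apply_apply, hb]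
  rw [Finset.sum_subtype_of_mem (fun k : ℤ =>
    (inner ℝ (e k : SmoothH L).toH u : ℝ) • (e k : SmoothH L).toH) hsub, proj_apply, map_sum]
  refine Finset.sum_congr rfl fun k _ => ?_
  rw [map_smul, real_inner_comm]

theorem V.norm_toV_proj_le (N : ℕ) (p : V L) : ‖(proj (freq N) (V.fn p)).toV‖ ≤ ‖p‖ := by
  refine le_of_sq_le_sq ?_ (norm_nonneg _)
  rw [SmoothH.norm_toV_sq, V.norm_sq, V.D_proj neg_mem_freq]
  have h1 := norm_proj_le (freq N) (V.fn p)
  have h2 := norm_proj_le (freq N) (V.deriv p)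
  gcongr

theorem V.tendsto_proj (p : V L) :
    Filter.Tendsto (fun N : ℕ => (proj (freq N) (V.fn p)).toV) Filter.atTop (nhds p) := by
  rw [tendsto_iff_norm_sub_tendsto_zero]
  have h1 := tendsto_iff_norm_sub_tendsto_zero.1 (KBS.tendsto_proj (V.fn p))
  have h2 := tendsto_iff_norm_sub_tendsto_zero.1 (KBS.tendsto_proj (V.deriv p))
  have h3 := ((h1.pow 2).add (h2.pow 2)).sqrt
  simp only [ne_eq, OfNat.ofNat_ne_zero, not_false_eq_true, zero_pow, add_zero,
    Real.sqrt_zero] at h3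
  refine h3.congr fun N => ?_
  rw [← V.D_proj neg_mem_freq, ← V.fn_toV, ← V.deriv_toV, ← V.fn_sub, ← V.deriv_sub, ← V.norm_sq,
    Real.sqrt_sq (norm_nonneg _)]

theorem SmoothH.tendsto_toV_proj (φ : SmoothH L) :
    Filter.Tendsto (fun N : ℕ => (proj (freq N) φ.toH).toV) Filter.atTop (nhds φ.toV) :=
  V.tendsto_proj φ.toV

/-- An element of the energy space is determined by its function. -/
theorem V.fn_injective : Function.Injective (V.fn : V L → H L) := by
  intro p q h
  exact tendsto_nhds_unique (h ▸ V.tendsto_proj p) (V.tendsto_proj q)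

/-- Elements of the energy space are bounded functions: the bound is expressed by the trilinear form
that they define. -/
theorem V.abs_tri_le (p : V L) (w : H L) (c : SmoothH L) :
    |tri c (V.fn p) w| ≤ ‖p‖ * ‖w‖ * ‖c.toH‖ := by
  have h1 : Filter.Tendsto (fun N : ℕ => tri c (proj (freq N) (V.fn p)).toH w) Filter.atTop
      (nhds (tri c (V.fn p) w)) :=
    (((tri c).continuous.clm_apply continuous_const).tendsto (V.fn p)).comp
      (KBS.tendsto_proj (V.fn p))
  refine le_of_tendsto h1.abs (Filter.Eventually.of_forall fun N => ?_)
  rw [tri_toH_left, tri_comm]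
  refine (KBS.abs_tri_le (proj (freq N) (V.fn p)) w c.toH).trans ?_
  have h2 := V.norm_toV_proj_le N p
  gcongr

end

section

/-! ### Gronwall's inequality and global solutions of ordinary differential equations -/

/-- Gronwall's inequality with a variable rate `a`, a source `h` and a dissipation `z`. -/
theorem gronwall {t₀ t₁ : ℝ} (ht : t₀ ≤ t₁) {y y' a z h : ℝ → ℝ} (ha : Continuous a)
    (hz : Continuous z) (hh : Continuous h) (ha0 : ∀ t, 0 ≤ a t) (hz0 : ∀ t, 0 ≤ z t)
    (hh0 : ∀ t, 0 ≤ h t) (hy : ContinuousOn y (Set.Icc t₀ t₁))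
    (hy' : ∀ t ∈ Set.Ioo t₀ t₁, HasDerivAt y (y' t) t)
    (hle : ∀ t ∈ Set.Ioo t₀ t₁, y' t ≤ - z t + a t * y t + h t) :
    y t₁ + ∫ s in t₀..t₁, z s ≤
      Real.exp (∫ s in t₀..t₁, a s) * (y t₀ + ∫ s in t₀..t₁, h s) := by
  have prim : ∀ {g : ℝ → ℝ}, Continuous g → ∀ t, HasDerivAt (fun t => ∫ s in t₀..t, g s) (g t) t :=
    fun hg t => intervalIntegral.integral_hasDerivAt_right (hg.intervalIntegrable _ _)
      (hg.stronglyMeasurableAtFilter _ _) hg.continuousAt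
  set A := fun t => ∫ s in t₀..t, a s with hA
  set Z := fun t => ∫ s in t₀..t, z s with hZ
  set G := fun t => ∫ s in t₀..t, h s with hG
  have hAd := prim ha
  have hZd := prim hz
  have hGd := prim hh
  have hAmono : Monotone A := monotone_of_hasDerivAt_nonneg hAd ha0
  have hAc : Continuous A := continuous_iff_continuousAt.2 fun t => (hAd t).continuousAt
  have hZc : Continuous Z := continuous_iff_continuousAt.2 fun t => (hZd t).continuousAt
  have hGc : Continuous G := continuous_iff_continuousAt.2 fun t => (hGd t).continuousAt
  have hA0 : A t₀ = 0 := intervalIntegral.integral_same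
  have hZ0 : Z t₀ = 0 := intervalIntegral.integral_same
  have hG0 : G t₀ = 0 := intervalIntegral.integral_same
  have hanti : AntitoneOn (fun t => Real.exp (-A t) * y t + Real.exp (-A t₁) * Z t - G t)
      (Set.Icc t₀ t₁) := by
    refine antitoneOn_of_hasDerivWithinAt_nonpos (convex_Icc t₀ t₁) (f' := fun t =>
      Real.exp (-A t) * (-a t) * y t + Real.exp (-A t) * y' t + Real.exp (-A t₁) * z t - h t)
      ?_ ?_ ?_
    · exact ((((Real.continuous_exp.comp hAc.neg).continuousOn.mul hy).add
        (continuous_const.mul hZc).continuousOn).sub hGc.continuousOn)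
    · intro t ht'
      rw [interior_Icc] at ht' ⊢
      exact ((((hAd t).neg.exp.mul (hy' t ht')).add ((hZd t).const_mul _)).sub
        (hGd t)).hasDerivWithinAt
    · intro t ht'
      rw [interior_Icc] at ht'
      have h1 := hle t ht'
      have h2 : Real.exp (-A t₁) ≤ Real.exp (-A t) :=
        Real.exp_le_exp.2 (neg_le_neg (hAmono ht'.2.le))
      have h3 : Real.exp (-A t) ≤ 1 := by
        rw [Real.exp_le_one_iff, neg_nonpos, ← hA0]
        exact hAmono ht'.1.le
      have h4 := mul_le_mul_of_nonneg_left h1 (Real.exp_pos (-A t)).le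
      have h5 := mul_le_mul_of_nonneg_right h2 (hz0 t)
      have h6 := mul_le_mul_of_nonneg_right h3 (hh0 t)
      nlinarith
  have hfin := hanti (Set.left_mem_Icc.2 ht) (Set.right_mem_Icc.2 ht) ht
  simp only [hA0, hZ0, hG0, neg_zero, Real.exp_zero, mul_zero, add_zero, sub_zero, one_mul] at hfin
  have hfin2 := mul_le_mul_of_nonneg_left hfin (Real.exp_pos (A t₁)).le
  have hone : Real.exp (A t₁) * Real.exp (-A t₁) = 1 := by
    rw [← Real.exp_add, add_neg_cancel, Real.exp_zero]
  change y t₁ + Z t₁ ≤ Real.exp (A t₁) * (y t₀ + G t₁)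
  have hexpand : Real.exp (A t₁) * (Real.exp (-A t₁) * y t₁ + Real.exp (-A t₁) * Z t₁ - G t₁) =
      (Real.exp (A t₁) * Real.exp (-A t₁)) * (y t₁ + Z t₁) - Real.exp (A t₁) * G t₁ := by ring
  rw [hexpand, hone] at hfin2
  linarith

section ODE

variable {E : Type*} [NormedAddCommGroup E] [InnerProductSpace ℝ E] [FiniteDimensional ℝ E]

/-- The vector field is cut off outside a large ball; the one-sided growth condition survives the
cutoff, and shows that the solution does not leave the ball. -/
theorem exists_solution_Icc {F : E → E} (hF : ContDiff ℝ 1 F) {K : ℝ} (hK : 0 ≤ K)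
    (hFK : ∀ x, inner ℝ x (F x) ≤ K * (1 + ‖x‖ ^ 2)) (x₀ : E) {T : ℝ} (hT : 0 ≤ T) :
    ∃ u : ℝ → E, u 0 = x₀ ∧
      ∀ t ∈ Set.Icc 0 T, HasDerivWithinAt u (F (u t)) (Set.Icc 0 T) t := by
  have : CompleteSpace E := FiniteDimensional.complete ℝ E
  set R : ℝ := Real.exp (2 * K * T) * (1 + ‖x₀‖ ^ 2) with hR
  have hRpos : 0 < R := by positivity
  let χ : ContDiffBump (0 : E) := ⟨R, R + 1, hRpos, by linarith⟩
  set G : E → E := fun x => χ x • F x with hG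
  have hGd : ContDiff ℝ 1 G := χ.contDiff.smul hF
  have hGc : HasCompactSupport G := χ.hasCompactSupport.smul_right
  obtain ⟨C, hC⟩ := hGc.exists_bound_of_continuous hGd.continuous
  obtain ⟨k, hk⟩ := ContDiff.lipschitzWith_of_hasCompactSupport hGc hGd one_ne_zero
  have hC0 : 0 ≤ C := (norm_nonneg _).trans (hC 0)
  have hpl : IsPicardLindelof (fun _ : ℝ => G) (tmin := 0) (tmax := T)
      ⟨0, Set.left_mem_Icc.2 hT⟩ x₀ ⟨C * T, mul_nonneg hC0 hT⟩ 0 ⟨C, hC0⟩ k :=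
    { lipschitzOnWith := fun t _ => hk.lipschitzOnWith
      continuousOn := fun x _ => continuousOn_const
      norm_le := fun t _ x _ => hC x
      mul_max_le := by
        simp only [sub_zero, sub_self, max_eq_left hT, NNReal.coe_zero]
        exact le_rfl }
  obtain ⟨u, hu0, hu⟩ := hpl.exists_eq_forall_mem_Icc_hasDerivWithinAt₀
  refine ⟨u, hu0, fun t ht => ?_⟩
  have hbound : ‖u t‖ ≤ R := by
    have hcont : ContinuousOn u (Set.Icc 0 T) := fun s hs => (hu s hs).continuousWithinAt
    have hsub : Set.Icc 0 t ⊆ Set.Icc 0 T := Set.Icc_subset_Icc_right ht.2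
    have hgw := gronwall ht.1 (y := fun s => 1 + ‖u s‖ ^ 2)
      (y' := fun s => 2 * inner ℝ (u s) (G (u s))) (a := fun _ => 2 * K) (z := fun _ => 0)
      (h := fun _ => 0) continuous_const continuous_const continuous_const
      (fun _ => by positivity) (fun _ => le_rfl) (fun _ => le_rfl)
      (continuousOn_const.add ((hcont.mono hsub).norm.pow 2)) (fun s hs => by
        have hs' : s ∈ Set.Ioo 0 T := ⟨hs.1, hs.2.trans_le ht.2⟩
        have := (hu s (Set.Ioo_subset_Icc_self hs')).hasDerivAt (Icc_mem_nhds hs'.1 hs'.2)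
        exact this.norm_sq.const_add 1) (fun s _ => by
        have h1 : inner ℝ (u s) (G (u s)) = χ (u s) * inner ℝ (u s) (F (u s)) :=
          real_inner_smul_right _ _ _
        have h2 := hFK (u s)
        have h3 : χ (u s) * inner ℝ (u s) (F (u s)) ≤ K * (1 + ‖u s‖ ^ 2) := by
          refine (mul_le_mul_of_nonneg_left h2 χ.nonneg).trans ?_
          exact mul_le_of_le_one_left (by positivity) χ.le_one
        rw [h1]
        linarith)
    simp only [intervalIntegral.integral_const, intervalIntegral.integral_zero, add_zero, sub_zero,
      smul_eq_mul, hu0] at hgw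
    have h5 : Real.exp (t * (2 * K)) ≤ Real.exp (2 * K * T) := by
      rw [Real.exp_le_exp, mul_comm]
      exact mul_le_mul_of_nonneg_left ht.2 (by positivity)
    have h6 : 1 + ‖u t‖ ^ 2 ≤ R :=
      hgw.trans (mul_le_mul_of_nonneg_right h5 (by positivity))
    nlinarith [sq_nonneg (‖u t‖ - 1)]
  have hone : χ (u t) = 1 := χ.one_of_mem_closedBall (by
    simpa only [Metric.mem_closedBall, dist_zero_right] using hbound)
  have := hu t ht
  simp only [hG, hone, one_smul] at this
  exact this

theorem eqOn_of_solution_Icc {F : E → E} (hF : ContDiff ℝ 1 F) {u v : ℝ → E} {T : ℝ}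
    (h0 : u 0 = v 0)
    (hu : ∀ t ∈ Set.Icc 0 T, HasDerivWithinAt u (F (u t)) (Set.Icc 0 T) t)
    (hv : ∀ t ∈ Set.Icc 0 T, HasDerivWithinAt v (F (v t)) (Set.Icc 0 T) t) :
    Set.EqOn u v (Set.Icc 0 T) := by
  have huc : ContinuousOn u (Set.Icc 0 T) := fun s hs => (hu s hs).continuousWithinAt
  have hvc : ContinuousOn v (Set.Icc 0 T) := fun s hs => (hv s hs).continuousWithinAt
  obtain ⟨a, ha⟩ := isCompact_Icc.exists_bound_of_continuousOn huc
  obtain ⟨b, hb⟩ := isCompact_Icc.exists_bound_of_continuousOn hvc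
  obtain ⟨k, hk⟩ := hF.contDiffOn.exists_lipschitzOnWith one_ne_zero
    (convex_closedBall (0 : E) (max a b)) (isCompact_closedBall _ _)
  have hright : ∀ {w : ℝ → E}, (∀ t ∈ Set.Icc 0 T,
      HasDerivWithinAt w (F (w t)) (Set.Icc 0 T) t) →
      ∀ t ∈ Set.Ico 0 T, HasDerivWithinAt w (F (w t)) (Set.Ici t) t := by
    intro w hw t ht
    refine ((hw t (Set.Ico_subset_Icc_self ht)).mono_of_mem_nhdsWithin ?_)
    exact Filter.mem_of_superset (Icc_mem_nhdsGE ht.2) (Set.Icc_subset_Icc_left ht.1)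
  refine ODE_solution_unique_of_mem_Icc_right (v := fun _ => F)
    (s := fun _ => Metric.closedBall 0 (max a b)) (K := k) (fun t _ => hk) huc (hright hu)
    (fun t ht => ?_) hvc (hright hv) (fun t ht => ?_) h0
  · rw [mem_closedBall_zero_iff]
    exact (ha t (Set.Ico_subset_Icc_self ht)).trans (le_max_left _ _)
  · rw [mem_closedBall_zero_iff]
    exact (hb t (Set.Ico_subset_Icc_self ht)).trans (le_max_right _ _)

/-- Global existence forward in time. The solution is extended by a straight line to negative times,
so that it is continuous on the whole line and differentiable at the initial time. -/
theorem exists_global_solution {F : E → E} (hF : ContDiff ℝ 1 F) {K : ℝ} (hK : 0 ≤ K)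
    (hFK : ∀ x, inner ℝ x (F x) ≤ K * (1 + ‖x‖ ^ 2)) (x₀ : E) :
    ∃ u : ℝ → E, u 0 = x₀ ∧ Continuous u ∧ ∀ t, 0 ≤ t → HasDerivAt u (F (u t)) t := by
  choose v hv0 hv using fun n : ℕ => exists_solution_Icc hF hK hFK x₀ (T := n) n.cast_nonneg
  have hagree : ∀ {m n : ℕ}, m ≤ n → Set.EqOn (v m) (v n) (Set.Icc 0 m) := by
    intro m n hmn
    have hsub : Set.Icc (0 : ℝ) m ⊆ Set.Icc 0 n :=
      Set.Icc_subset_Icc_right (by exact_mod_cast hmn)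
    exact eqOn_of_solution_Icc hF ((hv0 m).trans (hv0 n).symm) (hv m) fun t ht =>
      (hv n t (hsub ht)).mono hsub
  set w : ℝ → E := fun t => if t ≤ 0 then x₀ + t • F x₀ else v ⌈t⌉₊ t with hw
  have hwv : ∀ (n : ℕ) (t : ℝ), 0 ≤ t → t ≤ n → w t = v n t := by
    intro n t h0 hn
    rcases h0.eq_or_lt with rfl | hlt
    · simp [hw, hv0]
    · simp only [hw, not_le.2 hlt, if_false]
      exact hagree (Nat.ceil_le.2 hn) ⟨h0, Nat.le_ceil t⟩
  have hw0 : w 0 = x₀ := by simp [hw]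
  have hline : ∀ t : ℝ, HasDerivAt (fun t : ℝ => x₀ + t • F x₀) (F x₀) t := by
    intro t
    simpa using ((hasDerivAt_id t).smul_const (F x₀)).const_add x₀
  have hderiv : ∀ t, 0 ≤ t → HasDerivAt w (F (w t)) t := by
    intro t h0
    obtain ⟨n, hn⟩ := exists_nat_gt t
    have hn0 : (0 : ℝ) < n := h0.trans_lt hn
    have hvn := hv n t ⟨h0, hn.le⟩
    have hvw : HasDerivWithinAt w (F (w t)) (Set.Icc 0 n) t := by
      rw [hwv n t h0 hn.le]
      exact hvn.congr (fun s hs => hwv n s hs.1 hs.2) (hwv n t h0 hn.le)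
    rcases h0.eq_or_lt with rfl | hlt
    · have h1 : HasDerivWithinAt w (F (w 0)) (Set.Ici 0) 0 :=
        hvw.mono_of_mem_nhdsWithin (Icc_mem_nhdsGE hn0)
      have h2 : HasDerivWithinAt w (F (w 0)) (Set.Iic 0) 0 := by
        rw [hw0]
        exact (hline 0).hasDerivWithinAt.congr (fun s hs => if_pos hs) (if_pos le_rfl)
      have h3 := h2.union h1
      rwa [Set.Iic_union_Ici, hasDerivWithinAt_univ] at h3
    · exact hvw.hasDerivAt (Icc_mem_nhds hlt hn)
  refine ⟨w, hw0, continuous_iff_continuousAt.2 fun t => ?_, hderiv⟩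
  rcases le_or_gt 0 t with h0 | h0
  · exact (hderiv t h0).continuousAt
  · refine (hline t).continuousAt.congr ?_
    filter_upwards [Iio_mem_nhds h0] with s hs
    exact (if_pos (le_of_lt hs)).symm

end ODE

/-! ### Galerkin approximations -/

variable {L : ℝ} [Fact (0 < L)] {ν β γ : ℝ} {f : StrongDual ℝ (V L)}

/-- A path of trigonometric polynomials with frequencies up to `N` that solves the equation tested
with those trigonometric polynomials, for nonnegative times. -/
structure IsGalerkin (ν β γ : ℝ) (f : StrongDual ℝ (V L)) (N : ℕ) (u : ℝ → SmoothH L) :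
    Prop where
  spectrum : ∀ t, proj (freq N) (u t).toH = u t
  continuous_coeff : ∀ k : ℤ, Continuous fun t => inner ℝ (u t).toH (e k : SmoothH L).toH
  hasDerivAt_coeff : ∀ t, 0 ≤ t → ∀ k ∈ freq N,
    HasDerivAt (fun t => inner ℝ (u t).toH (e k : SmoothH L).toH)
      (rhs ν β γ f (u t).toH (e k)) t

/-- The energy inequality: half of the viscosity absorbs the derivative in the forcing term. -/
theorem rhs_self_le (hν : 0 < ν) (φ : SmoothH L) : 2 * rhs ν β γ f φ.toH φ ≤
    -ν * ‖φ.D.toH‖ ^ 2 + (2 * |β| + ν) * ‖φ.toH‖ ^ 2 + ‖f‖ ^ 2 / ν := by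
  rw [rhs_self]
  have h1 : f φ.toV ≤ ‖f‖ * ‖φ.toV‖ := (le_abs_self _).trans (f.le_opNorm φ.toV)
  have h2 := φ.norm_toV_sq
  have h3 : 2 * (‖f‖ * ‖φ.toV‖) ≤ ‖f‖ ^ 2 / ν + ν * ‖φ.toV‖ ^ 2 := by
    have h4 := div_nonneg (sq_nonneg (‖f‖ - ν * ‖φ.toV‖)) hν.le
    have h5 : (‖f‖ - ν * ‖φ.toV‖) ^ 2 / ν =
        ‖f‖ ^ 2 / ν + ν * ‖φ.toV‖ ^ 2 - 2 * (‖f‖ * ‖φ.toV‖) := by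
      field_simp
      ring
    linarith
  have h6 : β * ‖φ.toH‖ ^ 2 ≤ |β| * ‖φ.toH‖ ^ 2 :=
    mul_le_mul_of_nonneg_right (le_abs_self β) (sq_nonneg _)
  rw [h2] at h3
  linarith

namespace IsGalerkin

variable {N : ℕ} {u : ℝ → SmoothH L}

theorem eq_sum (hu : IsGalerkin ν β γ f N u) (t : ℝ) :
    u t = ∑ k ∈ freq N, (inner ℝ (u t).toH (e k : SmoothH L).toH : ℝ) • (e k : SmoothH L) :=
  (hu.spectrum t).symm

theorem continuous_map (hu : IsGalerkin ν β γ f N u) {G : Type*} [NormedAddCommGroup G]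
    [NormedSpace ℝ G] (ℓ : SmoothH L →ₗ[ℝ] G) : Continuous fun t => ℓ (u t) := by
  have h : ∀ t, ℓ (u t) = ∑ k ∈ freq N,
      (inner ℝ (u t).toH (e k : SmoothH L).toH : ℝ) • ℓ (e k) := by
    intro t
    conv_lhs => rw [hu.eq_sum t, map_sum]
    simp only [map_smul]
  simp only [h]
  exact continuous_finsetSum _ fun k _ => (hu.continuous_coeff k).smul continuous_const

theorem continuous_toH (hu : IsGalerkin ν β γ f N u) : Continuous fun t => (u t).toH :=
  hu.continuous_map (SmoothH.toH (L := L))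

theorem continuous_D_toH (hu : IsGalerkin ν β γ f N u) : Continuous fun t => (u t).D.toH :=
  hu.continuous_map ((SmoothH.toH (L := L)) ∘ₗ SmoothH.D)

theorem continuous_toV (hu : IsGalerkin ν β γ f N u) : Continuous fun t => (u t).toV :=
  hu.continuous_map (SmoothH.toV (L := L))

end IsGalerkin

/-- The trigonometric polynomial with given coefficients. -/
def trigPoly (N : ℕ) : EuclideanSpace ℝ (freq N) →ₗ[ℝ] SmoothH L where
  toFun x := ∑ k, x k • e (k : ℤ)
  map_add' x y := by simp only [PiLp.add_apply, add_smul, Finset.sum_add_distrib]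
  map_smul' c x := by
    simp only [PiLp.smul_apply, smul_eq_mul, mul_smul, Finset.smul_sum, RingHom.id_apply]

theorem inner_trigPoly (N : ℕ) (x : EuclideanSpace ℝ (freq N)) (j : ℤ) :
    inner ℝ (trigPoly N x : SmoothH L).toH (e j : SmoothH L).toH =
      if h : j ∈ freq N then x ⟨j, h⟩ else 0 := by
  change inner ℝ (∑ k, x k • (e (k : ℤ) : SmoothH L)).toH _ = _
  have h1 : ∑ k, x k • (e (k : ℤ) : SmoothH L) = ∑ k ∈ freq N,
      (if h : k ∈ freq N then x ⟨k, h⟩ else 0) • (e k : SmoothH L) := by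
    rw [← Finset.sum_coe_sort (freq N)]
    refine Finset.sum_congr rfl fun k _ => ?_
    rw [dif_pos k.2]
  rw [h1, inner_sum_e]
  by_cases hj : j ∈ freq N
  · simp [hj, (mem_freq.1 hj).1]
  · simp [hj]

theorem norm_trigPoly (N : ℕ) (x : EuclideanSpace ℝ (freq N)) :
    ‖(trigPoly N x : SmoothH L).toH‖ ^ 2 = ‖x‖ ^ 2 := by
  have h : proj (freq N) (trigPoly N x : SmoothH L).toH = trigPoly N x := by
    refine SmoothH.eq_of_inner_e fun k => ?_
    rw [inner_proj_e, inner_trigPoly]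
    split_ifs <;> rfl
  rw [← h, norm_proj_sq, EuclideanSpace.real_norm_sq_eq, ← Finset.sum_coe_sort (freq N)]
  refine Finset.sum_congr rfl fun k _ => ?_
  rw [inner_trigPoly, dif_pos k.2]

/-- In coefficients the approximation is a system of ordinary differential equations, whose
solutions are global by the energy inequality. -/
theorem exists_galerkin (hν : 0 < ν) (N : ℕ) (u₀ : H L) :
    ∃ u : ℝ → SmoothH L, IsGalerkin ν β γ f N u ∧ u 0 = proj (freq N) u₀ := by
  let U := trigPoly (L := L) N
  let F : EuclideanSpace ℝ (freq N) → EuclideanSpace ℝ (freq N) := fun x =>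
    WithLp.toLp 2 fun k => rhs ν β γ f (U x).toH (e (k : ℤ))
  have hF : ContDiff ℝ 1 F := by
    rw [contDiff_euclidean]
    intro k
    have h1 : ContDiff ℝ (⊤ : ℕ∞) fun x => (U x).toH :=
      (LinearMap.toContinuousLinearMap ((SmoothH.toH (L := L)) ∘ₗ U)).contDiff
    exact ((contDiff_rhs (e (k : ℤ))).comp h1).of_le (by exact_mod_cast le_top)
  have hFK : ∀ x, inner ℝ x (F x) ≤ (2 * |β| + ν + ‖f‖ ^ 2 / ν) * (1 + ‖x‖ ^ 2) := by
    intro x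
    have h1 : inner ℝ x (F x) = rhs ν β γ f (U x).toH (U x) := by
      have h2 : rhs ν β γ f (U x).toH (U x) =
          ∑ k, x k * rhs ν β γ f (U x).toH (e (k : ℤ)) := by
        conv_lhs => rw [show U x = ∑ k, x k • (e (k : ℤ) : SmoothH L) from rfl]
        rw [map_sum]
        simp only [map_smul, smul_eq_mul]
        rfl
      rw [h2, PiLp.inner_apply]
      refine Finset.sum_congr rfl fun k _ => ?_
      simp [F, mul_comm]
    have h3 := rhs_self_le (β := β) (γ := γ) (f := f) hν (U x)
    rw [norm_trigPoly] at h3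
    have h4 : 0 ≤ ν * ‖(U x).D.toH‖ ^ 2 := by positivity
    have h5 : 0 ≤ ‖f‖ ^ 2 / ν := by positivity
    have h6 : 0 ≤ (2 * |β| + ν) * ‖x‖ ^ 2 := by positivity
    have h7 : 0 ≤ ‖f‖ ^ 2 / ν * ‖x‖ ^ 2 := by positivity
    have h8 : 0 ≤ 2 * |β| + ν := by positivity
    rw [h1]
    nlinarith
  obtain ⟨x, hx0, hxc, hx⟩ := exists_global_solution hF (by positivity) hFK
    (WithLp.toLp 2 fun k : freq N => inner ℝ u₀ (e (k : ℤ) : SmoothH L).toH)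
  refine ⟨fun t => U (x t), ⟨fun t => ?_, fun k => ?_, fun t ht k hk => ?_⟩, ?_⟩
  · refine SmoothH.eq_of_inner_e fun k => ?_
    rw [inner_proj_e, inner_trigPoly]
    split_ifs <;> rfl
  · simp only [U, inner_trigPoly]
    split_ifs
    · fun_prop
    · exact continuous_const
  · simp only [U, inner_trigPoly, dif_pos hk]
    exact (EuclideanSpace.proj (𝕜 := ℝ) (⟨k, hk⟩ : freq N)).hasFDerivAt.comp_hasDerivAt t (hx t ht)
  · refine SmoothH.eq_of_inner_e fun k => ?_
    rw [inner_proj_e, inner_trigPoly, hx0]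
    split_ifs <;> rfl

end

section

variable {L : ℝ} [Fact (0 < L)] {ν β γ : ℝ} {f : StrongDual ℝ (V L)}

/-! ### Energy estimates -/

theorem hasDerivAt_norm_sq {A : Finset ℤ} {w : ℝ → SmoothH L} {d : ℤ → ℝ} {t : ℝ}
    (hw : ∀ t, proj A (w t).toH = w t)
    (hd : ∀ k ∈ A, HasDerivAt (fun t => inner ℝ (w t).toH (e k : SmoothH L).toH) (d k) t) :
    HasDerivAt (fun t => ‖(w t).toH‖ ^ 2)
      (2 * ∑ k ∈ A, inner ℝ (w t).toH (e k : SmoothH L).toH * d k) t := by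
  have h1 : (fun t => ‖(w t).toH‖ ^ 2) =
      fun t => ∑ k ∈ A, (inner ℝ (w t).toH (e k : SmoothH L).toH : ℝ) ^ 2 := by
    funext t
    conv_lhs => rw [← hw t]
    rw [norm_proj_sq]
  rw [h1, Finset.mul_sum]
  refine HasDerivAt.fun_sum fun k hk => ?_
  exact ((hd k hk).pow 2).congr_deriv (by ring)

theorem sum_inner_mul_rhs (A : Finset ℤ) (v w : H L) :
    ∑ k ∈ A, inner ℝ w (e k : SmoothH L).toH * rhs ν β γ f v (e k) =
      rhs ν β γ f v (proj A w) := by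
  rw [proj_apply, map_sum]
  simp only [map_smul, smul_eq_mul]

/-- The difference of two right-hand sides, tested with a truncation of the difference: the
dissipation absorbs the derivative in the transport term, and only the sum of the arguments needs to
lie in the energy space. -/
theorem rhs_sub_le (hν : 0 < ν) {A : Finset ℤ} (hA : ∀ k, -k ∈ A ↔ k ∈ A) (a b : H L) (p : V L)
    (hp : V.fn p = a + b) :
    2 * (rhs ν β γ f a (proj A (a - b)) - rhs ν β γ f b (proj A (a - b))) ≤
      -ν * ‖(proj A (a - b)).D.toH‖ ^ 2 +
        (2 * |β| + ‖p‖ ^ 2 / (4 * ν)) * ‖a - b‖ ^ 2 := by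
  set φ := proj A (a - b) with hφ
  have hφφ : proj A φ.toH = φ := by
    rw [hφ, proj_proj, Finset.inter_self]
  have hD1 : proj A φ.D.toH = φ.D := by rw [← D_proj hA, hφφ]
  have hD2 : proj A φ.D.D.toH = φ.D.D := by rw [← D_proj hA, hD1]
  have hD3 : proj A φ.D.D.D.toH = φ.D.D.D := by rw [← D_proj hA, hD2]
  have hin : ∀ {ψ : SmoothH L}, proj A ψ.toH = ψ →
      inner ℝ a ψ.toH - inner ℝ b ψ.toH = inner ℝ φ.toH ψ.toH := by
    intro ψ hψ
    rw [← inner_sub_left, hφ, inner_proj_comm, hψ]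
  have h1 := hin hD2
  have h2 := hin hφφ
  have h3 := hin hD3
  rw [SmoothH.inner_D, real_inner_self_eq_norm_sq] at h1
  rw [real_inner_self_eq_norm_sq] at h2
  rw [SmoothH.inner_D, SmoothH.inner_self_D, neg_zero] at h3
  have h4 : tri φ.D a a - tri φ.D b b = tri φ.D (V.fn p) (a - b) := by
    rw [hp, map_sub, map_add, add_apply, add_apply,
      tri_comm φ.D a b]
    ring
  have h5 := (le_abs_self _).trans (V.abs_tri_le p (a - b) φ.D)
  have h6 : β * ‖φ.toH‖ ^ 2 ≤ |β| * ‖a - b‖ ^ 2 := by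
    have h7 := norm_proj_le A (a - b)
    have h8 := le_abs_self β
    have h9 : ‖φ.toH‖ ^ 2 ≤ ‖a - b‖ ^ 2 := pow_le_pow_left₀ (norm_nonneg _) h7 2
    exact (mul_le_mul_of_nonneg_right h8 (sq_nonneg _)).trans
      (mul_le_mul_of_nonneg_left h9 (abs_nonneg β))
  have h10 : ‖p‖ * ‖a - b‖ * ‖φ.D.toH‖ ≤
      ν * ‖φ.D.toH‖ ^ 2 + ‖p‖ ^ 2 / (4 * ν) * ‖a - b‖ ^ 2 := by
    have h11 := div_nonneg (sq_nonneg (2 * ν * ‖φ.D.toH‖ - ‖p‖ * ‖a - b‖))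
      (by positivity : 0 ≤ 4 * ν)
    have h12 : (2 * ν * ‖φ.D.toH‖ - ‖p‖ * ‖a - b‖) ^ 2 / (4 * ν) =
        ν * ‖φ.D.toH‖ ^ 2 + ‖p‖ ^ 2 / (4 * ν) * ‖a - b‖ ^ 2 - ‖p‖ * ‖a - b‖ * ‖φ.D.toH‖ := by
      field_simp
      ring
    linarith
  have h13 : 2 * (rhs ν β γ f a φ - rhs ν β γ f b φ) =
      2 * ν * (inner ℝ a φ.D.D.toH - inner ℝ b φ.D.D.toH) + (tri φ.D a a - tri φ.D b b) +
      2 * β * (inner ℝ a φ.toH - inner ℝ b φ.toH) +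
      2 * γ * (inner ℝ a φ.D.D.D.toH - inner ℝ b φ.D.D.D.toH) := by
    rw [rhs_apply, rhs_apply]
    ring
  rw [h13, h1, h2, h3, h4]
  linarith

theorem proj_sub_proj {A B : Finset ℤ} (h : B ⊆ A) (w : H L) :
    proj A w - proj B w = proj (A \ B) w := by
  rw [proj_apply, proj_apply, proj_apply, ← Finset.sum_sdiff h, add_sub_cancel_right]

theorem neg_mem_sdiff {A B : Finset ℤ} (hA : ∀ k, -k ∈ A ↔ k ∈ A) (hB : ∀ k, -k ∈ B ↔ k ∈ B)
    (k : ℤ) : -k ∈ A \ B ↔ k ∈ A \ B := by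
  rw [Finset.mem_sdiff, Finset.mem_sdiff, hA, hB]

/-- The norm of the high-frequency part of a functional on the energy space tends to zero. -/
theorem exists_tail_bound (f : StrongDual ℝ (V L)) : ∃ η : ℕ → ℝ,
    Filter.Tendsto η Filter.atTop (nhds 0) ∧ (∀ N, 0 ≤ η N) ∧ ∀ (N M : ℕ) (w : H L),
      |f (proj (freq M \ freq N) w).toV| ≤ η N * ‖(proj (freq M \ freq N) w).toV‖ := by
  obtain ⟨g, hg⟩ := (InnerProductSpace.toDual ℝ (V L)).surjective f
  refine ⟨fun N => ‖(proj (freq N) (V.fn g)).toV - g‖,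
    tendsto_iff_norm_sub_tendsto_zero.1 (V.tendsto_proj g), fun N => norm_nonneg _,
    fun N M w => ?_⟩
  -- the representative `g` of `f` may be replaced by its high-frequency part
  set q := proj (freq M \ freq N) w with hq
  have h1 : f q.toV = inner ℝ g q.toV := by
    rw [← hg]
    rfl
  have h2 : inner ℝ (proj (freq N) (V.fn g)).toV q.toV = (0 : ℝ) := by
    rw [V.inner_eq, V.fn_toV, V.fn_toV, V.deriv_toV, V.deriv_toV, V.D_proj neg_mem_freq, hq]
    have h3 : freq N ∩ (freq M \ freq N) = ∅ := by
      ext k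
      simp
    have h4 : (proj (freq M \ freq N) w).D =
        proj (freq M \ freq N) (proj (freq M \ freq N) w).D.toH := by
      rw [← D_proj (neg_mem_sdiff neg_mem_freq neg_mem_freq), proj_proj, Finset.inter_self]
    rw [h4]
    rw [inner_proj_comm, inner_proj_comm, proj_proj, proj_proj, h3]
    simp [proj_apply]
  have h5 : f q.toV = - inner ℝ ((proj (freq N) (V.fn g)).toV - g) q.toV := by
    rw [h1, inner_sub_left, h2]
    ring
  rw [h5, abs_neg]
  exact abs_real_inner_le_norm _ _

/-- The numerical part of the estimate of a transport term by Agmon's inequality (for the function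
with norms `a`, `a'`) and a high-frequency bound (for the part of size `q` of the function with
norms `b`, `b'`). -/
theorem interpolation_aux {a b a' b' q B κ : ℝ} (ha : 0 ≤ a) (hb : 0 ≤ b) (ha' : 0 ≤ a')
    (hb' : 0 ≤ b') (hq : 0 ≤ q) (haB : a ^ 2 ≤ B) (hbB : b ^ 2 ≤ B) (hqb : q ≤ b) (hκ : 0 < κ)
    (hqκ : κ * q ≤ b') :
    Real.sqrt (2 * (a * a')) * q * a' ≤ Real.sqrt (B / κ) * (a' ^ 2 + b' ^ 2) := by
  have hB : 0 ≤ B := (sq_nonneg a).trans haB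
  refine le_of_sq_le_sq ?_ (by positivity)
  have hq2 : q ^ 2 ≤ b * b' / κ := by
    rw [le_div_iff₀ hκ]
    have := mul_le_mul hqb hqκ (by positivity) hb
    linarith
  have hab : a * b ≤ B := by nlinarith [sq_nonneg (a - b)]
  have hab' : 2 * (a' * b') ≤ a' ^ 2 + b' ^ 2 := by nlinarith [sq_nonneg (a' - b')]
  have haS : a' ^ 2 ≤ a' ^ 2 + b' ^ 2 := le_add_of_nonneg_right (sq_nonneg _)
  rw [mul_pow, mul_pow, mul_pow, Real.sq_sqrt (by positivity), Real.sq_sqrt (by positivity)]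
  calc 2 * (a * a') * q ^ 2 * a' ^ 2
      ≤ 2 * (a * a') * (b * b' / κ) * (a' ^ 2 + b' ^ 2) := by gcongr
    _ = (a * b) * (2 * (a' * b')) / κ * (a' ^ 2 + b' ^ 2) := by ring
    _ ≤ B * (a' ^ 2 + b' ^ 2) / κ * (a' ^ 2 + b' ^ 2) := by gcongr
    _ = B / κ * (a' ^ 2 + b' ^ 2) ^ 2 := by ring

namespace IsGalerkin

variable {N M : ℕ} {u v : ℝ → SmoothH L}

theorem hasDerivAt_energy (hu : IsGalerkin ν β γ f N u) {t : ℝ} (ht : 0 ≤ t) :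
    HasDerivAt (fun t => ‖(u t).toH‖ ^ 2) (2 * rhs ν β γ f (u t).toH (u t)) t := by
  refine (hasDerivAt_norm_sq hu.spectrum (hu.hasDerivAt_coeff t ht)).congr_deriv ?_
  rw [sum_inner_mul_rhs, hu.spectrum]

theorem energy_le (hν : 0 < ν) (hu : IsGalerkin ν β γ f N u) {t T : ℝ} (ht : 0 ≤ t)
    (htT : t ≤ T) : ‖(u t).toH‖ ^ 2 + ν * ∫ s in (0 : ℝ)..t, ‖(u s).D.toH‖ ^ 2 ≤
      Real.exp ((2 * |β| + ν) * T) * (‖(u 0).toH‖ ^ 2 + ‖f‖ ^ 2 / ν * T) := by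
  have hcD := (hu.continuous_D_toH.norm.pow 2).const_mul ν
  have h := gronwall ht (y := fun t => ‖(u t).toH‖ ^ 2)
    (y' := fun t => 2 * rhs ν β γ f (u t).toH (u t)) (a := fun _ => 2 * |β| + ν)
    (z := fun t => ν * ‖(u t).D.toH‖ ^ 2) (h := fun _ => ‖f‖ ^ 2 / ν) continuous_const
    hcD continuous_const (fun _ => by positivity) (fun _ => by positivity) (fun _ => by positivity)
    (hu.continuous_toH.norm.pow 2).continuousOn (fun t ht => hu.hasDerivAt_energy ht.1.le)
    (fun t _ => by
      have := rhs_self_le (β := β) (γ := γ) (f := f) hν (u t)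
      linarith)
  rw [intervalIntegral.integral_const_mul, intervalIntegral.integral_const,
    intervalIntegral.integral_const, smul_eq_mul, smul_eq_mul, sub_zero] at h
  refine h.trans ?_
  have h1 : t * (2 * |β| + ν) ≤ (2 * |β| + ν) * T := by
    rw [mul_comm]
    exact mul_le_mul_of_nonneg_left htT (by positivity)
  have h2 : t * (‖f‖ ^ 2 / ν) ≤ ‖f‖ ^ 2 / ν * T := by
    rw [mul_comm]
    exact mul_le_mul_of_nonneg_left htT (by positivity)
  gcongr

theorem proj_of_le (hu : IsGalerkin ν β γ f N u) (hNM : N ≤ M) (t : ℝ) :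
    proj (freq M) (u t).toH = u t := by
  rw [← hu.spectrum t, proj_proj, Finset.inter_eq_right.2 (freq_subset hNM)]

/-- The equation for the larger number of modes has the additional terms of the high frequencies,
in which the equation for `u` does not hold. -/
theorem hasDerivAt_energy_sub (hNM : N ≤ M) (hu : IsGalerkin ν β γ f N u)
    (hv : IsGalerkin ν β γ f M v) {t : ℝ} (ht : 0 ≤ t) :
    HasDerivAt (fun t => ‖(u t - v t).toH‖ ^ 2)
      (2 * (rhs ν β γ f (u t).toH (u t - v t) - rhs ν β γ f (v t).toH (u t - v t)) +
        2 * rhs ν β γ f (u t).toH (proj (freq M \ freq N) (v t).toH)) t := by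
  have hspec : ∀ t, proj (freq M) (u t - v t).toH = u t - v t := by
    intro t
    rw [map_sub, map_sub, hu.proj_of_le hNM, hv.spectrum]
  have hd : ∀ k ∈ freq M, HasDerivAt (fun t => inner ℝ (u t - v t).toH (e k : SmoothH L).toH)
      ((if k ∈ freq N then rhs ν β γ f (u t).toH (e k) else 0) -
        rhs ν β γ f (v t).toH (e k)) t := by
    intro k hk
    simp only [map_sub, inner_sub_left]
    refine HasDerivAt.sub ?_ (hv.hasDerivAt_coeff t ht k hk)
    split_ifs with hkN
    · exact hu.hasDerivAt_coeff t ht k hkN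
    · have : (fun t => inner ℝ (u t).toH (e k : SmoothH L).toH) = fun _ => (0 : ℝ) := by
        funext t
        rw [← hu.spectrum t, inner_proj_e, if_neg hkN]
      rw [this]
      exact hasDerivAt_const _ _
  refine (hasDerivAt_norm_sq hspec hd).congr_deriv ?_
  simp only [mul_sub, mul_ite, mul_zero, Finset.sum_sub_distrib]
  rw [sum_inner_mul_rhs, hspec, ← Finset.sum_filter, Finset.filter_mem_eq_inter,
    Finset.inter_eq_right.2 (freq_subset hNM), sum_inner_mul_rhs]
  have hq : proj (freq N) (u t - v t).toH = (u t - v t) + proj (freq M \ freq N) (v t).toH := by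
    rw [← proj_sub_proj (freq_subset hNM), map_sub, map_sub, hu.spectrum, hv.spectrum]
    abel
  rw [hq, map_add]
  ring

/-- On high frequencies only the transport term and the forcing are felt. -/
theorem rhs_high (hu : IsGalerkin ν β γ f N u) (t : ℝ) {q : SmoothH L}
    (hqq : proj (freq M \ freq N) q.toH = q) :
    rhs ν β γ f (u t).toH q = - tri (u t) q.toH (u t).D.toH + f q.toV := by
  have hsym := neg_mem_sdiff (neg_mem_freq (N := M)) (neg_mem_freq (N := N))
  have hDq : proj (freq M \ freq N) q.D.toH = q.D := by rw [← D_proj hsym, hqq]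
  have hDDq : proj (freq M \ freq N) q.D.D.toH = q.D.D := by rw [← D_proj hsym, hDq]
  have hDDDq : proj (freq M \ freq N) q.D.D.D.toH = q.D.D.D := by rw [← D_proj hsym, hDDq]
  have horth : ∀ {ψ : SmoothH L}, proj (freq M \ freq N) ψ.toH = ψ →
      inner ℝ (u t).toH ψ.toH = (0 : ℝ) := by
    intro ψ hψ
    have h3 : freq N ∩ (freq M \ freq N) = ∅ := by
      ext k
      simp
    rw [← hψ, ← hu.spectrum t, inner_proj_comm, proj_proj, h3]
    simp [proj_apply]
  have htri : tri q.D (u t).toH (u t).toH = -2 * tri (u t) q.toH (u t).D.toH := by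
    have h1 : tri q.D (u t).toH (u t).toH = ∫ x, (u t).1 x ^ 2 * q.D.1 x := by
      rw [tri_toH_toH]
      simp only [pow_two]
    rw [h1, SmoothH.integral_sq_mul_D, tri_toH_toH, ← integral_neg, ← integral_const_mul]
    congr 1
    funext x
    ring
  rw [rhs_apply, horth hqq, horth hDDq, horth hDDDq, htri]
  ring

/-- The error that the truncation of the equation for `u` makes in the equation for `v`. -/
theorem rhs_tail_le {η : ℕ → ℝ} (hη : ∀ (N M : ℕ) (w : H L),
      |f (proj (freq M \ freq N) w).toV| ≤ η N * ‖(proj (freq M \ freq N) w).toV‖)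
    (hη0 : ∀ N, 0 ≤ η N)
    (hu : IsGalerkin ν β γ f N u) {t B : ℝ} {φ : SmoothH L}
    (hub : ‖(u t).toH‖ ^ 2 ≤ B) (hvb : ‖φ.toH‖ ^ 2 ≤ B) :
    2 * rhs ν β γ f (u t).toH (proj (freq M \ freq N) φ.toH) ≤
      2 * (Real.sqrt (B / ((N + 1) * omega L)) + η N) *
        (1 + B + ‖(u t).D.toH‖ ^ 2 + ‖φ.D.toH‖ ^ 2) := by
  have hω := omega_pos (L := L)
  have hB : 0 ≤ B := (sq_nonneg _).trans hub
  obtain ⟨q, hq⟩ : ∃ q, q = proj (freq M \ freq N) φ.toH := ⟨_, rfl⟩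
  have hqq : proj (freq M \ freq N) q.toH = q := by
    rw [hq, proj_proj, Finset.inter_self]
  have hqn : ‖q.toH‖ ≤ ‖φ.toH‖ := hq ▸ norm_proj_le _ _
  have hqD : ‖q.D.toH‖ ≤ ‖φ.D.toH‖ := by
    rw [hq, D_proj (neg_mem_sdiff neg_mem_freq neg_mem_freq)]
    exact norm_proj_le _ _
  have hqlow : ((N : ℝ) + 1) * omega L * ‖q.toH‖ ≤ ‖q.D.toH‖ := by
    rw [hq]
    refine norm_toH_le_of_high (by positivity) (fun k hk => ?_) (fun h0 => ?_) _
    · rw [Finset.mem_sdiff, mem_freq, mem_freq, not_and, not_le] at hk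
      have : (N : ℤ) + 1 ≤ |k| := hk.2 hk.1.1
      exact_mod_cast this
    · exact (mem_freq.1 (Finset.mem_sdiff.1 h0).1).1 rfl
  have htle := abs_tri_le_of_forall (u t) q.toH (u t).D.toH fun x =>
    Real.abs_le_sqrt ((u t).agmon x)
  have hprod := interpolation_aux (norm_nonneg (u t).toH) (norm_nonneg φ.toH)
    (norm_nonneg (u t).D.toH) (norm_nonneg φ.D.toH) (norm_nonneg q.toH) hub hvb hqn
    (by positivity : 0 < ((N : ℝ) + 1) * omega L) (hqlow.trans hqD)
  have hf0 : f q.toV ≤ η N * ‖q.toV‖ := by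
    rw [hq]
    exact (le_abs_self _).trans (hη N M φ.toH)
  have hqV : ‖q.toV‖ ^ 2 = ‖q.toH‖ ^ 2 + ‖q.D.toH‖ ^ 2 := q.norm_toV_sq
  rw [← hq, hu.rhs_high t hqq]
  have h7 := neg_le_of_abs_le htle
  have h8 : 0 ≤ Real.sqrt (B / ((N + 1) * omega L)) := Real.sqrt_nonneg _
  generalize Real.sqrt (B / ((N + 1) * omega L)) = σ at *
  generalize tri (u t) q.toH (u t).D.toH = τ at *
  generalize f q.toV = fq at *
  have hη1 := hη0 N
  clear hη hη0 hu
  generalize η N = η' at *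
  have hS : ‖q.toV‖ ≤ 1 + B + ‖(u t).D.toH‖ ^ 2 + ‖φ.D.toH‖ ^ 2 := by
    have h2 : ‖q.toH‖ ^ 2 ≤ ‖φ.toH‖ ^ 2 := pow_le_pow_left₀ (norm_nonneg _) hqn 2
    have h3 : ‖q.D.toH‖ ^ 2 ≤ ‖φ.D.toH‖ ^ 2 := pow_le_pow_left₀ (norm_nonneg _) hqD 2
    have h4 := sq_nonneg ‖(u t).D.toH‖
    have h5 := sq_nonneg (‖q.toV‖ - 1)
    have h6 : (‖q.toV‖ - 1) ^ 2 = ‖q.toV‖ ^ 2 - 2 * ‖q.toV‖ + 1 := by ring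
    have h7 := sq_nonneg ‖q.toV‖
    linarith
  have hf1 := mul_le_mul_of_nonneg_left hS hη1
  have h9 : 0 ≤ σ * (1 + B) := by positivity
  have h10 : 2 * (σ + η') * (1 + B + ‖(u t).D.toH‖ ^ 2 + ‖φ.D.toH‖ ^ 2) =
      2 * (σ * (1 + B)) + 2 * (σ * (‖(u t).D.toH‖ ^ 2 + ‖φ.D.toH‖ ^ 2)) +
        2 * (η' * (1 + B + ‖(u t).D.toH‖ ^ 2 + ‖φ.D.toH‖ ^ 2)) := by ring
  rw [h10]
  linarith

end IsGalerkin

/-- Galerkin approximations with the same initial value form a Cauchy sequence, in the energy norm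
of every bounded time interval. -/
theorem galerkin_cauchy (hν : 0 < ν) {u₀ : H L} {u : ℕ → ℝ → SmoothH L}
    (hu : ∀ N, IsGalerkin ν β γ f N (u N)) (hu0 : ∀ N, u N 0 = proj (freq N) u₀) {T : ℝ}
    (hT : 0 ≤ T) : ∃ κ : ℕ → ℝ, Filter.Tendsto κ Filter.atTop (nhds 0) ∧
      ∀ N M, N ≤ M → ∀ t ∈ Set.Icc 0 T,
        ‖(u N t - u M t).toH‖ ^ 2 + ν * ∫ s in (0 : ℝ)..t, ‖(u N s - u M s).D.toH‖ ^ 2 ≤ κ N := by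
  obtain ⟨η, hη, hη0, hηf⟩ := exists_tail_bound f
  have hω := omega_pos (L := L)
  set B := Real.exp ((2 * |β| + ν) * T) * (‖u₀‖ ^ 2 + ‖f‖ ^ 2 / ν * T) with hB
  have hBpos : 0 ≤ B := by positivity
  have hen : ∀ N, ∀ t ∈ Set.Icc 0 T,
      ‖(u N t).toH‖ ^ 2 + ν * ∫ s in (0 : ℝ)..t, ‖(u N s).D.toH‖ ^ 2 ≤ B := by
    intro N t ht
    refine ((hu N).energy_le hν ht.1 ht.2).trans ?_
    have := norm_proj_le (freq N) u₀
    rw [hu0, hB]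
    gcongr
  have hint0 : ∀ N, ∀ t ∈ Set.Icc 0 T, 0 ≤ ∫ s in (0 : ℝ)..t, ‖(u N s).D.toH‖ ^ 2 :=
    fun N t ht => intervalIntegral.integral_nonneg ht.1 fun s _ => sq_nonneg _
  have hsup : ∀ N, ∀ t ∈ Set.Icc 0 T, ‖(u N t).toH‖ ^ 2 ≤ B := fun N t ht =>
    (le_add_of_nonneg_right (mul_nonneg hν.le (hint0 N t ht))).trans (hen N t ht)
  have hdiss : ∀ N, ∀ t ∈ Set.Icc 0 T, ∫ s in (0 : ℝ)..t, ‖(u N s).D.toH‖ ^ 2 ≤ B / ν := by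
    intro N t ht
    rw [le_div_iff₀ hν, mul_comm]
    exact (le_add_of_nonneg_left (sq_nonneg _)).trans (hen N t ht)
  -- the size of the error of the truncation
  set ε : ℕ → ℝ := fun N => 2 * (Real.sqrt (B / ((N + 1) * omega L)) + η N) with hε
  have hε0 : ∀ N, 0 ≤ ε N := fun N => by
    have := hη0 N
    positivity
  have hεlim : Filter.Tendsto ε Filter.atTop (nhds 0) := by
    have h1 : Filter.Tendsto (fun N : ℕ => B / (((N : ℝ) + 1) * omega L)) Filter.atTop
        (nhds 0) := by
      refine Filter.Tendsto.const_div_atTop ?_ B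
      exact (Filter.tendsto_atTop_add_const_right _ _
        tendsto_natCast_atTop_atTop).atTop_mul_const hω
    have h2 := (h1.sqrt.add hη).const_mul 2
    simpa using h2
  -- bounds on the integrals of the rate and of the source in Gronwall's inequality
  set Ca := 2 * |β| * T + 1 / (2 * ν) * (2 * B * T + 2 * (B / ν)) with hCa
  set Ch := (1 + B) * T + 2 * (B / ν) with hCh
  refine ⟨fun N => Real.exp Ca * (‖(proj (freq N) u₀).toH - u₀‖ ^ 2 + ε N * Ch), ?_, ?_⟩
  · have h1 := (tendsto_iff_norm_sub_tendsto_zero.1 (tendsto_proj u₀)).pow 2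
    have h2 := ((h1.add (hεlim.mul_const Ch)).const_mul (Real.exp Ca))
    simpa using h2
  intro N M hNM t ht
  have hcDu : Continuous fun t => ‖(u N t).D.toH‖ ^ 2 := (hu N).continuous_D_toH.norm.pow 2
  have hcDv : Continuous fun t => ‖(u M t).D.toH‖ ^ 2 := (hu M).continuous_D_toH.norm.pow 2
  have hc1 : Continuous fun t => 1 + B + ‖(u N t).D.toH‖ ^ 2 := continuous_const.add hcDu
  have hc2 : Continuous fun t =>
      1 / (2 * ν) * (‖(u N t).D.toH‖ ^ 2 + ‖(u M t).D.toH‖ ^ 2) :=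
    continuous_const.mul (hcDu.add hcDv)
  have hcw : Continuous fun t => ‖(u N t - u M t).toH‖ ^ 2 := by
    simp only [map_sub]
    exact ((hu N).continuous_toH.sub (hu M).continuous_toH).norm.pow 2
  have hcDw : Continuous fun t => ‖(u N t - u M t).D.toH‖ ^ 2 := by
    simp only [map_sub]
    exact ((hu N).continuous_D_toH.sub (hu M).continuous_D_toH).norm.pow 2
  have hca : Continuous fun t => 2 * |β| + ‖(u N t).toV + (u M t).toV‖ ^ 2 / (4 * ν) :=
    continuous_const.add
      ((((hu N).continuous_toV.add (hu M).continuous_toV).norm.pow 2).div_const _)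
  have hch : Continuous fun t => ε N *
      (1 + B + ‖(u N t).D.toH‖ ^ 2 + ‖(u M t).D.toH‖ ^ 2) :=
    continuous_const.mul (hc1.add hcDv)
  have hg := gronwall ht.1 (y := fun t => ‖(u N t - u M t).toH‖ ^ 2) (y' := fun t =>
      (2 * (rhs ν β γ f (u N t).toH (u N t - u M t) - rhs ν β γ f (u M t).toH (u N t - u M t)) +
        2 * rhs ν β γ f (u N t).toH (proj (freq M \ freq N) (u M t).toH)))
    (a := fun t => 2 * |β| + ‖(u N t).toV + (u M t).toV‖ ^ 2 / (4 * ν))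
    (z := fun t => ν * ‖(u N t - u M t).D.toH‖ ^ 2)
    (h := fun t => ε N * (1 + B + ‖(u N t).D.toH‖ ^ 2 + ‖(u M t).D.toH‖ ^ 2))
    hca (hcDw.const_mul ν) hch (fun s => by positivity) (fun s => by positivity)
    (fun s => mul_nonneg (hε0 N) (by positivity))
    hcw.continuousOn (fun s hs => (hu N).hasDerivAt_energy_sub hNM (hu M) hs.1.le) (fun s hs => by
      have hs' : s ∈ Set.Icc 0 T := ⟨hs.1.le, hs.2.le.trans ht.2⟩
      have h1 := (hu N).rhs_tail_le (M := M) hηf hη0 (hsup N s hs') (hsup M s hs')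
      have h2 := rhs_sub_le (β := β) (γ := γ) (f := f) hν (A := freq M) neg_mem_freq
        (u N s).toH (u M s).toH ((u N s).toV + (u M s).toV) rfl
      have hw : proj (freq M) ((u N s).toH - (u M s).toH) = u N s - u M s := by
        rw [map_sub, (hu N).proj_of_le hNM, (hu M).spectrum]
      rw [hw, ← map_sub] at h2
      linarith)
  rw [intervalIntegral.integral_const_mul] at hg
  refine hg.trans ?_
  have hi : ∀ {g : ℝ → ℝ}, Continuous g → IntervalIntegrable g volume 0 t :=
    fun hg => hg.intervalIntegrable _ _
  have hA : ∫ s in (0 : ℝ)..t, (2 * |β| + ‖(u N s).toV + (u M s).toV‖ ^ 2 / (4 * ν)) ≤ Ca := by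
    have h1 : ∫ s in (0 : ℝ)..t, (2 * |β| + ‖(u N s).toV + (u M s).toV‖ ^ 2 / (4 * ν)) ≤
        ∫ s in (0 : ℝ)..t, ((2 * |β| + 1 / (2 * ν) * (2 * B)) +
          1 / (2 * ν) * (‖(u N s).D.toH‖ ^ 2 + ‖(u M s).D.toH‖ ^ 2)) := by
      refine intervalIntegral.integral_mono_on ht.1 (hi hca)
        (hi (continuous_const.add hc2)) fun s hs => ?_
      have hs' : s ∈ Set.Icc 0 T := ⟨hs.1, hs.2.trans ht.2⟩
      have h2 : ‖(u N s).toV + (u M s).toV‖ ^ 2 ≤ 2 * (‖(u N s).toV‖ ^ 2 + ‖(u M s).toV‖ ^ 2) := by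
        have h3 := norm_add_le (u N s).toV (u M s).toV
        have h4 := pow_le_pow_left₀ (norm_nonneg _) h3 2
        nlinarith [sq_nonneg (‖(u N s).toV‖ - ‖(u M s).toV‖)]
      rw [SmoothH.norm_toV_sq, SmoothH.norm_toV_sq] at h2
      have h5 := hsup N s hs'
      have h6 := hsup M s hs'
      have h7 : ‖(u N s).toV + (u M s).toV‖ ^ 2 / (4 * ν) ≤
          1 / (2 * ν) * (2 * B + (‖(u N s).D.toH‖ ^ 2 + ‖(u M s).D.toH‖ ^ 2)) := by
        rw [div_le_iff₀ (by positivity)]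
        have : 1 / (2 * ν) * (2 * B + (‖(u N s).D.toH‖ ^ 2 + ‖(u M s).D.toH‖ ^ 2)) * (4 * ν) =
            2 * (2 * B + (‖(u N s).D.toH‖ ^ 2 + ‖(u M s).D.toH‖ ^ 2)) := by
          field_simp
          ring
        rw [this]
        linarith
      linarith
    refine h1.trans ?_
    rw [intervalIntegral.integral_add (hi continuous_const)
      (hi hc2), intervalIntegral.integral_const_mul,
      intervalIntegral.integral_add (hi hcDu) (hi hcDv), intervalIntegral.integral_const,
      smul_eq_mul, sub_zero]
    have h8 := hdiss N t ht
    have h9 := hdiss M t ht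
    have h10 : t * (2 * |β| + 1 / (2 * ν) * (2 * B)) ≤ T * (2 * |β| + 1 / (2 * ν) * (2 * B)) :=
      mul_le_mul_of_nonneg_right ht.2 (by positivity)
    have h11 : 1 / (2 * ν) * ((∫ s in (0 : ℝ)..t, ‖(u N s).D.toH‖ ^ 2) +
        ∫ s in (0 : ℝ)..t, ‖(u M s).D.toH‖ ^ 2) ≤ 1 / (2 * ν) * (B / ν + B / ν) := by gcongr
    rw [hCa]
    linarith
  have hH : ∫ s in (0 : ℝ)..t, ε N * (1 + B + ‖(u N s).D.toH‖ ^ 2 + ‖(u M s).D.toH‖ ^ 2) ≤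
      ε N * Ch := by
    rw [intervalIntegral.integral_const_mul]
    refine mul_le_mul_of_nonneg_left ?_ (hε0 N)
    rw [intervalIntegral.integral_add (hi hc1) (hi hcDv),
      intervalIntegral.integral_add (hi continuous_const) (hi hcDu),
      intervalIntegral.integral_const, smul_eq_mul, sub_zero]
    have h8 := hdiss N t ht
    have h9 := hdiss M t ht
    have h10 : t * (1 + B) ≤ T * (1 + B) := mul_le_mul_of_nonneg_right ht.2 (by positivity)
    rw [hCh]
    linarith
  have h0 : ‖(u N 0 - u M 0).toH‖ ≤ ‖(proj (freq N) u₀).toH - u₀‖ := by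
    have h1 : u N 0 - u M 0 = proj (freq M) ((proj (freq N) u₀).toH - u₀) := by
      rw [hu0, hu0, map_sub, proj_proj, Finset.inter_eq_right.2 (freq_subset hNM)]
    rw [h1]
    exact norm_proj_le _ _
  have hsum0 : 0 ≤ ∫ s in (0 : ℝ)..t, ε N *
      (1 + B + ‖(u N s).D.toH‖ ^ 2 + ‖(u M s).D.toH‖ ^ 2) :=
    intervalIntegral.integral_nonneg ht.1 fun s _ => mul_nonneg (hε0 N) (by positivity)
  have h0sq : ‖(u N 0 - u M 0).toH‖ ^ 2 ≤ ‖(proj (freq N) u₀).toH - u₀‖ ^ 2 := by gcongr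
  have hexp := Real.exp_le_exp.2 hA
  exact mul_le_mul hexp (add_le_add h0sq hH) (add_nonneg (sq_nonneg _) hsum0) (Real.exp_pos _).le

end

section

/-! ### Uniqueness -/

/-- A homogeneous integral inequality with an integrable rate has only the zero solution: on a short
interval, on which the integral of the rate is at most `1/2`, the maximum is at most half of
itself. -/
theorem eq_zero_of_le_integral {y a : ℝ → ℝ} {T : ℝ} (hy : ContinuousOn y (Set.Icc 0 T))
    (hy0 : ∀ t ∈ Set.Icc 0 T, 0 ≤ y t) (ha : IntervalIntegrable a volume 0 T) (ha0 : ∀ t, 0 ≤ a t)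
    (hle : ∀ t ∈ Set.Icc 0 T, y t ≤ ∫ s in (0 : ℝ)..t, a s * y s) :
    ∀ t ∈ Set.Icc 0 T, y t = 0 := by
  intro t₀ ht₀
  have hT : 0 ≤ T := ht₀.1.trans ht₀.2
  have hac : ContinuousOn (fun t => ∫ s in (0 : ℝ)..t, a s) (Set.Icc 0 T) := by
    have := intervalIntegral.continuousOn_primitive_interval (a := 0) (b := T) (f := a)
      (μ := volume) (by rw [Set.uIcc_of_le hT]; exact
        (intervalIntegrable_iff_integrableOn_Icc_of_le hT).1 ha)
    rwa [Set.uIcc_of_le hT] at this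
  have huc := isCompact_Icc.uniformContinuousOn_of_continuous hac
  obtain ⟨δ, hδ, hδa⟩ := Metric.uniformContinuousOn_iff.1 huc (1 / 2) (by norm_num)
  have hsub : ∀ {s t : ℝ}, 0 ≤ s → s ≤ t → t ≤ T → IntervalIntegrable a volume s t := by
    intro s t hs hst htT
    refine ha.mono_set ?_
    rw [Set.uIcc_of_le hst, Set.uIcc_of_le hT]
    exact Set.Icc_subset_Icc hs htT
  have hsuby : ∀ {s t : ℝ}, 0 ≤ s → s ≤ t → t ≤ T →
      IntervalIntegrable (fun s => a s * y s) volume s t := by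
    intro s t hs hst htT
    refine (hsub hs hst htT).mul_continuousOn (hy.mono ?_)
    rw [Set.uIcc_of_le hst]
    exact Set.Icc_subset_Icc hs htT
  have step : ∀ n : ℕ, ∀ t ∈ Set.Icc 0 T, t ≤ n * (δ / 2) → y t = 0 := by
    intro n
    induction n with
    | zero =>
      intro t ht htn
      have : t = 0 := le_antisymm (by simpa using htn) ht.1
      subst this
      have := hle 0 ht
      rw [intervalIntegral.integral_same] at this
      exact le_antisymm this (hy0 0 ht)
    | succ n ih =>
      intro t ht htn
      by_cases hlt : t ≤ n * (δ / 2)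
      · exact ih t ht hlt
      rw [not_le] at hlt
      set s : ℝ := n * (δ / 2) with hs
      have hs0 : 0 ≤ s := by positivity
      have hst : Set.Icc s t ⊆ Set.Icc 0 T := Set.Icc_subset_Icc hs0 ht.2
      obtain ⟨m, hm, hmax⟩ := isCompact_Icc.exists_isMaxOn (Set.nonempty_Icc.2 hlt.le)
        (hy.mono hst)
      have hmT := hst hm
      have h1 := hle m hmT
      rw [← intervalIntegral.integral_add_adjacent_intervals
        (hsuby le_rfl hs0 (hm.1.trans hmT.2)) (hsuby hs0 hm.1 hmT.2)] at h1
      have h2 : ∫ r in (0 : ℝ)..s, a r * y r = 0 := by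
        rw [intervalIntegral.integral_congr (g := fun _ => 0), intervalIntegral.integral_zero]
        intro r hr
        rw [Set.uIcc_of_le hs0] at hr
        simp only [ih r ⟨hr.1, hr.2.trans (hm.1.trans hmT.2)⟩ hr.2, mul_zero]
      have h3 : ∫ r in s..m, a r * y r ≤ ∫ r in s..m, a r * y m := by
        refine intervalIntegral.integral_mono_on hm.1 (hsuby hs0 hm.1 hmT.2)
          ((hsub hs0 hm.1 hmT.2).mul_const _) fun r hr => ?_
        exact mul_le_mul_of_nonneg_left (hmax ⟨hr.1, hr.2.trans hm.2⟩) (ha0 r)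
      rw [intervalIntegral.integral_mul_const] at h3
      have h4 : ∫ r in s..m, a r ≤ 1 / 2 := by
        have h5 := hδa m hmT s ⟨hs0, hm.1.trans hmT.2⟩ (by
          rw [Real.dist_eq, abs_of_nonneg (by linarith [hm.1])]
          push_cast at htn
          have := hm.2
          have h6 : ((n : ℝ) + 1) * (δ / 2) = s + δ / 2 := by rw [hs]; ring
          linarith)
        rw [Real.dist_eq, intervalIntegral.integral_interval_sub_left
          (hsub le_rfl hmT.1 hmT.2) (hsub le_rfl hs0 (hm.1.trans hmT.2))] at h5
        exact ((le_abs_self _).trans_lt h5).le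
      have hym : y m ≤ 0 := by
        have h7 := mul_le_mul_of_nonneg_right h4 (hy0 m hmT)
        linarith
      exact le_antisymm ((hmax ⟨hlt.le, le_rfl⟩).trans hym) (hy0 t ht)
  obtain ⟨n, hn⟩ := exists_nat_ge (t₀ / (δ / 2))
  refine step n t₀ ht₀ ?_
  rwa [div_le_iff₀ (by positivity)] at hn

variable {L : ℝ} [Fact (0 < L)] {ν β γ : ℝ} {f : StrongDual ℝ (V L)}

/-- Two solutions with the same initial value satisfy a homogeneous integral inequality for the
square of the norm of their difference. It is obtained for the Fourier truncations, which avoids the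
question whether a solution may be used as a test function. -/
theorem norm_sub_sq_le_integral (hν : 0 < ν) {u₀ : H L} {u₁ u₂ : ℝ → H L} {p : ℝ → V L}
    (h₁ : IsSolution ν β γ f u₀ u₁) (h₂ : IsSolution ν β γ f u₀ u₂) {T : ℝ}
    (hp : ∀ᵐ s ∂volume.restrict (Set.Ioi (0 : ℝ)), V.fn (p s) = u₁ s + u₂ s)
    (ha : IntervalIntegrable (fun s => (2 * |β| + ‖p s‖ ^ 2 / (4 * ν)) * ‖u₁ s - u₂ s‖ ^ 2)
      volume 0 T) {t : ℝ} (ht : t ∈ Set.Icc 0 T) :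
    ‖u₁ t - u₂ t‖ ^ 2 ≤
      ∫ s in (0 : ℝ)..t, (2 * |β| + ‖p s‖ ^ 2 / (4 * ν)) * ‖u₁ s - u₂ s‖ ^ 2 := by
  have hext : ∀ {u : ℝ → H L}, IsSolution ν β γ f u₀ u → Continuous fun s => u (max s 0) := by
    intro u hu
    exact hu.continuousOn.comp_continuous (by fun_prop) fun s => le_max_right s 0
  have hc₁ := hext h₁
  have hc₂ := hext h₂
  set r : ℤ → ℝ → ℝ := fun k s =>
    rhs ν β γ f (u₁ (max s 0)) (e k) - rhs ν β γ f (u₂ (max s 0)) (e k) with hr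
  have hrc : ∀ k, Continuous (r k) := fun k =>
    ((continuous_rhs (e k)).comp hc₁).sub ((continuous_rhs (e k)).comp hc₂)
  have hcoef : ∀ k, ∀ s, 0 ≤ s → inner ℝ (u₁ s - u₂ s) (e k : SmoothH L).toH =
      ∫ τ in (0 : ℝ)..s, r k τ := by
    intro k s hs
    have hw : ∀ {u : ℝ → H L}, IsSolution ν β γ f u₀ u → inner ℝ (u s) (e k : SmoothH L).toH =
        inner ℝ u₀ (e k : SmoothH L).toH + ∫ τ in (0 : ℝ)..s, rhs ν β γ f (u (max τ 0)) (e k) := by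
      intro u hu
      have h := hu.weak (e k : SmoothH L).test s hs
      rw [SmoothH.inner_toH_right, SmoothH.inner_toH_right]
      refine h.trans ?_
      congr 1
      refine intervalIntegral.integral_congr fun τ hτ => ?_
      rw [Set.uIcc_of_le hs] at hτ
      simp only [max_eq_left hτ.1, weakRHS_test]
    rw [inner_sub_left, hw h₁, hw h₂, hr, intervalIntegral.integral_sub]
    · ring
    · exact ((continuous_rhs (e k)).comp hc₁).intervalIntegrable _ _
    · exact ((continuous_rhs (e k)).comp hc₂).intervalIntegrable _ _
  have htrunc : ∀ N : ℕ, ‖(proj (freq N) (u₁ t - u₂ t)).toH‖ ^ 2 ≤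
      ∫ s in (0 : ℝ)..t, (2 * |β| + ‖p s‖ ^ 2 / (4 * ν)) * ‖u₁ s - u₂ s‖ ^ 2 := by
    intro N
    set c : ℤ → ℝ → ℝ := fun k s => ∫ τ in (0 : ℝ)..s, r k τ with hcdef
    have hcd : ∀ k s, HasDerivAt (c k) (r k s) s := fun k s =>
      intervalIntegral.integral_hasDerivAt_right ((hrc k).intervalIntegrable _ _)
        ((hrc k).stronglyMeasurableAtFilter _ _) (hrc k).continuousAt
    have hcc : ∀ k, Continuous (c k) := fun k =>
      continuous_iff_continuousAt.2 fun s => (hcd k s).continuousAt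
    have hd : ∀ s, HasDerivAt (fun s => ∑ k ∈ freq N, c k s ^ 2)
        (∑ k ∈ freq N, 2 * (c k s * r k s)) s := fun s =>
      HasDerivAt.fun_sum fun k _ => ((hcd k s).pow 2).congr_deriv (by ring)
    have hdc : Continuous fun s => ∑ k ∈ freq N, 2 * (c k s * r k s) :=
      continuous_finsetSum _ fun k _ => continuous_const.mul ((hcc k).mul (hrc k))
    have hftc := intervalIntegral.integral_eq_sub_of_hasDerivAt (a := 0) (b := t)
      (fun s _ => hd s) (hdc.intervalIntegrable _ _)
    have hc0 : ∑ k ∈ freq N, c k 0 ^ 2 = 0 :=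
      Finset.sum_eq_zero fun k _ => by simp [hcdef]
    have hct : ‖(proj (freq N) (u₁ t - u₂ t)).toH‖ ^ 2 = ∑ k ∈ freq N, c k t ^ 2 := by
      rw [norm_proj_sq]
      exact Finset.sum_congr rfl fun k _ => by rw [hcoef k t ht.1]
    rw [hc0, sub_zero] at hftc
    rw [hct, ← hftc]
    have hat : IntervalIntegrable (fun s => (2 * |β| + ‖p s‖ ^ 2 / (4 * ν)) * ‖u₁ s - u₂ s‖ ^ 2)
        volume 0 t := by
      refine ha.mono_set ?_
      rw [Set.uIcc_of_le ht.1, Set.uIcc_of_le (ht.1.trans ht.2)]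
      exact Set.Icc_subset_Icc le_rfl ht.2
    refine intervalIntegral.integral_mono_ae_restrict ht.1 (hdc.intervalIntegrable _ _) hat ?_
    have hp' : ∀ᵐ s ∂volume.restrict (Set.Icc (0 : ℝ) t), V.fn (p s) = u₁ s + u₂ s := by
      rw [← restrict_Ioc_eq_restrict_Icc]
      exact ae_restrict_of_ae_restrict_of_subset Set.Ioc_subset_Ioi_self hp
    filter_upwards [hp', ae_restrict_mem measurableSet_Icc] with s hs hs'
    have h := rhs_sub_le (β := β) (γ := γ) (f := f) hν (A := freq N) neg_mem_freq (u₁ s) (u₂ s)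
      (p s) hs
    have h0 : 0 ≤ ν * ‖(proj (freq N) (u₁ s - u₂ s)).D.toH‖ ^ 2 := by positivity
    have heq : ∑ k ∈ freq N, 2 * (c k s * r k s) =
        2 * (rhs ν β γ f (u₁ s) (proj (freq N) (u₁ s - u₂ s)) -
          rhs ν β γ f (u₂ s) (proj (freq N) (u₁ s - u₂ s))) := by
      rw [← sum_inner_mul_rhs, ← sum_inner_mul_rhs, ← Finset.mul_sum, ← Finset.sum_sub_distrib]
      congr 1
      refine Finset.sum_congr rfl fun k _ => ?_
      rw [hcoef k s hs'.1, hr]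
      simp only [max_eq_left hs'.1]
      ring
    rw [heq]
    linarith
  have hlim := (tendsto_proj (u₁ t - u₂ t)).norm.pow 2
  exact le_of_tendsto hlim (Filter.Eventually.of_forall htrunc)

theorem solution_unique (hν : 0 < ν) {u₀ : H L} {u₁ u₂ : ℝ → H L}
    (h₁ : IsSolution ν β γ f u₀ u₁) (h₂ : IsSolution ν β γ f u₀ u₂) {t : ℝ} (ht : 0 ≤ t) :
    u₁ t = u₂ t := by
  obtain ⟨v₁, hv₁, hm₁⟩ := h₁.memL2V
  obtain ⟨v₂, hv₂, hm₂⟩ := h₂.memL2V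
  set T := t + 1 with hT
  have hTpos : 0 < T := by linarith
  have hp : ∀ᵐ s ∂volume.restrict (Set.Ioi (0 : ℝ)), V.fn (v₁ s + v₂ s) = u₁ s + u₂ s := by
    filter_upwards [hv₁, hv₂] with s h1 h2
    refine Subtype.ext ?_
    change ((v₁ s : V L) : WithLp 2 (L2 L × L2 L)).fst +
      ((v₂ s : V L) : WithLp 2 (L2 L × L2 L)).fst = u₁ s + u₂ s
    rw [h1, h2]
  have ha : IntervalIntegrable (fun s => 2 * |β| + ‖v₁ s + v₂ s‖ ^ 2 / (4 * ν)) volume 0 T := by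
    have h := ((hm₁ T hTpos).add (hm₂ T hTpos)).norm.integrable_sq
    have h' : IntervalIntegrable (fun s => ‖v₁ s + v₂ s‖ ^ 2) volume 0 T :=
      (intervalIntegrable_iff_integrableOn_Ioc_of_le hTpos.le).2 h
    exact intervalIntegrable_const.add (h'.div_const _)
  have hc : ContinuousOn (fun s => ‖u₁ s - u₂ s‖ ^ 2) (Set.Icc 0 T) :=
    ((h₁.continuousOn.sub h₂.continuousOn).norm.pow 2).mono Set.Icc_subset_Ici_self
  have haw : IntervalIntegrable
      (fun s => (2 * |β| + ‖v₁ s + v₂ s‖ ^ 2 / (4 * ν)) * ‖u₁ s - u₂ s‖ ^ 2) volume 0 T :=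
    ha.mul_continuousOn (by rwa [Set.uIcc_of_le hTpos.le])
  have h := eq_zero_of_le_integral hc (fun s _ => sq_nonneg _) ha (fun s => by positivity)
    (fun s hs => norm_sub_sq_le_integral hν h₁ h₂ (p := fun s => v₁ s + v₂ s) hp haw hs) t
    ⟨ht, by linarith⟩
  exact sub_eq_zero.1 (norm_eq_zero.1 (pow_eq_zero_iff two_ne_zero |>.1 h))

end

section

variable {L : ℝ} [Fact (0 < L)] {ν β γ : ℝ} {f : StrongDual ℝ (V L)}

/-! ### Existence -/

/-- A bound for the right-hand side as a functional of the test function. -/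
def rhsBound (ν β γ : ℝ) (f : StrongDual ℝ (V L)) (φ : SmoothH L) : ℝ :=
  |ν| * ‖φ.D.D.toH‖ + ‖φ.D.toV‖ + |β| * ‖φ.toH‖ + |γ| * ‖φ.D.D.D.toH‖ + ‖f‖ * ‖φ.toV‖

theorem rhsBound_nonneg (φ : SmoothH L) : 0 ≤ rhsBound ν β γ f φ := by
  unfold rhsBound
  positivity

theorem abs_rhs_le (w : H L) (φ : SmoothH L) :
    |rhs ν β γ f w φ| ≤ rhsBound ν β γ f φ * (1 + ‖w‖) ^ 2 := by
  have h1 : ∀ ψ : SmoothH L, |inner ℝ w ψ.toH| ≤ ‖ψ.toH‖ * (1 + ‖w‖) ^ 2 := by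
    intro ψ
    have := abs_real_inner_le_norm w ψ.toH
    have h2 : ‖w‖ ≤ (1 + ‖w‖) ^ 2 := by nlinarith [norm_nonneg w]
    have := mul_le_mul_of_nonneg_right h2 (norm_nonneg ψ.toH)
    linarith
  have h2 : |tri φ.D w w| ≤ ‖φ.D.toV‖ * (1 + ‖w‖) ^ 2 := by
    have h3 := abs_tri_le φ.D w w
    have h4 : ‖w‖ * ‖w‖ ≤ (1 + ‖w‖) ^ 2 := by nlinarith [norm_nonneg w]
    have := mul_le_mul_of_nonneg_left h4 (norm_nonneg φ.D.toV)
    linarith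
  have h3 : |f φ.toV| ≤ ‖f‖ * ‖φ.toV‖ * (1 + ‖w‖) ^ 2 := by
    have h4 : |f φ.toV| ≤ ‖f‖ * ‖φ.toV‖ := f.le_opNorm φ.toV
    have h5 : 1 ≤ (1 + ‖w‖) ^ 2 := by nlinarith [norm_nonneg w]
    exact h4.trans (le_mul_of_one_le_right (by positivity) h5)
  have hν := mul_le_mul_of_nonneg_left (h1 φ.D.D) (abs_nonneg ν)
  have hβ := mul_le_mul_of_nonneg_left (h1 φ) (abs_nonneg β)
  have hγ := mul_le_mul_of_nonneg_left (h1 φ.D.D.D) (abs_nonneg γ)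
  have h6 : 1 / 2 * |tri φ.D w w| ≤ ‖φ.D.toV‖ * (1 + ‖w‖) ^ 2 := by
    linarith [abs_nonneg (tri φ.D w w)]
  rw [← abs_mul] at hν hβ hγ
  have h7 : |(1 / 2 : ℝ) * tri φ.D w w| = 1 / 2 * |tri φ.D w w| := by
    rw [abs_mul, abs_of_pos (by norm_num : (0 : ℝ) < 1 / 2)]
  rw [rhs_apply]
  refine (abs_add_le _ _).trans ?_
  refine (add_le_add_left ((abs_add_le _ _).trans (add_le_add_left ((abs_add_le _ _).trans
    (add_le_add_left (abs_add_le _ _) _)) _)) _).trans ?_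
  rw [h7, rhsBound]
  linarith

theorem tendsto_rhsBound_proj (φ : SmoothH L) :
    Filter.Tendsto (fun N : ℕ => rhsBound ν β γ f (proj (freq N) φ.toH - φ)) Filter.atTop
      (nhds 0) := by
  have h : ∀ ψ : SmoothH L, Filter.Tendsto
      (fun N : ℕ => ‖(proj (freq N) ψ.toH - ψ).toH‖) Filter.atTop (nhds 0) := by
    intro ψ
    simp only [map_sub]
    exact tendsto_iff_norm_sub_tendsto_zero.1 (tendsto_proj ψ.toH)
  have hV : ∀ ψ : SmoothH L, Filter.Tendsto
      (fun N : ℕ => ‖(proj (freq N) ψ.toH - ψ).toV‖) Filter.atTop (nhds 0) := by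
    intro ψ
    simp only [map_sub]
    exact tendsto_iff_norm_sub_tendsto_zero.1 ψ.tendsto_toV_proj
  have hD : ∀ (ψ : SmoothH L) (N : ℕ), (proj (freq N) ψ.toH - ψ).D =
      proj (freq N) ψ.D.toH - ψ.D := fun ψ N => by rw [map_sub, D_proj neg_mem_freq]
  unfold rhsBound
  simp only [hD]
  simpa using (((((h φ.D.D).const_mul |ν|).add (hV φ.D)).add ((h φ).const_mul |β|)).add
    ((h φ.D.D.D).const_mul |γ|)).add ((hV φ).const_mul ‖f‖)

theorem tendsto_rhs_proj {x : ℕ → H L} {y : H L} (hx : Filter.Tendsto x Filter.atTop (nhds y))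
    (φ : SmoothH L) : Filter.Tendsto (fun N => rhs ν β γ f (x N) (proj (freq N) φ.toH))
      Filter.atTop (nhds (rhs ν β γ f y φ)) := by
  have h1 : Filter.Tendsto (fun N => rhs ν β γ f (x N) φ) Filter.atTop
      (nhds (rhs ν β γ f y φ)) := ((continuous_rhs φ).tendsto y).comp hx
  have h2 : Filter.Tendsto (fun N => rhs ν β γ f (x N) (proj (freq N) φ.toH - φ)) Filter.atTop
      (nhds 0) := by
    refine squeeze_zero_norm (fun N => abs_rhs_le (x N) (proj (freq N) φ.toH - φ)) ?_
    have h3 := (tendsto_rhsBound_proj (ν := ν) (β := β) (γ := γ) (f := f) φ).mul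
      ((hx.norm.const_add 1).pow 2)
    simpa using h3
  have h4 := h1.add h2
  simpa using h4

namespace IsGalerkin

variable {N : ℕ} {u : ℝ → SmoothH L}

theorem hasDerivAt_inner (hu : IsGalerkin ν β γ f N u) {ψ : SmoothH L}
    (hψ : proj (freq N) ψ.toH = ψ) {t : ℝ} (ht : 0 ≤ t) :
    HasDerivAt (fun t => inner ℝ (u t).toH ψ.toH) (rhs ν β γ f (u t).toH ψ) t := by
  have h1 : ∀ w : H L, inner ℝ w ψ.toH = ∑ k ∈ freq N,
      (inner ℝ ψ.toH (e k : SmoothH L).toH : ℝ) * inner ℝ w (e k : SmoothH L).toH := by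
    intro w
    conv_lhs => rw [← hψ]
    rw [real_inner_comm, inner_proj_left]
  simp only [h1]
  have h2 : rhs ν β γ f (u t).toH ψ = ∑ k ∈ freq N,
      (inner ℝ ψ.toH (e k : SmoothH L).toH : ℝ) * rhs ν β γ f (u t).toH (e k) := by
    rw [sum_inner_mul_rhs, hψ]
  rw [h2]
  exact HasDerivAt.fun_sum fun k hk => (hu.hasDerivAt_coeff t ht k hk).const_mul _

theorem inner_eq_integral (hu : IsGalerkin ν β γ f N u) {ψ : SmoothH L}
    (hψ : proj (freq N) ψ.toH = ψ) {t : ℝ} (ht : 0 ≤ t) :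
    inner ℝ (u t).toH ψ.toH =
      inner ℝ (u 0).toH ψ.toH + ∫ s in (0 : ℝ)..t, rhs ν β γ f (u s).toH ψ := by
  rw [intervalIntegral.integral_eq_sub_of_hasDerivAt (fun s hs => hu.hasDerivAt_inner hψ (by
    rw [Set.uIcc_of_le ht] at hs
    exact hs.1)) (((continuous_rhs ψ).comp hu.continuous_toH).intervalIntegrable _ _)]
  ring

end IsGalerkin

/-- A sequence of continuous paths in a Hilbert space that is Cauchy in mean square has a square
integrable limit, which is identified by any pointwise limit of a continuous image. -/
theorem exists_memLp_limit {E G : Type*} [NormedAddCommGroup E] [InnerProductSpace ℝ E]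
    [CompleteSpace E] [TopologicalSpace G] [T2Space G] {π : E → G} (hπ : Continuous π)
    {T : ℝ} (hT : 0 < T) {v : ℕ → ℝ → E} {w : ℝ → G}
    (hv : ∀ N, Continuous (v N)) {κ : ℕ → ℝ} (hκ : Filter.Tendsto κ Filter.atTop (nhds 0))
    (hcau : ∀ N M, N ≤ M → ∫ s in (0 : ℝ)..T, ‖v N s - v M s‖ ^ 2 ≤ κ N)
    (hw : ∀ t ∈ Set.Ioc 0 T, Filter.Tendsto (fun N => π (v N t)) Filter.atTop (nhds (w t))) :
    ∃ F : ℝ → E, MemLp F 2 (volume.restrict (Set.Ioc 0 T)) ∧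
      ∀ᵐ t ∂volume.restrict (Set.Ioc 0 T), π (F t) = w t := by
  have hmem : ∀ N, MemLp (v N) 2 (volume.restrict (Set.Ioc 0 T)) := by
    intro N
    obtain ⟨C, hC⟩ := isCompact_Icc.exists_bound_of_continuousOn
      ((hv N).continuousOn (s := Set.Icc 0 T))
    refine MemLp.of_bound (hv N).aestronglyMeasurable C ?_
    filter_upwards [ae_restrict_mem measurableSet_Ioc] with t ht
    exact hC t (Set.Ioc_subset_Icc_self ht)
  set F : ℕ → Lp E 2 (volume.restrict (Set.Ioc 0 T)) := fun N => (hmem N).toLp with hF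
  have hdist : ∀ N M, N ≤ M → ‖F N - F M‖ ^ 2 ≤ κ N := by
    intro N M hNM
    refine le_trans (le_of_eq ?_) (hcau N M hNM)
    rw [← real_inner_self_eq_norm_sq (F N - F M), L2.inner_def,
      intervalIntegral.integral_of_le hT.le]
    refine integral_congr_ae ?_
    filter_upwards [Lp.coeFn_sub (F N) (F M), (hmem N).coeFn_toLp, (hmem M).coeFn_toLp]
      with t h1 h2 h3
    rw [h1, Pi.sub_apply, hF, h2, h3, real_inner_self_eq_norm_sq]
  have hFc : CauchySeq F := by
    rw [Metric.cauchySeq_iff']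
    intro ε hε
    obtain ⟨N, hN⟩ := ((hκ.eventually (gt_mem_nhds (by positivity : 0 < ε ^ 2)))).exists
    refine ⟨N, fun M hM => ?_⟩
    rw [dist_comm, dist_eq_norm]
    exact lt_of_pow_lt_pow_left₀ 2 hε.le ((hdist N M hM).trans_lt hN)
  obtain ⟨G, hG⟩ := cauchySeq_tendsto_of_complete hFc
  obtain ⟨n, hnm, hn⟩ := (tendstoInMeasure_of_tendsto_Lp hG).exists_seq_tendsto_ae
  refine ⟨G, Lp.memLp G, ?_⟩
  have hall : ∀ᵐ t ∂volume.restrict (Set.Ioc 0 T), ∀ N, F N t = v N t :=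
    ae_all_iff.2 fun N => (hmem N).coeFn_toLp
  filter_upwards [hn, hall, ae_restrict_mem measurableSet_Ioc] with t h1 h2 h3
  simp only [h2] at h1
  exact tendsto_nhds_unique ((hπ.tendsto _).comp h1) ((hw t h3).comp hnm.tendsto_atTop)

theorem V.continuous_fn : Continuous (V.fn : V L → H L) :=
  (continuous_fst.comp continuous_subtype_val).subtype_mk _

/-- The Galerkin approximations converge to a solution. -/
theorem exists_solution_of_galerkin (hν : 0 < ν) {u₀ : H L} {u : ℕ → ℝ → SmoothH L}
    (hu : ∀ N, IsGalerkin ν β γ f N (u N)) (hu0 : ∀ N, u N 0 = proj (freq N) u₀) :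
    ∃ w : ℝ → H L, IsSolution ν β γ f u₀ w ∧
      ∀ t, 0 ≤ t → Filter.Tendsto (fun N => (u N t).toH) Filter.atTop (nhds (w t)) := by
  have hκ := fun {T : ℝ} (hT : 0 ≤ T) => galerkin_cauchy hν hu hu0 hT
  -- the dissipation integrals in the Cauchy estimate are nonnegative
  have hdiss0 : ∀ N M, ∀ t, 0 ≤ t → 0 ≤ ν * ∫ s in (0 : ℝ)..t, ‖(u N s - u M s).D.toH‖ ^ 2 :=
    fun N M t ht => mul_nonneg hν.le
      (intervalIntegral.integral_nonneg ht fun s _ => sq_nonneg _)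
  have hex : ∀ t, ∃ x : H L, 0 ≤ t →
      Filter.Tendsto (fun N => (u N t).toH) Filter.atTop (nhds x) := by
    intro t
    by_cases ht : 0 ≤ t
    · obtain ⟨κ, hκ0, hκ1⟩ := hκ ht
      have hc : CauchySeq fun N => (u N t).toH := by
        rw [Metric.cauchySeq_iff']
        intro ε hε
        obtain ⟨N, hN⟩ := (hκ0.eventually (gt_mem_nhds (by positivity : 0 < ε ^ 2))).exists
        refine ⟨N, fun M hM => ?_⟩
        rw [dist_comm, dist_eq_norm, ← map_sub]
        have h1 := hκ1 N M hM t ⟨ht, le_rfl⟩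
        have h2 := hdiss0 N M t ht
        exact lt_of_pow_lt_pow_left₀ 2 hε.le (by linarith)
      obtain ⟨x, hx⟩ := cauchySeq_tendsto_of_complete hc
      exact ⟨x, fun _ => hx⟩
    · exact ⟨0, fun h => absurd h ht⟩
  choose w hw using hex
  have hunif : ∀ {T : ℝ}, 0 ≤ T →
      TendstoUniformlyOn (fun N t => (u N t).toH) w Filter.atTop (Set.Icc 0 T) := by
    intro T hT
    obtain ⟨κ, hκ0, hκ1⟩ := hκ hT
    rw [Metric.tendstoUniformlyOn_iff]
    intro ε hε
    filter_upwards [hκ0.eventually (gt_mem_nhds (by positivity : 0 < ε ^ 2))] with N hN t ht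
    have hlim : Filter.Tendsto (fun M => ‖(u N t).toH - (u M t).toH‖ ^ 2) Filter.atTop
        (nhds (‖(u N t).toH - w t‖ ^ 2)) := ((hw t ht.1).const_sub _).norm.pow 2
    have hle : ‖(u N t).toH - w t‖ ^ 2 ≤ κ N := by
      refine le_of_tendsto hlim ?_
      filter_upwards [Filter.eventually_ge_atTop N] with M hM
      rw [← map_sub]
      have h1 := hκ1 N M hM t ht
      have h2 := hdiss0 N M t ht.1
      linarith
    rw [dist_comm, dist_eq_norm]
    exact lt_of_pow_lt_pow_left₀ 2 hε.le (hle.trans_lt hN)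
  have hcont : ContinuousOn w (Set.Ici 0) := by
    intro t ht
    have h1 : ContinuousOn w (Set.Icc 0 (t + 1)) :=
      (hunif (add_nonneg ht zero_le_one)).continuousOn (Filter.Frequently.of_forall fun N =>
        (hu N).continuous_toH.continuousOn)
    refine (h1 t ⟨ht, by linarith⟩).mono_of_mem_nhdsWithin ?_
    exact Filter.mem_of_superset (inter_mem_nhdsWithin _ (Iio_mem_nhds (lt_add_one t)))
      fun s hs => ⟨hs.1, hs.2.le⟩
  have hw0 : w 0 = u₀ := by
    refine tendsto_nhds_unique (hw 0 le_rfl) ?_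
    simp only [hu0]
    exact tendsto_proj u₀
  refine ⟨w, ⟨hw0, hcont, ?_, ?_⟩, hw⟩
  · classical
    have hF : ∀ T : ℝ, 0 < T → ∃ F : ℝ → V L, MemLp F 2 (volume.restrict (Set.Ioc 0 T)) ∧
        ∀ᵐ t ∂volume.restrict (Set.Ioc 0 T), V.fn (F t) = w t := by
      intro T hT
      obtain ⟨κ, hκ0, hκ1⟩ := hκ hT.le
      refine exists_memLp_limit V.continuous_fn hT (v := fun N t => (u N t).toV)
        (fun N => (hu N).continuous_toV) (κ := fun N => T * κ N + κ N / ν)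
        (by simpa using (hκ0.const_mul T).add (hκ0.div_const ν)) (fun N M hNM => ?_)
        fun t ht => hw t ht.1.le
      have hc1 : Continuous fun s => ‖(u N s - u M s).toH‖ ^ 2 := by
        simp only [map_sub]
        exact ((hu N).continuous_toH.sub (hu M).continuous_toH).norm.pow 2
      have hc2 : Continuous fun s => ‖(u N s - u M s).D.toH‖ ^ 2 := by
        simp only [map_sub]
        exact ((hu N).continuous_D_toH.sub (hu M).continuous_D_toH).norm.pow 2
      simp only [← map_sub, SmoothH.norm_toV_sq]
      rw [intervalIntegral.integral_add (hc1.intervalIntegrable _ _)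
        (hc2.intervalIntegrable _ _)]
      refine add_le_add ?_ ?_
      · have h1 : ∫ s in (0 : ℝ)..T, ‖(u N s - u M s).toH‖ ^ 2 ≤ ∫ s in (0 : ℝ)..T, κ N := by
          refine intervalIntegral.integral_mono_on hT.le (hc1.intervalIntegrable _ _)
            intervalIntegrable_const fun s hs => ?_
          have h1 := hκ1 N M hNM s hs
          have h2 := hdiss0 N M s hs.1
          linarith
        rwa [intervalIntegral.integral_const, sub_zero, smul_eq_mul] at h1
      · rw [le_div_iff₀ hν, mul_comm]
        have h1 := hκ1 N M hNM T ⟨hT.le, le_rfl⟩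
        have h2 := sq_nonneg ‖(u N T - u M T).toH‖
        linarith
    -- the limits on different time intervals agree, since `V.fn` is injective
    set v : ℝ → V L := fun t => if h : ∃ p : V L, V.fn p = w t then h.choose else 0 with hv
    have hvw : ∀ {t : ℝ} {p : V L}, V.fn p = w t → V.fn (v t) = w t ∧ v t = p := by
      intro t p hp
      have h : ∃ p : V L, V.fn p = w t := ⟨p, hp⟩
      have h1 : V.fn (v t) = w t := by
        simp only [hv, dif_pos h]
        exact h.choose_spec
      exact ⟨h1, V.fn_injective (h1.trans hp.symm)⟩
    refine ⟨v, ?_, fun T hT => ?_⟩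
    · have hU : Set.Ioi (0 : ℝ) = ⋃ n : ℕ, Set.Ioc 0 ((n : ℝ) + 1) := by
        ext t
        simp only [Set.mem_Ioi, Set.mem_iUnion, Set.mem_Ioc]
        constructor
        · intro ht
          obtain ⟨n, hn⟩ := exists_nat_ge t
          exact ⟨n, ht, by linarith⟩
        · rintro ⟨n, ht, -⟩
          exact ht
      rw [hU, ae_restrict_iUnion_iff]
      intro n
      obtain ⟨F, -, hF2⟩ := hF ((n : ℝ) + 1) (by positivity)
      filter_upwards [hF2] with t ht
      exact congrArg Subtype.val (hvw ht).1
    · obtain ⟨F, hF1, hF2⟩ := hF T hT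
      refine hF1.ae_eq ?_
      filter_upwards [hF2] with t ht
      exact (hvw ht).2.symm
  · intro φ t ht
    set ψ : SmoothH L := ⟨φ.toFun, φ.smooth, φ.mean_zero⟩ with hψ
    have hψN : ∀ N, proj (freq N) (proj (freq N) ψ.toH).toH = proj (freq N) ψ.toH := fun N => by
      rw [proj_proj, Finset.inter_self]
    have happ := fun N => (hu N).inner_eq_integral (hψN N) ht
    have hl : Filter.Tendsto (fun N => inner ℝ (u N t).toH (proj (freq N) ψ.toH).toH)
        Filter.atTop (nhds (inner ℝ (w t) ψ.toH : ℝ)) :=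
      (hw t ht).inner (tendsto_proj ψ.toH)
    have hl0 : Filter.Tendsto (fun N => inner ℝ (u N 0).toH (proj (freq N) ψ.toH).toH)
        Filter.atTop (nhds (inner ℝ u₀ ψ.toH : ℝ)) := by
      have := (hw 0 le_rfl).inner (𝕜 := ℝ) (tendsto_proj ψ.toH)
      rwa [hw0] at this
    -- a bound for the approximations, uniform in time and in the truncation
    obtain ⟨C, hC⟩ : ∃ C : ℝ, ∀ N, ∀ s ∈ Set.Icc 0 t, ‖(u N s).toH‖ ≤ C := by
      refine ⟨Real.sqrt (Real.exp ((2 * |β| + ν) * t) * (‖u₀‖ ^ 2 + ‖f‖ ^ 2 / ν * t)),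
        fun N s hs => Real.le_sqrt_of_sq_le ?_⟩
      have h1 := (hu N).energy_le hν hs.1 hs.2
      have h2 : 0 ≤ ν * ∫ τ in (0 : ℝ)..s, ‖(u N τ).D.toH‖ ^ 2 :=
        mul_nonneg hν.le (intervalIntegral.integral_nonneg hs.1 fun s _ => sq_nonneg _)
      have h3 : ‖(u N 0).toH‖ ≤ ‖u₀‖ := by
        rw [hu0]
        exact norm_proj_le _ _
      have h4 : Real.exp ((2 * |β| + ν) * t) * (‖(u N 0).toH‖ ^ 2 + ‖f‖ ^ 2 / ν * t) ≤
          Real.exp ((2 * |β| + ν) * t) * (‖u₀‖ ^ 2 + ‖f‖ ^ 2 / ν * t) := by gcongr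
      linarith
    obtain ⟨C', hC'⟩ := (((tendsto_rhsBound_proj (ν := ν) (β := β) (γ := γ) (f := f) ψ).norm
      ).bddAbove_range)
    have hi : Filter.Tendsto (fun N => ∫ s in (0 : ℝ)..t,
        rhs ν β γ f (u N s).toH (proj (freq N) ψ.toH)) Filter.atTop
        (nhds (∫ s in (0 : ℝ)..t, rhs ν β γ f (w s) ψ)) := by
      refine intervalIntegral.tendsto_integral_filter_of_dominated_convergence
        (fun _ => (C' + rhsBound ν β γ f ψ) * (1 + C) ^ 2)
        (Filter.Eventually.of_forall fun N => ?_) (Filter.Eventually.of_forall fun N => ?_)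
        intervalIntegrable_const ?_
      · exact ((continuous_rhs _).comp (hu N).continuous_toH).aestronglyMeasurable
      · refine Filter.Eventually.of_forall fun s hs => ?_
        rw [Set.uIoc_of_le ht] at hs
        have h1 := hC N s ⟨hs.1.le, hs.2⟩
        have h2 : rhs ν β γ f (u N s).toH (proj (freq N) ψ.toH) =
            rhs ν β γ f (u N s).toH (proj (freq N) ψ.toH - ψ) + rhs ν β γ f (u N s).toH ψ := by
          rw [map_sub]
          ring
        have h3 := abs_rhs_le (ν := ν) (β := β) (γ := γ) (f := f) (u N s).toH
          (proj (freq N) ψ.toH - ψ)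
        have h4 := abs_rhs_le (ν := ν) (β := β) (γ := γ) (f := f) (u N s).toH ψ
        have h5 : rhsBound ν β γ f (proj (freq N) ψ.toH - ψ) ≤ C' :=
          (le_abs_self _).trans (hC' ⟨N, rfl⟩)
        have h6 : (1 + ‖(u N s).toH‖) ^ 2 ≤ (1 + C) ^ 2 := by gcongr
        rw [h2, Real.norm_eq_abs]
        refine (abs_add_le _ _).trans ?_
        have h7 := rhsBound_nonneg (ν := ν) (β := β) (γ := γ) (f := f) ψ
        have h8 := rhsBound_nonneg (ν := ν) (β := β) (γ := γ) (f := f)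
          (proj (freq N) ψ.toH - ψ)
        rw [add_mul]
        exact add_le_add (h3.trans (mul_le_mul h5 h6 (sq_nonneg _) (h8.trans h5)))
          (h4.trans (mul_le_mul_of_nonneg_left h6 h7))
      · refine Filter.Eventually.of_forall fun s hs => ?_
        rw [Set.uIoc_of_le ht] at hs
        exact tendsto_rhs_proj (hw s hs.1.le) ψ
    have hfin := tendsto_nhds_unique hl (by
      simp only [happ]
      exact hl0.add hi)
    rw [SmoothH.inner_toH_right, SmoothH.inner_toH_right] at hfin
    refine hfin.trans ?_
    congr 1
    refine intervalIntegral.integral_congr fun s _ => ?_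
    exact (weakRHS_test (w s) ψ).symm

end

section

/-! ### The Fejér kernel -/

/-- The Fejér kernel, normalised to have mean value one over a period. -/
def fejer (n : ℕ) (θ : ℝ) : ℝ :=
  ((∑ j ∈ Finset.range n, Real.cos (j * θ)) ^ 2 +
    (∑ j ∈ Finset.range n, Real.sin (j * θ)) ^ 2) / n

theorem fejer_nonneg (n : ℕ) (θ : ℝ) : 0 ≤ fejer n θ := by
  unfold fejer
  positivity

theorem continuous_fejer (n : ℕ) : Continuous (fejer n) := by
  unfold fejer
  fun_prop

theorem fejer_eq_sum (n : ℕ) (θ : ℝ) : fejer n θ =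
    (∑ q ∈ Finset.range n ×ˢ Finset.range n, Real.cos (((q.1 : ℤ) - q.2 : ℤ) * θ)) / n := by
  rw [fejer, pow_two, pow_two, Finset.sum_mul_sum, Finset.sum_mul_sum, Finset.sum_product,
    ← Finset.sum_add_distrib]
  congr 1
  refine Finset.sum_congr rfl fun j _ => ?_
  rw [← Finset.sum_add_distrib]
  refine Finset.sum_congr rfl fun l _ => ?_
  push_cast
  rw [sub_mul, Real.cos_sub]

theorem sum_sin_diff (n : ℕ) (θ : ℝ) :
    ∑ q ∈ Finset.range n ×ˢ Finset.range n, Real.sin (((q.1 : ℤ) - q.2 : ℤ) * θ) = 0 := by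
  have h : ∑ q ∈ Finset.range n ×ˢ Finset.range n, Real.sin (((q.1 : ℤ) - q.2 : ℤ) * θ) =
      ∑ q ∈ Finset.range n ×ˢ Finset.range n, Real.sin (((q.2 : ℤ) - q.1 : ℤ) * θ) := by
    rw [Finset.sum_product, Finset.sum_comm, Finset.sum_product]
  have h2 : ∑ q ∈ Finset.range n ×ˢ Finset.range n, Real.sin (((q.2 : ℤ) - q.1 : ℤ) * θ) =
      - ∑ q ∈ Finset.range n ×ˢ Finset.range n, Real.sin (((q.1 : ℤ) - q.2 : ℤ) * θ) := by
    rw [← Finset.sum_neg_distrib]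
    refine Finset.sum_congr rfl fun q _ => ?_
    rw [← Real.sin_neg]
    congr 1
    push_cast
    ring
  linarith

theorem two_sin_mul_sum_cos (n : ℕ) (α : ℝ) :
    2 * Real.sin α * ∑ j ∈ Finset.range n, Real.cos (j * (2 * α)) =
      Real.sin (2 * n * α - α) + Real.sin α := by
  induction n with
  | zero => simp [Real.sin_neg]
  | succ n ih =>
    rw [Finset.sum_range_succ, mul_add, ih]
    have h1 : 2 * ((n + 1 : ℕ) : ℝ) * α - α = 2 * n * α + α := by push_cast; ring
    have h2 : (n : ℝ) * (2 * α) = 2 * n * α := by ring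
    rw [h1, h2, Real.sin_add, Real.sin_sub]
    ring

theorem two_sin_mul_sum_sin (n : ℕ) (α : ℝ) :
    2 * Real.sin α * ∑ j ∈ Finset.range n, Real.sin (j * (2 * α)) =
      Real.cos α - Real.cos (2 * n * α - α) := by
  induction n with
  | zero => simp [Real.cos_neg]
  | succ n ih =>
    rw [Finset.sum_range_succ, mul_add, ih]
    have h1 : 2 * ((n + 1 : ℕ) : ℝ) * α - α = 2 * n * α + α := by push_cast; ring
    have h2 : (n : ℝ) * (2 * α) = 2 * n * α := by ring
    rw [h1, h2, Real.cos_add, Real.cos_sub]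
    ring

/-- The concentration of the Fejér kernel. -/
theorem sin_sq_mul_fejer_le {n : ℕ} (hn : 0 < n) (α : ℝ) :
    Real.sin α ^ 2 * fejer n (2 * α) ≤ 1 / n := by
  have h1 := two_sin_mul_sum_cos n α
  have h2 := two_sin_mul_sum_sin n α
  have hn' : (0 : ℝ) < n := by exact_mod_cast hn
  rw [fejer, mul_div_assoc', div_le_div_iff_of_pos_right hn']
  set C := ∑ j ∈ Finset.range n, Real.cos (j * (2 * α))
  set S := ∑ j ∈ Finset.range n, Real.sin (j * (2 * α))
  have h3 : 4 * (Real.sin α ^ 2 * (C ^ 2 + S ^ 2)) =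
      (2 * Real.sin α * C) ^ 2 + (2 * Real.sin α * S) ^ 2 := by ring
  rw [h1, h2] at h3
  have h4 := Real.sin_sq_add_cos_sq α
  have h5 := Real.sin_sq_add_cos_sq (2 * n * α - α)
  nlinarith [sq_nonneg (Real.sin (2 * n * α - α) - Real.sin α),
    sq_nonneg (Real.cos α + Real.cos (2 * n * α - α))]

variable {L : ℝ} [Fact (0 < L)]

/-! ### The travelling profile -/

/-- The function `sin (kω(x + s)) + cos (kω(x + s))`, divided by `kω`; it is zero for `k = 0`. -/
def shiftedMode (k : ℤ) (s : ℝ) : SmoothH L :=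
  (Real.sqrt L / (k * omega L)) •
    (Real.cos (k * omega L * s) • e k + Real.sin (k * omega L * s) • e (-k))

/-- The travelling profile, shifted by `s`. It has the constant slope `lam`, except for a steep
descent near `-s`, whose shape is that of the Fejér kernel of order `n`. -/
def profile (lam : ℝ) (n : ℕ) (s : ℝ) : SmoothH L :=
  (-(lam / n)) • ∑ q ∈ Finset.range n ×ˢ Finset.range n, shiftedMode ((q.1 : ℤ) - q.2) s

theorem hasDerivAt_shiftedMode (ℓ : SmoothH L →ₗ[ℝ] ℝ) (k : ℤ) (s : ℝ) :
    HasDerivAt (fun s => ℓ (shiftedMode k s)) (ℓ (shiftedMode k s).D) s := by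
  simp only [shiftedMode, map_smul, map_add, smul_eq_mul, D_e, neg_neg]
  have h : HasDerivAt (fun s : ℝ => (k : ℝ) * omega L * s) (k * omega L) s := by
    simpa using (hasDerivAt_id s).const_mul ((k : ℝ) * omega L)
  refine (((h.cos.mul_const (ℓ (e k))).add (h.sin.mul_const (ℓ (e (-k))))).const_mul
    (Real.sqrt L / (k * omega L))).congr_deriv ?_
  push_cast
  ring

theorem hasDerivAt_profile (ℓ : SmoothH L →ₗ[ℝ] ℝ) (lam : ℝ) (n : ℕ) (s : ℝ) :
    HasDerivAt (fun s => ℓ (profile lam n s)) (ℓ (profile lam n s).D) s := by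
  simp only [profile, map_smul, map_sum, smul_eq_mul]
  exact (HasDerivAt.fun_sum fun q _ => hasDerivAt_shiftedMode ℓ _ s).const_mul _

theorem D_shiftedMode_coe {k : ℤ} (hk : k ≠ 0) (s y : ℝ) :
    (shiftedMode k s : SmoothH L).D.1 (y : AddCircle L) =
      Real.cos (k * (omega L * (y + s))) - Real.sin (k * (omega L * (y + s))) := by
  have hL : 0 < L := Fact.out
  have hsq : Real.sqrt L ≠ 0 := (Real.sqrt_pos.2 hL).ne'
  have hω := (omega_pos (L := L)).ne'
  have hk' : (k : ℝ) ≠ 0 := by exact_mod_cast hk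
  simp only [shiftedMode, map_smul, map_add, D_e, neg_neg, SmoothH.smul_val, SmoothH.add_val,
    Pi.smul_apply, Pi.add_apply, smul_eq_mul, e_coe hk, e_coe (neg_ne_zero.2 hk)]
  have h1 : ((-k : ℤ) : ℝ) * omega L * y = -(k * omega L * y) := by push_cast; ring
  have h2 : (k : ℝ) * (omega L * (y + s)) = k * omega L * y + k * omega L * s := by ring
  rw [h1, h2, Real.cos_neg, Real.sin_neg, Real.cos_add, Real.sin_add]
  push_cast
  field_simp
  ring

theorem D_shiftedMode_zero (s : ℝ) : (shiftedMode 0 s : SmoothH L).D = 0 := by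
  simp [shiftedMode]

theorem D_profile_coe (lam : ℝ) {n : ℕ} (hn : 0 < n) (s y : ℝ) :
    (profile lam n s : SmoothH L).D.1 (y : AddCircle L) =
      lam * (1 - fejer n (omega L * (y + s))) := by
  have hn' : (n : ℝ) ≠ 0 := by exact_mod_cast hn.ne'
  simp only [profile, map_smul, map_sum, SmoothH.smul_val, Pi.smul_apply, smul_eq_mul,
    SmoothH.sum_apply]
  have h : ∀ q ∈ Finset.range n ×ˢ Finset.range n,
      (shiftedMode ((q.1 : ℤ) - q.2) s : SmoothH L).D.1 (y : AddCircle L) =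
        Real.cos (((q.1 : ℤ) - q.2 : ℤ) * (omega L * (y + s))) -
          Real.sin (((q.1 : ℤ) - q.2 : ℤ) * (omega L * (y + s))) -
            if q.1 = q.2 then 1 else 0 := by
    intro q _
    by_cases hq : q.1 = q.2
    · simp [hq, D_shiftedMode_zero, SmoothH.zero_val]
    · have hk : (q.1 : ℤ) - q.2 ≠ 0 := by
        rw [sub_ne_zero]
        exact_mod_cast hq
      rw [D_shiftedMode_coe hk, if_neg hq, sub_zero]
  have hdiag : ∑ q ∈ Finset.range n ×ˢ Finset.range n, (if q.1 = q.2 then (1 : ℝ) else 0) = n := by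
    rw [Finset.sum_product, Finset.sum_congr rfl fun j hj => by
      rw [Finset.sum_ite_eq, if_pos hj]]
    simp
  rw [Finset.sum_congr rfl h, Finset.sum_sub_distrib, Finset.sum_sub_distrib, sum_sin_diff, hdiag,
    fejer_eq_sum]
  generalize ∑ q ∈ Finset.range n ×ˢ Finset.range n,
    Real.cos (((q.1 : ℤ) - q.2 : ℤ) * (omega L * (y + s))) = C
  field_simp
  ring

theorem norm_e_le (k : ℤ) : ‖(e k : SmoothH L).toH‖ ≤ 1 := by
  refine le_of_sq_le_sq ?_ zero_le_one
  rw [← real_inner_self_eq_norm_sq, inner_e_e]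
  split_ifs <;> norm_num

theorem norm_D_pow_e_le (i : ℕ) (k : ℤ) :
    ‖((SmoothH.D (L := L) ^ i) (e k)).toH‖ ≤ (|(k : ℝ)| * omega L) ^ i := by
  have hω := omega_pos (L := L)
  induction i generalizing k with
  | zero => simpa using norm_e_le k
  | succ i ih =>
    rw [pow_succ, Module.End.mul_apply, D_e, map_smul, map_smul, norm_smul, Real.norm_eq_abs,
      abs_mul, abs_of_pos hω, pow_succ, mul_comm]
    have := ih (-k)
    push_cast at this
    rw [abs_neg] at this
    gcongr

/-- The constant in the bounds for the profile. -/
def profileConst (L : ℝ) : ℝ :=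
  2 * Real.sqrt L * (1 / omega L + 1 + omega L + omega L ^ 2)

theorem profileConst_nonneg : 0 ≤ profileConst L := by
  have hω := omega_pos (L := L)
  unfold profileConst
  positivity

theorem norm_D_pow_shiftedMode_le {i n : ℕ} (hi : i ≤ 3) (hn : 0 < n) {k : ℤ}
    (hk : |(k : ℝ)| ≤ n) (s : ℝ) :
    ‖((SmoothH.D (L := L) ^ i) (shiftedMode k s)).toH‖ ≤ profileConst L * n ^ 2 := by
  have hω := omega_pos (L := L)
  have hpc := profileConst_nonneg (L := L)
  by_cases hk0 : k = 0
  · subst hk0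
    simp only [shiftedMode, Int.cast_zero, zero_mul, div_zero, zero_smul, map_zero, norm_zero]
    positivity
  have hk1 : 1 ≤ |(k : ℝ)| := by
    exact_mod_cast Int.one_le_abs hk0
  have hkpos : 0 < |(k : ℝ)| := by linarith
  have h1 : ‖((SmoothH.D (L := L) ^ i) (shiftedMode k s)).toH‖ ≤
      Real.sqrt L / (|(k : ℝ)| * omega L) * (2 * (|(k : ℝ)| * omega L) ^ i) := by
    simp only [shiftedMode, map_smul, map_add, norm_smul, Real.norm_eq_abs, abs_div, abs_mul,
      abs_of_pos hω, abs_of_nonneg (Real.sqrt_nonneg L)]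
    refine mul_le_mul_of_nonneg_left ((norm_add_le _ _).trans ?_) (by positivity)
    rw [norm_smul, norm_smul, Real.norm_eq_abs, Real.norm_eq_abs, two_mul]
    have h2 := norm_D_pow_e_le (L := L) i k
    have h3 := norm_D_pow_e_le (L := L) i (-k)
    push_cast at h3
    rw [abs_neg] at h3
    exact add_le_add
      ((mul_le_of_le_one_left (norm_nonneg _) (Real.abs_cos_le_one _)).trans h2)
      ((mul_le_of_le_one_left (norm_nonneg _) (Real.abs_sin_le_one _)).trans h3)
  refine h1.trans ?_
  have hn1 : (1 : ℝ) ≤ n := by exact_mod_cast hn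
  have hn2 : (1 : ℝ) ≤ (n : ℝ) ^ 2 := one_le_pow₀ hn1
  have hkn2 : |(k : ℝ)| ≤ (n : ℝ) ^ 2 := hk.trans (by nlinarith)
  have hk2n : |(k : ℝ)| ^ 2 ≤ (n : ℝ) ^ 2 := by gcongr
  have hsq := Real.sqrt_nonneg L
  have key : (|(k : ℝ)| * omega L) ^ i / (|(k : ℝ)| * omega L) ≤
      (1 / omega L + 1 + omega L + omega L ^ 2) * n ^ 2 := by
    have hx : 0 < |(k : ℝ)| * omega L := by positivity
    have hone : 0 ≤ 1 / omega L := by positivity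
    have e1 : 0 ≤ (1 / omega L) * (n : ℝ) ^ 2 := by positivity
    have e2 : 0 ≤ omega L * (n : ℝ) ^ 2 := by positivity
    have e3 : 0 ≤ omega L ^ 2 * (n : ℝ) ^ 2 := by positivity
    have hexp : (1 / omega L + 1 + omega L + omega L ^ 2) * (n : ℝ) ^ 2 =
      1 / omega L * n ^ 2 + n ^ 2 + omega L * n ^ 2 + omega L ^ 2 * n ^ 2 := by ring
    rw [hexp]
    interval_cases i
    · have : (|(k : ℝ)| * omega L) ^ 0 / (|(k : ℝ)| * omega L) ≤ 1 / omega L := by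
        rw [pow_zero]
        exact one_div_le_one_div_of_le hω (le_mul_of_one_le_left hω.le hk1)
      have h4 : 1 / omega L ≤ 1 / omega L * (n : ℝ) ^ 2 := le_mul_of_one_le_right hone hn2
      linarith
    · rw [pow_one, div_self hx.ne']
      linarith
    · rw [pow_two, mul_div_assoc, div_self hx.ne', mul_one]
      have : |(k : ℝ)| * omega L ≤ omega L * (n : ℝ) ^ 2 := by
        rw [mul_comm]
        gcongr
      linarith
    · have h5 : (|(k : ℝ)| * omega L) ^ 3 / (|(k : ℝ)| * omega L) =
          omega L ^ 2 * |(k : ℝ)| ^ 2 := by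
        field_simp
      rw [h5]
      have : omega L ^ 2 * |(k : ℝ)| ^ 2 ≤ omega L ^ 2 * (n : ℝ) ^ 2 := by gcongr
      linarith
  calc Real.sqrt L / (|(k : ℝ)| * omega L) * (2 * (|(k : ℝ)| * omega L) ^ i)
      = 2 * Real.sqrt L * ((|(k : ℝ)| * omega L) ^ i / (|(k : ℝ)| * omega L)) := by ring
    _ ≤ 2 * Real.sqrt L * ((1 / omega L + 1 + omega L + omega L ^ 2) * n ^ 2) := by gcongr
    _ = profileConst L * n ^ 2 := by rw [profileConst]; ring

theorem abs_sub_le_of_mem {n : ℕ} {q : ℕ × ℕ} (hq : q ∈ Finset.range n ×ˢ Finset.range n) :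
    |(q.1 : ℤ) - q.2| ≤ n := by
  rw [Finset.mem_product, Finset.mem_range, Finset.mem_range] at hq
  rw [abs_le]
  omega

/-- The profile and its derivatives grow at most polynomially in the amplitude and the order. -/
theorem norm_D_pow_profile_le {i n : ℕ} (hi : i ≤ 3) (hn : 0 < n) {lam : ℝ} (hlam : 0 ≤ lam)
    (s : ℝ) :
    ‖((SmoothH.D (L := L) ^ i) (profile lam n s)).toH‖ ≤ lam * profileConst L * n ^ 3 := by
  have hn' : (0 : ℝ) < n := by exact_mod_cast hn
  simp only [profile, map_smul, map_sum, norm_smul, Real.norm_eq_abs, abs_neg,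
    abs_of_nonneg (div_nonneg hlam hn'.le)]
  have h : ‖∑ q ∈ Finset.range n ×ˢ Finset.range n,
      ((SmoothH.D (L := L) ^ i) (shiftedMode ((q.1 : ℤ) - q.2) s)).toH‖ ≤
        (n * n : ℝ) * (profileConst L * n ^ 2) := by
    refine (norm_sum_le_of_le _ fun q hq => norm_D_pow_shiftedMode_le hi hn ?_ s).trans ?_
    · exact_mod_cast abs_sub_le_of_mem hq
    · rw [Finset.sum_const, Finset.card_product, Finset.card_range, nsmul_eq_mul]
      push_cast
      exact le_rfl
  calc lam / n * ‖∑ q ∈ Finset.range n ×ˢ Finset.range n,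
        ((SmoothH.D (L := L) ^ i) (shiftedMode ((q.1 : ℤ) - q.2) s)).toH‖
      ≤ lam / n * ((n * n : ℝ) * (profileConst L * n ^ 2)) := by gcongr
    _ = lam * profileConst L * n ^ 3 := by field_simp

/-! ### Coercivity -/

/-- The slope of the profile makes the quadratic form of the transport term positive, up to a
contribution of the steep descent. The square of `⟨u, profile_x⟩` compensates the mean of `u` there,
and the deviation from the mean is controlled by the viscosity. -/
theorem profile_coercive {lam : ℝ} (hlam : 0 < lam) {m : ℕ} (hm : 0 < m) (s : ℝ) (u : SmoothH L) :
    1 / 2 * lam * ‖u.toH‖ ^ 2 - lam * L ^ 2 / (4 * m) * ‖u.D.toH‖ ^ 2 ≤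
      1 / 2 * tri (profile lam (m ^ 2) s).D u.toH u.toH +
        1 / (2 * lam * L) * inner ℝ u.toH (profile lam (m ^ 2) s).D.toH ^ 2 := by
  have hL : 0 < L := Fact.out
  have hn : 0 < m ^ 2 := by positivity
  have hm' : (0 : ℝ) < m := by exact_mod_cast hm
  set φ : SmoothH L := profile lam (m ^ 2) s with hφ
  set g : ℝ → ℝ := fun y => fejer (m ^ 2) (omega L * (y + s)) with hg
  have hgc : Continuous g := (continuous_fejer _).comp (by fun_prop)
  have hg0 : ∀ y, 0 ≤ g y := fun y => fejer_nonneg _ _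
  have hDφ : ∀ y : ℝ, φ.D.1 (y : AddCircle L) = lam * (1 - g y) := fun y =>
    D_profile_coe lam hn s y
  -- a period centred at the point of steepest descent
  set a := -s - L / 2 with ha
  have hper : ∀ h : AddCircle L → ℝ, ∫ x, h x = ∫ y in a..a + L, h (y : AddCircle L) := fun h =>
    (AddCircle.intervalIntegral_preimage L a h).symm
  obtain ⟨U, hU⟩ : ∃ U : ℝ → ℝ, ∀ y : ℝ, u.1 (y : AddCircle L) = U y := ⟨_, fun _ => rfl⟩
  have huc : Continuous U := by
    refine (u.continuous.comp (AddCircle.continuous_mk' L)).congr fun y => hU y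
  have hU0 : ∫ y in a..a + L, U y = 0 := by
    have h1 := u.mean_zero
    rw [hper] at h1
    simpa only [hU] using h1
  have hi : ∀ {h : ℝ → ℝ}, Continuous h → IntervalIntegrable h volume a (a + L) :=
    fun hh => hh.intervalIntegrable _ _
  have hI0 : ∫ y in a..a + L, g y = L := by
    have h1 := φ.D.mean_zero
    rw [hper] at h1
    simp only [hDφ] at h1
    rw [intervalIntegral.integral_const_mul, intervalIntegral.integral_sub (hi continuous_const)
      (hi hgc), intervalIntegral.integral_const, smul_eq_mul, mul_one, add_sub_cancel_left] at h1
    have h2 := (mul_eq_zero.1 h1).resolve_left hlam.ne'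
    linarith
  set I1 := ∫ y in a..a + L, U y * g y with hI1
  set I2 := ∫ y in a..a + L, U y ^ 2 * g y with hI2
  have hinner : inner ℝ u.toH φ.D.toH = -lam * I1 := by
    rw [SmoothH.inner_toH, hper]
    simp only [hDφ, hU]
    have h1 : ∀ y : ℝ, U y * (lam * (1 - g y)) =
        lam * U y - lam * (U y * g y) := fun y => by ring
    simp only [h1]
    rw [intervalIntegral.integral_sub (hi (by fun_prop)) (hi (by fun_prop)),
      intervalIntegral.integral_const_mul, intervalIntegral.integral_const_mul, hU0]
    ring
  have htri : tri φ.D u.toH u.toH = lam * ‖u.toH‖ ^ 2 - lam * I2 := by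
    rw [tri_toH_toH, SmoothH.norm_toH_sq, hper, hper]
    simp only [hDφ, hU]
    have h1 : ∀ y : ℝ, U y * U y * (lam * (1 - g y)) =
        lam * U y ^ 2 - lam * (U y ^ 2 * g y) :=
      fun y => by ring
    simp only [h1]
    rw [intervalIntegral.integral_sub (hi (by fun_prop)) (hi (by fun_prop)),
      intervalIntegral.integral_const_mul, intervalIntegral.integral_const_mul]
  set c := U (-s) with hc
  have hvar : ∫ y in a..a + L, (U y - c) ^ 2 * g y =
      I2 - 2 * c * I1 + c ^ 2 * L := by
    have h1 : ∀ y : ℝ, (U y - c) ^ 2 * g y =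
        U y ^ 2 * g y - 2 * c * (U y * g y) + c ^ 2 * g y :=
      fun y => by ring
    simp only [h1]
    rw [intervalIntegral.integral_add (hi (by fun_prop)) (hi (by fun_prop)),
      intervalIntegral.integral_sub (hi (by fun_prop)) (hi (by fun_prop)),
      intervalIntegral.integral_const_mul,
      intervalIntegral.integral_const_mul, hI0]
  have hbound : ∫ y in a..a + L, (U y - c) ^ 2 * g y ≤
      L ^ 2 / (2 * m) * ‖u.D.toH‖ ^ 2 := by
    -- the elementary inequality `2 |sin| ≤ 1 / m + m sin²` balances the two properties of
    -- the kernel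
    have h1 : ∫ y in a..a + L, (U y - c) ^ 2 * g y ≤
        ∫ y in a..a + L, L / 4 * ‖u.D.toH‖ ^ 2 * (1 / m * g y + 1 / m) := by
      refine intervalIntegral.integral_mono_on (by linarith)
        (hi (by fun_prop)) (hi (by fun_prop)) fun y hy => ?_
      have h2 := u.sq_sub_le_sin (a := -s) (y := y) (by
        rw [abs_le]
        constructor <;> linarith [hy.1, hy.2])
      have harg : Real.pi * (y - -s) / L = omega L * (y + s) / 2 := by
        unfold omega
        field_simp
        ring
      rw [harg, hU, hU] at h2
      set α := omega L * (y + s) / 2 with hα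
      have h3 := sin_sq_mul_fejer_le hn α
      have h4 : fejer (m ^ 2) (2 * α) = g y := by
        rw [hα, hg]
        congr 1
        ring
      rw [h4] at h3
      push_cast at h3
      have h5 : |Real.sin α| ≤ 1 / 2 * (1 / m + m * Real.sin α ^ 2) := by
        rw [← sq_abs (Real.sin α)]
        have h6 : 1 / 2 * (1 / m + m * |Real.sin α| ^ 2) - |Real.sin α| =
            (m * |Real.sin α| - 1) ^ 2 / (2 * m) := by
          field_simp
          ring
        have h7 : 0 ≤ (m * |Real.sin α| - 1) ^ 2 / (2 * m) := by positivity
        linarith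
      have h8 : m * (Real.sin α ^ 2 * g y) ≤ 1 / m := by
        calc (m : ℝ) * (Real.sin α ^ 2 * g y) ≤ (m : ℝ) * (1 / (m : ℝ) ^ 2) := by gcongr
          _ = 1 / (m : ℝ) := by field_simp
      calc (U y - c) ^ 2 * g y
          ≤ L / 2 * |Real.sin α| * ‖u.D.toH‖ ^ 2 * g y := mul_le_mul_of_nonneg_right h2 (hg0 y)
        _ ≤ L / 2 * (1 / 2 * (1 / m + m * Real.sin α ^ 2)) * ‖u.D.toH‖ ^ 2 * g y := by
          have := hg0 y
          gcongr
        _ = L / 4 * ‖u.D.toH‖ ^ 2 * (1 / m * g y + m * (Real.sin α ^ 2 * g y)) := by ring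
        _ ≤ L / 4 * ‖u.D.toH‖ ^ 2 * (1 / m * g y + 1 / m) := by gcongr
    refine h1.trans (le_of_eq ?_)
    rw [intervalIntegral.integral_const_mul, intervalIntegral.integral_add
      (hi (by fun_prop)) (hi (by fun_prop)), intervalIntegral.integral_const_mul,
      hI0, intervalIntegral.integral_const, smul_eq_mul, add_sub_cancel_left]
    field_simp
    ring
  rw [hvar] at hbound
  have hsq : 0 ≤ (I1 - c * L) ^ 2 / L := by positivity
  have hsq' : (I1 - c * L) ^ 2 / L = I1 ^ 2 / L - 2 * c * I1 + c ^ 2 * L := by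
    field_simp
    ring
  have hfin : I2 - I1 ^ 2 / L ≤ L ^ 2 / (2 * m) * ‖u.D.toH‖ ^ 2 := by linarith
  rw [htri, hinner]
  have h9 : 1 / (2 * lam * L) * (-lam * I1) ^ 2 = 1 / 2 * lam * (I1 ^ 2 / L) := by
    field_simp
  have h10 := mul_le_mul_of_nonneg_left hfin (by positivity : 0 ≤ 1 / 2 * lam)
  have h11 : 1 / 2 * lam * (L ^ 2 / (2 * m) * ‖u.D.toH‖ ^ 2) =
      lam * L ^ 2 / (4 * m) * ‖u.D.toH‖ ^ 2 := by
    field_simp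
    ring
  rw [h9]
  linarith

end

section

/-! ### The shift of the profile -/

/-- A bounded scalar vector field which is Lipschitz in space and continuous in time has integral
curves on compact intervals. -/
theorem exists_integral_curve {g : ℝ → ℝ → ℝ} {a b M : ℝ} {K : NNReal} (hab : a ≤ b)
    (hM : 0 ≤ M) (hc : ∀ x, ContinuousOn (fun t => g t x) (Set.Icc a b))
    (hb : ∀ t ∈ Set.Icc a b, ∀ x, |g t x| ≤ M) (hK : ∀ t ∈ Set.Icc a b, LipschitzWith K (g t)) :
    ∃ s : ℝ → ℝ, ∀ t ∈ Set.Icc a b, HasDerivWithinAt s (g t (s t)) (Set.Icc a b) t := by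
  have hpl : IsPicardLindelof g (tmin := a) (tmax := b) ⟨a, Set.left_mem_Icc.2 hab⟩ 0
      ⟨M * (b - a), mul_nonneg hM (sub_nonneg.2 hab)⟩ 0 ⟨M, hM⟩ K :=
    { lipschitzOnWith := fun t ht => (hK t ht).lipschitzOnWith
      continuousOn := fun x _ => hc x
      norm_le := fun t ht x _ => hb t ht x
      mul_max_le := by
        simp only [sub_self, max_eq_left (sub_nonneg.2 hab), NNReal.coe_zero, sub_zero]
        exact le_rfl }
  obtain ⟨s, -, hs⟩ := hpl.exists_eq_forall_mem_Icc_hasDerivWithinAt₀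
  exact ⟨s, hs⟩

variable {L : ℝ} [Fact (0 < L)] {ν β γ : ℝ} {f : StrongDual ℝ (V L)}

theorem proj_e {N : ℕ} {k : ℤ} (hk : |k| ≤ N) : proj (freq N) (e k : SmoothH L).toH = e k := by
  by_cases hk0 : k = 0
  · rw [hk0, e_zero, map_zero, map_zero]
  refine SmoothH.eq_of_inner_e fun j => ?_
  rw [inner_proj_e, inner_e_e]
  by_cases hkj : k = j
  · subst hkj
    rw [if_pos (mem_freq.2 ⟨hk0, hk⟩)]
  · simp [hkj]

/-- The profile of order `n` has frequencies up to `n`, so that it is a test function for the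
Galerkin approximation. -/
theorem proj_profile {n N : ℕ} (hnN : n ≤ N) (lam s : ℝ) :
    proj (freq N) (profile lam n s : SmoothH L).toH = profile lam n s := by
  simp only [profile, map_smul, map_sum]
  congr 1
  refine Finset.sum_congr rfl fun q hq => ?_
  have h : |(q.1 : ℤ) - q.2| ≤ N := (abs_sub_le_of_mem hq).trans (by exact_mod_cast hnN)
  simp only [shiftedMode, map_smul, map_add]
  rw [proj_e h, proj_e (by rwa [abs_neg])]

namespace IsGalerkin

variable {N : ℕ} {u : ℝ → SmoothH L}

/-- The shift follows the mean of `u` against the slope of the profile. -/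
theorem exists_shift (hu : IsGalerkin ν β γ f N u) {lam : ℝ} (hlam : 0 ≤ lam) {n : ℕ} (hn : 0 < n)
    (κ : ℝ) {t₀ t₁ : ℝ} (ht : t₀ ≤ t₁) : ∃ s : ℝ → ℝ, ∀ t ∈ Set.Icc t₀ t₁,
      HasDerivWithinAt s (κ * inner ℝ (u t).toH (profile lam n (s t)).D.toH)
        (Set.Icc t₀ t₁) t := by
  have hpc := profileConst_nonneg (L := L)
  obtain ⟨B, hB⟩ := isCompact_Icc.exists_bound_of_continuousOn
    (hu.continuous_toH.continuousOn (s := Set.Icc t₀ t₁))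
  have hB0 : 0 ≤ B := (norm_nonneg _).trans (hB t₀ (Set.left_mem_Icc.2 ht))
  set M : ℝ := |κ| * (B * (lam * profileConst L * n ^ 3)) with hM
  have hM0 : 0 ≤ M := by positivity
  have hbound : ∀ t ∈ Set.Icc t₀ t₁, ∀ φ : SmoothH L,
      ‖φ.toH‖ ≤ lam * profileConst L * n ^ 3 → |κ * inner ℝ (u t).toH φ.toH| ≤ M := by
    intro t ht φ hφ
    rw [abs_mul]
    refine mul_le_mul_of_nonneg_left ((abs_real_inner_le_norm _ _).trans ?_) (abs_nonneg κ)
    exact mul_le_mul (hB t ht) hφ (norm_nonneg _) hB0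
  refine exists_integral_curve (K := ⟨M, hM0⟩)
    (g := fun t x => κ * inner ℝ (u t).toH (profile lam n x).D.toH) ht hM0
    (fun x => ?_) (fun t ht x => ?_) (fun t ht => ?_)
  · exact (continuous_const.mul (hu.continuous_toH.inner continuous_const)).continuousOn
  · refine hbound t ht _ ?_
    simpa using norm_D_pow_profile_le (L := L) (i := 1) (by norm_num) hn hlam x
  · have hd : ∀ x, HasDerivAt (fun x => κ * inner ℝ (u t).toH (profile lam n x).D.toH)
        (κ * inner ℝ (u t).toH (profile lam n x).D.D.toH) x := fun x =>
      (hasDerivAt_profile ((innerₗ (H L) (u t).toH).comp (SmoothH.toH.comp SmoothH.D))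
        lam n x).const_mul κ
    refine lipschitzWith_of_nnnorm_deriv_le (fun x => (hd x).differentiableAt) fun x => ?_
    rw [(hd x).deriv]
    refine hbound t ht _ ?_
    simpa [pow_succ] using norm_D_pow_profile_le (L := L) (i := 2) (by norm_num) hn hlam x

theorem hasDerivAt_inner_profile (hu : IsGalerkin ν β γ f N u) {lam : ℝ} {n : ℕ} (hn : n ≤ N)
    {s : ℝ → ℝ} {s' t : ℝ} (ht : 0 ≤ t) (hs : HasDerivAt s s' t) :
    HasDerivAt (fun t => inner ℝ (u t).toH (profile lam n (s t)).toH)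
      (rhs ν β γ f (u t).toH (profile lam n (s t)) +
        s' * inner ℝ (u t).toH (profile lam n (s t)).D.toH) t := by
  have h1 : ∀ (t : ℝ) (w : H L), inner ℝ (u t).toH w = ∑ k ∈ freq N,
      (inner ℝ (u t).toH (e k : SmoothH L).toH : ℝ) * inner ℝ (e k : SmoothH L).toH w := by
    intro t w
    conv_lhs => rw [← hu.spectrum t]
    rw [inner_proj_left]
    exact Finset.sum_congr rfl fun k _ => by rw [real_inner_comm w]
  have h2 : rhs ν β γ f (u t).toH (profile lam n (s t)) = ∑ k ∈ freq N,
      (inner ℝ (profile lam n (s t)).toH (e k : SmoothH L).toH : ℝ) *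
        rhs ν β γ f (u t).toH (e k) := by
    rw [sum_inner_mul_rhs, proj_profile hn]
  rw [funext fun t => h1 t (profile lam n (s t)).toH, h1 t (profile lam n (s t)).D.toH,
    h2, Finset.mul_sum, ← Finset.sum_add_distrib]
  refine HasDerivAt.fun_sum fun k hk => ?_
  have h3 : HasDerivAt (fun t => inner ℝ (e k : SmoothH L).toH (profile lam n (s t)).toH)
      (inner ℝ (e k : SmoothH L).toH (profile lam n (s t)).D.toH * s') t :=
    HasDerivAt.comp t
      (hasDerivAt_profile ((innerₗ (H L) (e k : SmoothH L).toH).comp SmoothH.toH) lam n (s t)) hs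
  refine ((hu.hasDerivAt_coeff t ht k hk).mul h3).congr_deriv ?_
  rw [real_inner_comm (profile lam n (s t)).toH]
  ring

end IsGalerkin

/-! ### Decay of the Lyapunov functional -/

/-- In the right-hand side only the transport term is kept; the linear terms and the forcing are
bounded by the size `Φ` of the test function and its derivatives. -/
theorem neg_rhs_le_of_norm_le {φ u : SmoothH L} {Φ : ℝ} (hΦ : 0 ≤ Φ)
    (h0 : ‖φ.toH‖ ≤ Φ) (h1 : ‖φ.D.toH‖ ≤ Φ) (h2 : ‖φ.D.D.toH‖ ≤ Φ) (h3 : ‖φ.D.D.D.toH‖ ≤ Φ) :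
    -rhs ν β γ f u.toH φ ≤ -(1 / 2 * tri φ.D u.toH u.toH) +
      (|ν| + |β| + |γ|) * (‖u.toH‖ * Φ) + 2 * ‖f‖ * Φ := by
  rw [rhs_apply]
  have hin : ∀ (c : ℝ) (ψ : SmoothH L), ‖ψ.toH‖ ≤ Φ →
      -(c * inner ℝ u.toH ψ.toH) ≤ |c| * (‖u.toH‖ * Φ) := by
    intro c ψ hψ
    refine (neg_le_abs _).trans ?_
    rw [abs_mul]
    exact mul_le_mul_of_nonneg_left ((abs_real_inner_le_norm _ _).trans
      (mul_le_mul_of_nonneg_left hψ (norm_nonneg _))) (abs_nonneg c)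
  have hV : ‖φ.toV‖ ≤ 2 * Φ := by
    refine le_of_sq_le_sq ?_ (by positivity)
    rw [φ.norm_toV_sq]
    nlinarith [norm_nonneg φ.toH, norm_nonneg φ.D.toH]
  have hf : -f φ.toV ≤ 2 * ‖f‖ * Φ := by
    refine (neg_le_abs _).trans ((f.le_opNorm φ.toV).trans ?_)
    nlinarith [mul_le_mul_of_nonneg_left hV (norm_nonneg f)]
  have e2 := hin ν _ h2
  have e0 := hin β _ h0
  have e3 := hin γ _ h3
  linarith

/-- The decay rate of the Lyapunov functional. The hypotheses on `lam` absorb the terms of lower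
order; the one on `m` lets the viscosity control the deviation of `u` from its mean on the steep
descent of the profile. -/
theorem lyapunov_rate_le (hν : 0 < ν) {lam : ℝ} (hlam1 : 1 ≤ lam) (hlam : 8 * |β| + 4 * ν ≤ lam)
    {m : ℕ} (hm : 0 < m) (hm2 : lam * L ^ 2 ≤ 2 * ν * m) (s : ℝ) (u : SmoothH L) {Φ : ℝ}
    (hΦ : lam * profileConst L * ((m ^ 2 : ℕ) : ℝ) ^ 3 = Φ) :
    rhs ν β γ f u.toH u - rhs ν β γ f u.toH (profile lam (m ^ 2) s) -
        1 / (2 * lam * L) * inner ℝ u.toH (profile lam (m ^ 2) s).D.toH ^ 2 ≤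
      -(lam / 4) * ‖u.toH‖ ^ 2 + 2 * (|ν| + |β| + |γ|) ^ 2 * Φ ^ 2 + 2 * ‖f‖ * Φ +
        ‖f‖ ^ 2 / (2 * ν) := by
  have hlam0 : 0 < lam := by linarith
  have hpc := profileConst_nonneg (L := L)
  have hΦ0 : 0 ≤ Φ := by rw [← hΦ]; positivity
  have hn : 0 < m ^ 2 := by positivity
  have hm' : (0 : ℝ) < m := by exact_mod_cast hm
  have hd : ∀ i ≤ 3, ‖((SmoothH.D (L := L) ^ i) (profile lam (m ^ 2) s)).toH‖ ≤ Φ := fun i hi =>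
    (norm_D_pow_profile_le hi hn hlam0.le s).trans_eq hΦ
  set φ : SmoothH L := profile lam (m ^ 2) s with hφ
  have h1 : -rhs ν β γ f u.toH φ ≤ -(1 / 2 * tri φ.D u.toH u.toH) +
      (|ν| + |β| + |γ|) * (‖u.toH‖ * Φ) + 2 * ‖f‖ * Φ := by
    refine neg_rhs_le_of_norm_le hΦ0 ?_ ?_ ?_ ?_
    · simpa using hd 0 (by norm_num)
    · simpa using hd 1 (by norm_num)
    · simpa [pow_succ] using hd 2 (by norm_num)
    · simpa [pow_succ] using hd 3 (by norm_num)
  have h2 : 1 / 2 * lam * ‖u.toH‖ ^ 2 - lam * L ^ 2 / (4 * m) * ‖u.D.toH‖ ^ 2 ≤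
      1 / 2 * tri φ.D u.toH u.toH + 1 / (2 * lam * L) * inner ℝ u.toH φ.D.toH ^ 2 :=
    profile_coercive hlam0 hm s u
  have h3 : lam * L ^ 2 / (4 * m) ≤ ν / 2 := by
    rw [div_le_div_iff₀ (by positivity) (by norm_num)]
    linarith
  have h4 := mul_le_mul_of_nonneg_right h3 (sq_nonneg ‖u.D.toH‖)
  have h5 : f u.toV ≤ ‖f‖ ^ 2 / (2 * ν) + ν / 2 * (‖u.toH‖ ^ 2 + ‖u.D.toH‖ ^ 2) := by
    refine (le_abs_self _).trans ((f.le_opNorm u.toV).trans ?_)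
    rw [← u.norm_toV_sq]
    have h6 : ‖f‖ ^ 2 / (2 * ν) + ν / 2 * ‖u.toV‖ ^ 2 - ‖f‖ * ‖u.toV‖ =
        (‖f‖ - ν * ‖u.toV‖) ^ 2 / (2 * ν) := by
      field_simp
      ring
    have h7 : 0 ≤ (‖f‖ - ν * ‖u.toV‖) ^ 2 / (2 * ν) := by positivity
    linarith
  have h8 : β * ‖u.toH‖ ^ 2 ≤ |β| * ‖u.toH‖ ^ 2 :=
    mul_le_mul_of_nonneg_right (le_abs_self β) (sq_nonneg _)
  have h9 : (|ν| + |β| + |γ|) * (‖u.toH‖ * Φ) ≤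
      1 / 8 * ‖u.toH‖ ^ 2 + 2 * (|ν| + |β| + |γ|) ^ 2 * Φ ^ 2 := by
    nlinarith [sq_nonneg (‖u.toH‖ - 4 * ((|ν| + |β| + |γ|) * Φ))]
  have h10 : 0 ≤ (lam - 1) * ‖u.toH‖ ^ 2 := mul_nonneg (by linarith) (sq_nonneg _)
  have h11 : 0 ≤ (lam - (8 * |β| + 4 * ν)) * ‖u.toH‖ ^ 2 := mul_nonneg (by linarith) (sq_nonneg _)
  rw [rhs_self]
  linarith

theorem exp_decay {y y' : ℝ → ℝ} {κ Q t₀ t₁ : ℝ} (ht : t₀ ≤ t₁)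
    (hy : ContinuousOn y (Set.Icc t₀ t₁)) (hy' : ∀ t ∈ Set.Ioo t₀ t₁, HasDerivAt y (y' t) t)
    (hle : ∀ t ∈ Set.Ioo t₀ t₁, y' t ≤ -κ * (y t - Q)) :
    y t₁ - Q ≤ Real.exp (-κ * (t₁ - t₀)) * (y t₀ - Q) := by
  have hanti : AntitoneOn (fun t => Real.exp (κ * (t - t₁)) * (y t - Q)) (Set.Icc t₀ t₁) := by
    refine antitoneOn_of_hasDerivWithinAt_nonpos (convex_Icc t₀ t₁)
      (f' := fun t => Real.exp (κ * (t - t₁)) * κ * (y t - Q) + Real.exp (κ * (t - t₁)) * y' t)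
      ?_ ?_ ?_
    · exact (Continuous.continuousOn (by fun_prop)).mul (hy.sub continuousOn_const)
    · intro t ht
      rw [interior_Icc] at ht
      have h1 : HasDerivAt (fun t => κ * (t - t₁)) κ t := by
        simpa using ((hasDerivAt_id t).sub_const t₁).const_mul κ
      exact (h1.exp.mul ((hy' t ht).sub_const Q)).hasDerivWithinAt
    · intro t ht
      rw [interior_Icc] at ht
      have h1 := mul_le_mul_of_nonneg_left (hle t ht) (Real.exp_nonneg (κ * (t - t₁)))
      linarith
  have h := hanti (Set.left_mem_Icc.2 ht) (Set.right_mem_Icc.2 ht) ht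
  simp only [sub_self, mul_zero, Real.exp_zero, one_mul] at h
  refine h.trans_eq ?_
  congr 2
  ring

/-- Up to an additive constant, the energy decays at the rate `lam / 4`. -/
theorem IsGalerkin.decay {N : ℕ} {u : ℝ → SmoothH L} (hu : IsGalerkin ν β γ f N u) (hν : 0 < ν)
    {lam : ℝ} (hlam1 : 1 ≤ lam) (hlam : 8 * |β| + 4 * ν ≤ lam)
    {m : ℕ} (hm : 0 < m) (hm2 : lam * L ^ 2 ≤ 2 * ν * m) (hN : m ^ 2 ≤ N) {Φ : ℝ}
    (hΦ : lam * profileConst L * ((m ^ 2 : ℕ) : ℝ) ^ 3 = Φ)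
    {t₀ t₁ : ℝ} (ht0 : 0 ≤ t₀) (ht : t₀ ≤ t₁) :
    ‖(u t₁).toH‖ ^ 2 ≤ 4 * Real.exp (-(lam / 4) * (t₁ - t₀)) * ‖(u t₀).toH‖ ^ 2 + 6 * Φ ^ 2 +
      16 * (lam / 8 * Φ ^ 2 + 2 * (|ν| + |β| + |γ|) ^ 2 * Φ ^ 2 + 2 * ‖f‖ * Φ +
        ‖f‖ ^ 2 / (2 * ν)) := by
  have hlam0 : 0 < lam := by linarith
  have hL : 0 < L := Fact.out
  have hpc := profileConst_nonneg (L := L)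
  have hn : 0 < m ^ 2 := by positivity
  have hΦ0 : 0 ≤ Φ := by rw [← hΦ]; positivity
  set Q := lam / 8 * Φ ^ 2 + 2 * (|ν| + |β| + |γ|) ^ 2 * Φ ^ 2 + 2 * ‖f‖ * Φ +
    ‖f‖ ^ 2 / (2 * ν) with hQ
  have hQ0 : 0 ≤ Q := by positivity
  obtain ⟨s, hs⟩ := hu.exists_shift hlam0.le hn (1 / (2 * lam * L)) ht
  set φ : ℝ → SmoothH L := fun t => profile lam (m ^ 2) (s t) with hφ
  -- the Lyapunov functional; it is comparable to the energy up to multiples of `Φ ^ 2`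
  set y : ℝ → ℝ := fun t => 1 / 2 * ‖(u t).toH‖ ^ 2 - inner ℝ (u t).toH (φ t).toH with hy
  have hin : ∀ t, |inner ℝ (u t).toH (φ t).toH| ≤ ‖(u t).toH‖ * Φ := fun t =>
    (abs_real_inner_le_norm _ _).trans (mul_le_mul_of_nonneg_left (by
      have := norm_D_pow_profile_le (L := L) (i := 0) (by norm_num) hn hlam0.le (s t)
      rw [hΦ] at this
      simpa using this) (norm_nonneg _))
  have hupper : ∀ t, y t ≤ ‖(u t).toH‖ ^ 2 + 1 / 2 * Φ ^ 2 := by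
    intro t
    have h1 := (abs_le.1 (hin t)).1
    simp only [hy]
    nlinarith [sq_nonneg (‖(u t).toH‖ - Φ)]
  have hlower : ∀ t, 1 / 4 * ‖(u t).toH‖ ^ 2 - Φ ^ 2 ≤ y t := by
    intro t
    have h1 := (abs_le.1 (hin t)).2
    simp only [hy]
    nlinarith [sq_nonneg (‖(u t).toH‖ - 2 * Φ)]
  have hscont : ContinuousOn s (Set.Icc t₀ t₁) := fun t ht => (hs t ht).continuousWithinAt
  have hprof : Continuous fun x : ℝ => (profile lam (m ^ 2) x : SmoothH L).toH := by
    simp only [profile, shiftedMode, map_smul, map_sum, map_add]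
    fun_prop
  have hycont : ContinuousOn y (Set.Icc t₀ t₁) := by
    refine ContinuousOn.sub (Continuous.continuousOn ?_) ?_
    · exact continuous_const.mul (hu.continuous_toH.norm.pow 2)
    · exact hu.continuous_toH.continuousOn.inner (hprof.comp_continuousOn hscont)
  have hyder : ∀ t ∈ Set.Ioo t₀ t₁, HasDerivAt y
      (rhs ν β γ f (u t).toH (u t) - rhs ν β γ f (u t).toH (φ t) -
        1 / (2 * lam * L) * inner ℝ (u t).toH (φ t).D.toH ^ 2) t := by
    intro t ht
    have hst := (hs t (Set.Ioo_subset_Icc_self ht)).hasDerivAt (Icc_mem_nhds ht.1 ht.2)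
    have ht00 : 0 ≤ t := ht0.trans ht.1.le
    refine (((hu.hasDerivAt_energy ht00).const_mul (1 / 2)).sub
      (hu.hasDerivAt_inner_profile hN ht00 hst)).congr_deriv ?_
    simp only [hφ]
    ring
  have hmain := exp_decay (κ := lam / 4) (Q := 4 * Q / lam) ht hycont hyder fun t _ => by
    have h1 := lyapunov_rate_le (β := β) (γ := γ) (f := f) hν hlam1 hlam hm hm2 (s t) (u t) hΦ
    have h2 := mul_le_mul_of_nonneg_left (hupper t) (by positivity : 0 ≤ lam / 4)
    have h3 : -(lam / 4) * (y t - 4 * Q / lam) = -(lam / 4) * y t + Q := by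
      field_simp
      ring
    rw [h3]
    linarith
  have hexp : Real.exp (-(lam / 4) * (t₁ - t₀)) ≤ 1 :=
    Real.exp_le_one_iff.2 (by nlinarith)
  have hexp0 := Real.exp_nonneg (-(lam / 4) * (t₁ - t₀))
  set E := Real.exp (-(lam / 4) * (t₁ - t₀))
  have hQl : 4 * Q / lam ≤ 4 * Q := div_le_self (by positivity) hlam1
  have hQl0 : 0 ≤ 4 * Q / lam := by positivity
  have h1 : E * (y t₀ - 4 * Q / lam) ≤ E * (‖(u t₀).toH‖ ^ 2 + 1 / 2 * Φ ^ 2) :=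
    mul_le_mul_of_nonneg_left (by linarith [hupper t₀]) hexp0
  have h2 : E * (1 / 2 * Φ ^ 2) ≤ 1 / 2 * Φ ^ 2 := mul_le_of_le_one_left (by positivity) hexp
  have h3 := hlower t₁
  linarith

/-- The additive constant in the decay estimate grows only polynomially in the decay rate. -/
theorem exists_decay (hν : 0 < ν) (β γ : ℝ) (f : StrongDual ℝ (V L)) :
    ∃ C lam₀ : ℝ, 1 ≤ C ∧ 1 ≤ lam₀ ∧
    ∀ lam, lam₀ ≤ lam → ∃ n : ℕ, ∀ N, n ≤ N → ∀ u : ℝ → SmoothH L, IsGalerkin ν β γ f N u →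
      ∀ t₀ t₁, 0 ≤ t₀ → t₀ ≤ t₁ → ‖(u t₁).toH‖ ^ 2 ≤
        4 * Real.exp (-(lam / 4) * (t₁ - t₀)) * ‖(u t₀).toH‖ ^ 2 + C * lam ^ 15 := by
  have hpc := profileConst_nonneg (L := L)
  set B : ℝ := L ^ 2 / (2 * ν) + 2 with hB
  have hB0 : 0 < B := by positivity
  set a : ℝ := profileConst L * B ^ 6 with ha
  have ha0 : 0 ≤ a := by positivity
  set K : ℝ := |ν| + |β| + |γ| with hK
  -- `m` is at most `lam * B`, hence `Φ` is at most `a * lam ^ 7`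
  refine ⟨a ^ 2 * (24 + 32 * K ^ 2) + 16 * ‖f‖ ^ 2 + 8 * ‖f‖ ^ 2 / ν + 1,
    1 + 8 * |β| + 4 * ν, ?_, ?_, fun lam hlam => ?_⟩
  · have : 0 ≤ a ^ 2 * (24 + 32 * K ^ 2) + 16 * ‖f‖ ^ 2 + 8 * ‖f‖ ^ 2 / ν := by positivity
    linarith
  · have := abs_nonneg β
    linarith
  have hβ := abs_nonneg β
  have hlam1 : 1 ≤ lam := by linarith
  have hlam0 : 0 < lam := by linarith
  -- a steep descent of width proportional to `1 / m ^ 2`, narrow enough for the viscosity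
  set m : ℕ := ⌈lam * L ^ 2 / (2 * ν)⌉₊ + 1 with hm
  have hm1 : lam * L ^ 2 / (2 * ν) ≤ m := by
    rw [hm]
    push_cast
    linarith [Nat.le_ceil (lam * L ^ 2 / (2 * ν))]
  have hm2 : lam * L ^ 2 ≤ 2 * ν * m := by
    rw [div_le_iff₀ (by positivity)] at hm1
    linarith
  have hm3 : (m : ℝ) ≤ lam * B := by
    have h1 := Nat.ceil_lt_add_one (by positivity : 0 ≤ lam * L ^ 2 / (2 * ν))
    have h2 : lam * B = lam * L ^ 2 / (2 * ν) + 2 * lam := by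
      rw [hB]
      ring
    rw [hm, h2]
    push_cast
    linarith
  refine ⟨m ^ 2, fun N hN u hu t₀ t₁ ht0 ht => ?_⟩
  have h := hu.decay hν hlam1 (by linarith) (Nat.succ_pos _) hm2 hN rfl ht0 ht
  refine h.trans ?_
  set Φ : ℝ := lam * profileConst L * ((m ^ 2 : ℕ) : ℝ) ^ 3 with hΦ
  have hΦ0 : 0 ≤ Φ := by positivity
  have hΦ1 : Φ ≤ a * lam ^ 7 := by
    calc Φ = lam * profileConst L * (m : ℝ) ^ 6 := by rw [hΦ]; push_cast; ring
      _ ≤ lam * profileConst L * (lam * B) ^ 6 := by gcongr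
      _ = a * lam ^ 7 := by rw [ha]; ring
  have hΦ2 : Φ ^ 2 ≤ a ^ 2 * lam ^ 14 := by
    calc Φ ^ 2 ≤ (a * lam ^ 7) ^ 2 := by gcongr
      _ = a ^ 2 * lam ^ 14 := by ring
  have hf : 2 * ‖f‖ * Φ ≤ ‖f‖ ^ 2 + Φ ^ 2 := two_mul_le_add_sq _ _
  have hp : 1 ≤ lam ^ 15 := one_le_pow₀ hlam1
  have hp14 : lam ^ 14 ≤ lam ^ 15 := pow_le_pow_right₀ hlam1 (by norm_num)
  have e1 : Φ ^ 2 * (22 + 32 * K ^ 2 + 2 * lam) ≤ a ^ 2 * (24 + 32 * K ^ 2) * lam ^ 15 := by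
    calc Φ ^ 2 * (22 + 32 * K ^ 2 + 2 * lam)
        ≤ a ^ 2 * lam ^ 14 * ((22 + 32 * K ^ 2) * lam + 2 * lam) := by
          refine mul_le_mul hΦ2 ?_ (by positivity) (by positivity)
          have : 22 + 32 * K ^ 2 ≤ (22 + 32 * K ^ 2) * lam :=
            le_mul_of_one_le_right (by positivity) hlam1
          linarith
      _ = a ^ 2 * (24 + 32 * K ^ 2) * lam ^ 15 := by ring
  have e2 : 16 * ‖f‖ ^ 2 + 8 * ‖f‖ ^ 2 / ν ≤ (16 * ‖f‖ ^ 2 + 8 * ‖f‖ ^ 2 / ν) * lam ^ 15 :=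
    le_mul_of_one_le_right (by positivity) hp
  have e3 : 16 * (‖f‖ ^ 2 / (2 * ν)) = 8 * ‖f‖ ^ 2 / ν := by
    field_simp
    ring
  linarith

end

section

/-! ### The absorbing ball -/

theorem two_pow_le_exp : (2 : ℝ) ^ 18 ≤ Real.exp 18 := by
  have h1 : (2 : ℝ) ≤ Real.exp 1 := by linarith [Real.add_one_le_exp (1 : ℝ)]
  calc (2 : ℝ) ^ 18 ≤ Real.exp 1 ^ 18 := by gcongr
    _ = Real.exp 18 := by
      rw [← Real.exp_nat_mul]
      norm_num

variable {L : ℝ} [Fact (0 < L)] {ν β γ : ℝ} {f : StrongDual ℝ (V L)}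

/-- At every nonnegative time, an energy of at most `2 C (Λ 2 ^ k) ^ 15` falls to `2 C Λ ^ 15`
within a time that is bounded uniformly in `k`: one dyadic step, at the decay rate `Λ 2 ^ k / 4`,
takes the time `72 / (Λ 2 ^ k)`. -/
theorem exists_time_of_decay {C lam₀ Λ : ℝ} (hlam₀ : 1 ≤ lam₀) (hΛ : lam₀ ≤ Λ)
    (hdecay : ∀ lam, lam₀ ≤ lam → ∃ n : ℕ, ∀ N, n ≤ N → ∀ u : ℝ → SmoothH L,
      IsGalerkin ν β γ f N u → ∀ t₀ t₁, 0 ≤ t₀ → t₀ ≤ t₁ → ‖(u t₁).toH‖ ^ 2 ≤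
        4 * Real.exp (-(lam / 4) * (t₁ - t₀)) * ‖(u t₀).toH‖ ^ 2 + C * lam ^ 15) (k : ℕ) :
    ∃ n : ℕ, ∀ N, n ≤ N → ∀ u : ℝ → SmoothH L, IsGalerkin ν β γ f N u → ∀ t₀, 0 ≤ t₀ →
      ‖(u t₀).toH‖ ^ 2 ≤ 2 * C * (Λ * 2 ^ k) ^ 15 →
      ∃ t₁, t₀ ≤ t₁ ∧ t₁ ≤ t₀ + 144 / Λ * (1 - (1 / 2) ^ k) ∧
        ‖(u t₁).toH‖ ^ 2 ≤ 2 * C * Λ ^ 15 := by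
  have hΛ0 : 0 < Λ := by linarith
  induction k with
  | zero => exact ⟨0, fun N _ u _ t₀ _ h => ⟨t₀, le_rfl, by simp, by simpa using h⟩⟩
  | succ k ih =>
    have hpow : (1 : ℝ) ≤ 2 ^ k := one_le_pow₀ one_le_two
    set lam := Λ * 2 ^ k with hlam
    have hlam0 : 0 < lam := by positivity
    obtain ⟨n₁, hn₁⟩ := ih
    obtain ⟨n₂, hn₂⟩ := hdecay lam (hΛ.trans (le_mul_of_one_le_right hΛ0.le hpow))
    refine ⟨max n₁ n₂, fun N hN u hu t₀ ht₀ h => ?_⟩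
    have hT : 0 < 72 / lam := by positivity
    have hle : t₀ ≤ t₀ + 72 / lam := by linarith
    have h1 := hn₂ N (le_of_max_le_right hN) u hu t₀ (t₀ + 72 / lam) ht₀ hle
    have h2 : -(lam / 4) * (t₀ + 72 / lam - t₀) = -18 := by
      field_simp
      ring
    rw [h2, Real.exp_neg] at h1
    have h3 : (Real.exp 18)⁻¹ ≤ (2 ^ 18 : ℝ)⁻¹ := inv_anti₀ (by positivity) two_pow_le_exp
    have h4 : Λ * 2 ^ (k + 1) = 2 * lam := by
      rw [hlam]
      ring
    rw [h4, mul_pow] at h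
    have h5 : ‖(u (t₀ + 72 / lam)).toH‖ ^ 2 ≤ 2 * C * lam ^ 15 := by
      -- `4 exp (-18) 2 ^ 15 ≤ 1 / 2`
      refine h1.trans ?_
      have h6 : 4 * (Real.exp 18)⁻¹ * ‖(u t₀).toH‖ ^ 2 ≤
          4 * (2 ^ 18 : ℝ)⁻¹ * (2 * C * (2 ^ 15 * lam ^ 15)) := by gcongr
      linarith
    obtain ⟨t₁, ht₁, ht₁', hu₁⟩ := hn₁ N (le_of_max_le_left hN) u hu _ (ht₀.trans hle) h5
    refine ⟨t₁, hle.trans ht₁, ht₁'.trans (le_of_eq ?_), hu₁⟩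
    rw [hlam, pow_succ, one_div, inv_pow]
    field_simp
    ring

/-- The bound does not depend on the initial energy, which only determines how many modes the
approximation must have. -/
theorem exists_uniform_bound (hν : 0 < ν) (β γ : ℝ) (f : StrongDual ℝ (V L)) {t' : ℝ}
    (ht' : 0 < t') : ∃ R : ℝ, 0 ≤ R ∧ ∀ M : ℝ, ∃ n : ℕ, ∀ N, n ≤ N → ∀ u : ℝ → SmoothH L,
      IsGalerkin ν β γ f N u → ‖(u 0).toH‖ ^ 2 ≤ M → ∀ t, t' ≤ t → ‖(u t).toH‖ ^ 2 ≤ R := by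
  obtain ⟨C, lam₀, hC, hlam₀, hdecay⟩ := exists_decay hν β γ f
  set Λ := max lam₀ (144 / t') with hΛdef
  have hΛ : lam₀ ≤ Λ := le_max_left _ _
  have hΛ1 : 1 ≤ Λ := hlam₀.trans hΛ
  have hΛ0 : 0 < Λ := by linarith
  have hΛt : 144 / Λ ≤ t' := by
    rw [div_le_iff₀ hΛ0]
    have := (div_le_iff₀ ht').1 (le_max_right lam₀ (144 / t'))
    rwa [mul_comm] at this
  refine ⟨9 * C * Λ ^ 15, by positivity, fun M => ?_⟩
  obtain ⟨k, hk⟩ := pow_unbounded_of_one_lt M (one_lt_two (α := ℝ))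
  obtain ⟨n₁, hn₁⟩ := exists_time_of_decay hlam₀ hΛ hdecay k
  obtain ⟨n₂, hn₂⟩ := hdecay Λ hΛ
  refine ⟨max n₁ n₂, fun N hN u hu hM t ht => ?_⟩
  have hpow : (1 : ℝ) ≤ 2 ^ k := one_le_pow₀ one_le_two
  have hY : M ≤ 2 * C * (Λ * 2 ^ k) ^ 15 := by
    calc M ≤ 2 ^ k := hk.le
      _ ≤ Λ * 2 ^ k := le_mul_of_one_le_left (by positivity) hΛ1
      _ ≤ (Λ * 2 ^ k) ^ 15 := le_self_pow₀ (one_le_mul_of_one_le_of_one_le hΛ1 hpow) (by norm_num)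
      _ ≤ 2 * C * (Λ * 2 ^ k) ^ 15 := le_mul_of_one_le_left (by positivity) (by linarith)
  obtain ⟨t₁, ht₁, ht₁', hu₁⟩ :=
    hn₁ N (le_of_max_le_left hN) u hu 0 le_rfl (hM.trans hY)
  have hhalf : (0 : ℝ) ≤ (1 / 2) ^ k := by positivity
  have ht₁t : t₁ ≤ t := by
    have : 144 / Λ * (1 - (1 / 2) ^ k) ≤ 144 / Λ :=
      mul_le_of_le_one_right (by positivity) (by linarith)
    linarith
  have h1 := hn₂ N (le_of_max_le_right hN) u hu t₁ t ht₁ ht₁t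
  have h2 : Real.exp (-(Λ / 4) * (t - t₁)) ≤ 1 := Real.exp_le_one_iff.2 (by
    nlinarith [mul_nonneg hΛ0.le (sub_nonneg.2 ht₁t)])
  have h3 : 4 * Real.exp (-(Λ / 4) * (t - t₁)) * ‖(u t₁).toH‖ ^ 2 ≤
      4 * 1 * (2 * C * Λ ^ 15) := by gcongr
  linarith

theorem not_dense_of_norm_lt {A : Set (H L)} {r : ℝ} (hA : ∀ w ∈ A, ‖w‖ < r) : ¬ Dense A := by
  intro hd
  have hsub : A ⊆ Metric.closedBall 0 r := fun w hw => by
    rw [mem_closedBall_zero_iff]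
    exact (hA w hw).le
  have huniv : (Set.univ : Set (H L)) ⊆ Metric.closedBall 0 r := by
    rw [← hd.closure_eq]
    exact closure_minimal hsub Metric.isClosed_closedBall
  have hnorm : ‖(e 1 : SmoothH L).toH‖ = 1 := by
    have h1 : ‖(e 1 : SmoothH L).toH‖ ^ 2 = 1 := by
      rw [← real_inner_self_eq_norm_sq, inner_e_e]
      simp
    nlinarith [norm_nonneg (e 1 : SmoothH L).toH]
  have h2 := huniv (Set.mem_univ ((|r| + 1) • (e 1 : SmoothH L).toH))
  rw [mem_closedBall_zero_iff, norm_smul, hnorm, mul_one, Real.norm_eq_abs,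
    abs_of_pos (by positivity)] at h2
  linarith [le_abs_self r]

end

end KBS

end

theorem corollary3 (L : ℝ) [Fact (0 < L)] (ν β γ : ℝ) (hν : 0 < ν) (hγ : γ ≠ 0)
    (f : StrongDual ℝ (KBS.V L)) :
    ∃ S : ℝ → KBS.H L → KBS.H L, KBS.IsSolutionSemigroup ν β γ f S ∧
      (∀ t' : ℝ, 0 < t' → ∃ r : ℝ, 0 < r ∧
        ∀ u₀ : KBS.H L, ∀ t : ℝ, t' ≤ t → ‖S t u₀‖ < r) ∧
      ∀ t : ℝ, 0 < t → ¬ Dense (Set.range (S t)) := by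
  choose u hu hu0 using fun (u₀ : KBS.H L) (N : ℕ) =>
    KBS.exists_galerkin (β := β) (γ := γ) (f := f) hν N u₀
  choose w hw hlim using fun u₀ : KBS.H L =>
    KBS.exists_solution_of_galerkin hν (hu u₀) (hu0 u₀)
  have hball : ∀ t' : ℝ, 0 < t' → ∃ r : ℝ, 0 < r ∧
      ∀ u₀ : KBS.H L, ∀ t : ℝ, t' ≤ t → ‖w u₀ t‖ < r := by
    intro t' ht'
    obtain ⟨R, hR, hbound⟩ := KBS.exists_uniform_bound hν β γ f ht'
    refine ⟨Real.sqrt R + 1, by positivity, fun u₀ t ht => ?_⟩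
    obtain ⟨n, hn⟩ := hbound (‖u₀‖ ^ 2)
    have h1 : ‖w u₀ t‖ ≤ Real.sqrt R := by
      refine le_of_tendsto (hlim u₀ t (ht'.le.trans ht)).norm ?_
      filter_upwards [Filter.eventually_ge_atTop n] with N hN
      refine Real.le_sqrt_of_sq_le (hn N hN _ (hu u₀ N) ?_ t ht)
      rw [hu0 u₀ N]
      exact pow_le_pow_left₀ (norm_nonneg _) (KBS.norm_proj_le _ _) 2
    linarith
  refine ⟨fun t u₀ => w u₀ t, fun u₀ => ⟨hw u₀, fun v hv t ht =>
    KBS.solution_unique hν hv (hw u₀) ht⟩, hball, fun t ht => ?_⟩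
  obtain ⟨r, -, hr⟩ := hball t ht
  refine KBS.not_dense_of_norm_lt (r := r) ?_
  rintro _ ⟨u₀, rfl⟩
  exact hr u₀ t le_rfl
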